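/- Work in the category of all topological spaces, and let $\Delta^n=\{t\in\mathbb{R}^{n+1} : t_i\ge 0,\ \sum_i t_i=1\}$. A simplicial space $X_*$ has \emph{free degeneracies} if there are subspaces $N_k\subseteq X_k$ ($k\ge 0$) such that, for every $k$, the canonical map $\coprod_{\sigma} N_\sigma\to X_k$ is a homeomorphism; here $\sigma$ ranges over all surjective order-preserving maps $[k]\to[n]$ ($n\ge 0$), $N_\sigma$ is a copy of $N_n$, and $N_\sigma\to X_k$ is the restriction of $\sigma^*\colon X_n\to X_k$. The \emph{geometric realization} $|X_*|$ is the quotient space of $\coprod_n X_n\times\Delta^n$ by the equivalence relation generated by $(\theta^*x,t)\sim(x,\theta_*t)$ for all order-preserving $\theta\colon[m]\to[n]$, $x\in X_n$, $t\in\Delta^m$. A continuous map is a \emph{weak equivalence} if it induces a bijection on path components and isomorphisms on all homotopy groups $\pi_n$, $n\ge 1$, at all basepoints of the source. Let $X_*$ and $Y_*$ be simplicial spaces with free degeneracies, and let $f\colon X_*\to Y_*$ be a map of simplicial spaces such that $f_n\colon X_n\to Y_n$ is a weak equivalence for each $n\ge 0$. Then the induced map $|X_*|\to|Y_*|$ is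 a weak equivalence. (No separation or cofibrancy hypotheses are made on the spaces, and $f$ is not assumed to preserve the chosen subspaces $N_k$.) -/

import Mathlib

open CategoryTheory Opposite Simplicial Topology

universe u v

noncomputable section

namespace WeakEquiv

variable {X : Type u} {Y : Type v} [TopologicalSpace X] [TopologicalSpace Y]

/-- The map `π₀ X → π₀ Y` on path components induced by a continuous map. -/
def piZeroMap (f : C(X, Y)) : ZerothHomotopy X → ZerothHomotopy Y :=
  Quotient.map f fun _ _ h => h.map f.continuous

/-- Composition of an `n`-dimensional loop based at `x` with a continuous map. -/
def genLoopMap (f : C(X, Y)) (n : ℕ) (x : X) (p : GenLoop (Fin n) X x) :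
    GenLoop (Fin n) Y (f x) :=
  ⟨f.comp p.1, fun y hy => congrArg f (p.2 y hy)⟩

/-- The map `π_n(X, x) → π_n(Y, f x)` induced by a continuous map. -/
def piMap (f : C(X, Y)) (n : ℕ) (x : X) :
    HomotopyGroup.Pi n X x → HomotopyGroup.Pi n Y (f x) :=
  Quotient.map (genLoopMap f n x) fun _ _ h => ContinuousMap.HomotopicRel.comp_continuousMap h f

/-- A continuous map is a weak equivalence if it induces a bijection on path components and
an isomorphism on all homotopy groups `π_n`, `n ≥ 1`, for all basepoints of the source. -/
def IsWeakEquivalence (f : C(X, Y)) : Prop :=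
  Function.Bijective (piZeroMap f) ∧
    ∀ (n : ℕ) (x : X), Function.Bijective (piMap f (n + 1) x)

end WeakEquiv

namespace SimplicialSpace

/-- The disjoint union of the spaces `X_n × Δⁿ`. -/
abbrev PreRealization (X : SimplicialObject TopCat.{u}) : Type u :=
  Σ n : SimplexCategory, X.obj (op n) × SimplexCategory.toTop₀.obj n

/-- The relation `(θ^* x, t) ∼ (x, θ_* t)` for `θ : [m] → [n]`, `x ∈ X_n`, `t ∈ Δᵐ`. -/
inductive GlueRel (X : SimplicialObject TopCat.{u}) : PreRealization X → PreRealization X → Prop where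
  | mk {m n : SimplexCategory} (θ : m ⟶ n) (x : X.obj (op n))
      (t : SimplexCategory.toTop₀.obj m) :
      GlueRel X ⟨m, X.map θ.op x, t⟩ ⟨n, x, SimplexCategory.toTop₀.map θ t⟩

/-- The geometric realization of a simplicial space: the quotient, with the quotient topology, of
the disjoint union of the `X_n × Δⁿ` (with product topologies, in the category of all topological
spaces) by the equivalence relation generated by `GlueRel`. -/
def Realization (X : SimplicialObject TopCat.{u}) : Type u :=
  Quot (GlueRel X)

instance (X : SimplicialObject TopCat.{u}) : TopologicalSpace (Realization X) :=
  inferInstanceAs (TopologicalSpace (Quot (GlueRel X)))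

/-- The map `∐ X_n × Δⁿ → ∐ Y_n × Δⁿ` induced by a map of simplicial spaces. -/
def preMap {X Y : SimplicialObject TopCat.{u}} (f : X ⟶ Y) (p : PreRealization X) :
    PreRealization Y :=
  ⟨p.1, f.app (op p.1) p.2.1, p.2.2⟩

theorem continuous_preMap {X Y : SimplicialObject TopCat.{u}} (f : X ⟶ Y) :
    Continuous (preMap f) := by
  refine continuous_sigma fun n => ?_
  exact continuous_sigmaMk.comp
    (((f.app (op n)).hom.continuous.comp continuous_fst).prodMk continuous_snd)

theorem rel_preMap {X Y : SimplicialObject TopCat.{u}} (f : X ⟶ Y) (p q : PreRealization X)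
    (h : GlueRel X p q) : GlueRel Y (preMap f p) (preMap f q) := by
  obtain ⟨θ, x, t⟩ := h
  have e : f.app _ (X.map θ.op x) = Y.map θ.op (f.app _ x) :=
    NatTrans.naturality_apply f θ.op x
  simp only [preMap, e]
  exact GlueRel.mk θ _ t

/-- The map of geometric realizations induced by a map of simplicial spaces. -/
def realizationMap {X Y : SimplicialObject TopCat.{u}} (f : X ⟶ Y) :
    C(Realization X, Realization Y) where
  toFun := Quot.map (preMap f) (rel_preMap f)
  continuous_toFun :=
    continuous_quot_map (rel_preMap f) (continuous_preMap f)

/-- A simplicial space has free degeneracies (is split) if there are `N n → X_n` such that for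
every `k` the map from the coproduct, over all surjections `σ : [k] → [n]`, of copies of `N n` to
`X_k` given by `σ^*` is an isomorphism of spaces. (Taking `σ = id`, each `N n → X_n` is then the
inclusion of a subspace.) -/
def HasFreeDegeneracies (X : SimplicialObject TopCat.{u}) : Prop :=
  Nonempty (SimplicialObject.Splitting X)

end SimplicialSpace

end

/-! Weak equivalences are detected by lifting problems: f is one iff every map of pairs from (Dⁿ,
Sⁿ⁻¹), with a lift given on the sphere, lifts to the source up to a homotopy relative to the sphere
(`WeakEquiv.IsWeakEquivalence.liftsOver`, `LiftsOver.isWeakEquivalence`, the latter away from an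
empty source). In this form the property can be localized: `LiftsOver p V` asks it of balls mapping
into V, with homotopies that stay in V. The central local-to-global statement is
`LiftsOver.of_cover`: lifting over two relatively open sets that cover V and over their intersection
gives lifting over V. Its proof subdivides the ball into small cubes and extends the lift cell by
cell, controlling in each cell the sets in which the homotopy must stay.

The realization of a split simplicial space is filtered by skeleta, the k-th obtained from the
previous one by attaching N_k × Δᵏ along N_k × ∂Δᵏ (`realizationCells`). A k-skeleton is covered by
its open k-cells, a copy of N_k times an open simplex, and by the complement of the barycenters,
which deforms radially into the lower skeleton; the intersection is N_k times a punctured open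
simplex. Induction on k with `LiftsOver.of_cover` therefore reduces everything to the maps N_k →
N'_k, and a compactness argument passes from skeleta to the whole space
(`CellStructure.liftsOver_univ`).

The map f does induce maps N_k → N'_k with the lifting property. The subspace N_k is clopen and
consists of the nondegenerate simplices. Any simplicial map reflects nondegeneracy; a levelwise weak
equivalence also preserves it, by injectivity on path components (`map_mem_range_ι`).

Separation axioms are never needed for the spaces X_n: slices with fixed barycentric coordinates
serve in place of closed points, quotient maps are multiplied only by the interval, and closed maps
come from compactness of simplices. -/

noncomputable section

namespace DiskLifting

open Set Metric

/-- Continuous functions on two closed sets that agree on the overlap glue. -/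
theorem exists_glue {α β : Type*} [TopologicalSpace α] [TopologicalSpace β] {f g : α → β}
    {s t : Set α} (hs : IsClosed s) (ht : IsClosed t) (hf : ContinuousOn f s)
    (hg : ContinuousOn g t) (hfg : EqOn f g (s ∩ t)) :
    ∃ F : α → β, ContinuousOn F (s ∪ t) ∧ EqOn F f s ∧ EqOn F g t := by
  classical
  have h1 : EqOn (s.piecewise f g) f s := fun x hx => piecewise_eq_of_mem _ _ _ hx
  have h2 : EqOn (s.piecewise f g) g t := by
    intro x hx
    by_cases hxs : x ∈ s
    · rw [piecewise_eq_of_mem _ _ _ hxs, hfg ⟨hxs, hx⟩]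
    · rw [piecewise_eq_of_notMem _ _ _ hxs]
  exact ⟨s.piecewise f g, (hf.congr h1).union_of_isClosed (hg.congr h2) hs ht, h1, h2⟩

theorem max_half_pos (r : ℝ) {s : ℝ} (hs : 0 ≤ s) : 0 < max r ((1 + s) / 2) :=
  lt_of_lt_of_le (by linarith) (le_max_right _ _)

/-! ### Homotopy extension and lifting problems for balls -/

section Ball

variable {E : Type*} [NormedAddCommGroup E] [NormedSpace ℝ E]

/-- The cylinder over the ball retracts onto its bottom and sides: (x, t) goes to (1 + t)x on the
bottom while that lies in the ball, and otherwise to the side point in direction x at height (1 +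
t)‖x‖ - 1. Since F only takes values of k and h, any set V containing those also contains the values
of F. -/
theorem exists_homotopy_extension {W : Type*} [TopologicalSpace W] {k : E → W} {h : E × ℝ → W}
    (hk : ContinuousOn k (closedBall 0 1)) (hh : ContinuousOn h (sphere 0 1 ×ˢ Icc 0 1))
    (h0 : ∀ x ∈ sphere (0 : E) 1, h (x, 0) = k x) :
    ∃ F : E × ℝ → W, ContinuousOn F (closedBall 0 1 ×ˢ Icc 0 1) ∧
      (∀ x ∈ closedBall (0 : E) 1, F (x, 0) = k x) ∧
      (∀ x ∈ sphere (0 : E) 1, ∀ t ∈ Icc (0 : ℝ) 1, F (x, t) = h (x, t)) ∧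
      ∀ V : Set W, MapsTo k (closedBall 0 1) V → MapsTo h (sphere 0 1 ×ˢ Icc 0 1) V →
        MapsTo F (closedBall 0 1 ×ˢ Icc 0 1) V := by
  set s : Set (E × ℝ) := closedBall 0 1 ×ˢ Icc 0 1 ∩ {z | (1 + z.2) * ‖z.1‖ ≤ 1} with hs
  set t : Set (E × ℝ) := closedBall 0 1 ×ˢ Icc 0 1 ∩ {z | 1 ≤ (1 + z.2) * ‖z.1‖} with ht
  have hsc : IsClosed s := (isClosed_closedBall.prod isClosed_Icc).inter
    (isClosed_le (by fun_prop) (by fun_prop))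
  have htc : IsClosed t := (isClosed_closedBall.prod isClosed_Icc).inter
    (isClosed_le (by fun_prop) (by fun_prop))
  have hst : s ∪ t = closedBall 0 1 ×ˢ Icc 0 1 := by
    rw [hs, ht, ← inter_union_distrib_left, inter_eq_left]
    intro z _
    exact le_total ((1 + z.2) * ‖z.1‖) 1
  have m1 : MapsTo (fun z : E × ℝ => (1 + z.2) • z.1) s (closedBall 0 1) := by
    rintro ⟨x, r⟩ ⟨⟨_, hr⟩, h1⟩
    simp only [mem_Icc, mem_ofPred_eq] at hr h1
    rw [mem_closedBall_zero_iff, norm_smul, Real.norm_of_nonneg (by linarith)]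
    exact h1
  have pos : ∀ z ∈ t, 0 < ‖z.1‖ := by
    rintro ⟨x, r⟩ ⟨⟨_, hr⟩, h1⟩
    simp only [mem_Icc, mem_ofPred_eq] at hr h1
    by_contra hx
    have : ‖x‖ = 0 := le_antisymm (not_lt.1 hx) (norm_nonneg _)
    rw [this] at h1
    linarith
  have m2 : MapsTo (fun z : E × ℝ => (‖z.1‖⁻¹ • z.1, (1 + z.2) * ‖z.1‖ - 1)) t
      (sphere 0 1 ×ˢ Icc 0 1) := by
    rintro ⟨x, r⟩ hz
    have hp : 0 < ‖x‖ := pos _ hz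
    obtain ⟨⟨hx, hr⟩, h1⟩ := hz
    simp only [mem_closedBall_zero_iff, mem_Icc, mem_ofPred_eq] at hx hr h1
    refine ⟨?_, ?_⟩
    · simp only [mem_sphere_zero_iff_norm, norm_smul, norm_inv, norm_norm]
      field_simp
    · simp only [mem_Icc]
      constructor
      · linarith
      · nlinarith
  have c1 : ContinuousOn (fun z : E × ℝ => k ((1 + z.2) • z.1)) s :=
    hk.comp (by fun_prop) m1
  have c2 : ContinuousOn (fun z : E × ℝ => h (‖z.1‖⁻¹ • z.1, (1 + z.2) * ‖z.1‖ - 1)) t := by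
    refine hh.comp (ContinuousOn.prodMk (ContinuousOn.smul (ContinuousOn.inv₀ (by fun_prop) ?_)
      (by fun_prop)) (by fun_prop)) m2
    exact fun z hz => (pos z hz).ne'
  obtain ⟨F, hF, hFs, hFt⟩ := exists_glue hsc htc c1 c2 (by
    rintro ⟨x, r⟩ ⟨h1, h2⟩
    have e : (1 + r) * ‖x‖ = 1 := le_antisymm h1.2 h2.2
    have hp : 0 < ‖x‖ := pos _ h2
    have e' : 1 + r = ‖x‖⁻¹ := by field_simp; exact e
    simp only
    rw [e, sub_self, h0 _ (m2 h2).1, e'])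
  rw [hst] at hF
  refine ⟨F, hF, ?_, ?_, ?_⟩
  · intro x hx
    have : (x, (0 : ℝ)) ∈ s := ⟨⟨hx, by simp⟩, by simpa using hx⟩
    rw [hFs this]
    simp
  · intro x hx r hr
    have hx' : ‖x‖ = 1 := by simpa using hx
    have : (x, r) ∈ t := ⟨⟨sphere_subset_closedBall hx, hr⟩, by
      simp only [mem_ofPred_eq, hx', mul_one]; linarith [hr.1]⟩
    rw [hFt this]
    simp [hx']
  · intro V hkV hhV z hz
    rw [← hst] at hz
    rcases hz with hz | hz
    · rw [hFs hz]; exact hkV (m1 hz)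
    · rw [hFt hz]; exact hhV (m2 hz)

variable {X : Type u} {Y : Type v} [TopologicalSpace X] [TopologicalSpace Y]

/-- The lifting problem given by `a` on the unit sphere of `E` and `b` on the unit ball has a
solution up to a homotopy that is constant on the sphere and stays in `V`. -/
def Solvable (p : X → Y) (V : Set Y) (a : E → X) (b : E → Y) : Prop :=
  ∃ (a' : E → X) (H : E × ℝ → Y), ContinuousOn a' (closedBall 0 1) ∧ EqOn a' a (sphere 0 1) ∧
    ContinuousOn H (closedBall 0 1 ×ˢ Icc 0 1) ∧ MapsTo H (closedBall 0 1 ×ˢ Icc 0 1) V ∧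
    (∀ x ∈ closedBall (0 : E) 1, H (x, 0) = p (a' x)) ∧
    (∀ x ∈ closedBall (0 : E) 1, H (x, 1) = b x) ∧
    ∀ x ∈ sphere (0 : E) 1, ∀ t ∈ Icc (0 : ℝ) 1, H (x, t) = b x

variable (E) in
/-- Every lifting problem for the unit ball of `E`, with the ball mapping to `V`, is solvable. -/
def DiskLift (p : X → Y) (V : Set Y) : Prop :=
  ∀ (a : E → X) (b : E → Y), ContinuousOn a (sphere 0 1) → ContinuousOn b (closedBall 0 1) →
    MapsTo b (closedBall 0 1) V → EqOn (p ∘ a) b (sphere 0 1) → Solvable p V a b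

/-- Radial expansion by a factor of at most two, fixing the unit sphere. -/
def expand (z : E × ℝ) : E := (max ‖z.1‖ ((1 + z.2) / 2))⁻¹ • z.1

theorem continuousOn_expand : ContinuousOn (expand (E := E)) {z | 0 ≤ z.2} :=
  ContinuousOn.smul (ContinuousOn.inv₀ (by fun_prop) fun _ hz => (max_half_pos _ hz).ne') (by fun_prop)

theorem expand_mem {z : E × ℝ} (hz : 0 ≤ z.2) : expand z ∈ closedBall (0 : E) 1 := by
  have := max_half_pos ‖z.1‖ hz
  rw [mem_closedBall_zero_iff, expand, norm_smul, norm_inv, Real.norm_of_nonneg this.le,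
    inv_mul_le_one₀ this]
  exact le_max_left _ _

theorem expand_of_le {x : E} {s : ℝ} (hx : (1 + s) / 2 ≤ ‖x‖) : expand (x, s) = ‖x‖⁻¹ • x := by
  simp only [expand, max_eq_left hx]

theorem expand_sphere {x : E} {s : ℝ} (hx : x ∈ sphere (0 : E) 1) (hs : s ≤ 1) :
    expand (x, s) = x := by
  have hx' : ‖x‖ = 1 := by simpa using hx
  rw [expand_of_le (by rw [hx']; linarith), hx', inv_one, one_smul]

theorem expand_one {x : E} (hx : x ∈ closedBall (0 : E) 1) : expand (x, 1) = x := by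
  have hx' : ‖x‖ ≤ 1 := by simpa using hx
  rw [expand]
  norm_num
  rw [max_eq_right hx', inv_one, one_smul]

theorem expand_zero_of_le {x : E} (hx : ‖x‖ ≤ 1 / 2) : expand (x, 0) = (2 : ℝ) • x := by
  rw [expand]
  simp only [add_zero]
  rw [max_eq_right hx]
  norm_num

theorem normalize_mem {x : E} (hx : 0 < ‖x‖) : ‖x‖⁻¹ • x ∈ sphere (0 : E) 1 := by
  simp only [mem_sphere_zero_iff_norm, norm_smul, norm_inv, norm_norm]
  field_simp

theorem expand_zero_mem_sphere {x : E} (hx : 1 / 2 ≤ ‖x‖) : expand (x, 0) ∈ sphere (0 : E) 1 := by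
  rw [expand_of_le (by linarith)]
  exact normalize_mem (by linarith)

/-- Solvability of a lifting problem is invariant under homotopies of the problem. -/
theorem Solvable.of_homotopy {p : X → Y} {V : Set Y} {A : E × ℝ → X}
    {B : E × ℝ → Y} (hA : ContinuousOn A (sphere 0 1 ×ˢ Icc 0 1))
    (hB : ContinuousOn B (closedBall 0 1 ×ˢ Icc 0 1))
    (hBV : MapsTo B (closedBall 0 1 ×ˢ Icc 0 1) V)
    (hAB : ∀ x ∈ sphere (0 : E) 1, ∀ t ∈ Icc (0 : ℝ) 1, p (A (x, t)) = B (x, t))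
    (h : Solvable p V (fun x => A (x, 1)) (fun x => B (x, 1))) :
    Solvable p V (fun x => A (x, 0)) (fun x => B (x, 0)) := by
  obtain ⟨g, G, hg, hgA, hG, hGV, hG0, hG1, hGS⟩ := h
  have two_mem : ∀ x : E, ‖x‖ ≤ 1 / 2 → (2 : ℝ) • x ∈ closedBall (0 : E) 1 := by
    intro x hx
    rw [mem_closedBall_zero_iff, norm_smul]
    norm_num; linarith
  have two_mem' : ∀ x : E, ‖x‖ = 1 / 2 → (2 : ℝ) • x ∈ sphere (0 : E) 1 := by
    intro x hx
    rw [mem_sphere_zero_iff_norm, norm_smul, hx]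
    norm_num
  -- the lift
  obtain ⟨a', ha', ha1, ha2⟩ := exists_glue (f := fun x : E => g ((2 : ℝ) • x))
    (g := fun x : E => A (‖x‖⁻¹ • x, 2 - 2 * ‖x‖))
    (s := {x | ‖x‖ ≤ 1 / 2}) (t := {x | 1 / 2 ≤ ‖x‖} ∩ closedBall 0 1)
    (isClosed_le (by fun_prop) (by fun_prop))
    ((isClosed_le (by fun_prop) (by fun_prop)).inter isClosed_closedBall)
    (hg.comp (by fun_prop) two_mem)
    (by
      refine hA.comp (ContinuousOn.prodMk (ContinuousOn.smul (ContinuousOn.inv₀ (by fun_prop) ?_)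
        (by fun_prop)) (by fun_prop)) ?_
      · intro x hx
        exact (lt_of_lt_of_le (by norm_num) hx.1).ne'
      · rintro x ⟨hx, hx'⟩
        simp only [mem_ofPred_eq, mem_closedBall_zero_iff] at hx hx'
        exact ⟨normalize_mem (by linarith), by constructor <;> linarith⟩)
    (by
      rintro x ⟨hx, hx'⟩
      have e : ‖x‖ = 1 / 2 := le_antisymm hx hx'.1
      have : (‖x‖⁻¹ : ℝ) = 2 := by rw [e]; norm_num
      simp only
      rw [this, e, hgA (two_mem' x e)]
      norm_num)
  have hun : (({x | ‖x‖ ≤ 1 / 2} : Set E) ∪ {x | 1 / 2 ≤ ‖x‖} ∩ closedBall 0 1) = closedBall 0 1 := by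
    ext x
    simp only [mem_union, mem_ofPred_eq, mem_inter_iff, mem_closedBall_zero_iff]
    constructor
    · rintro (h | h)
      · linarith
      · exact h.2
    · intro h
      rcases le_total ‖x‖ (1 / 2) with h' | h'
      · exact Or.inl h'
      · exact Or.inr ⟨h', h⟩
  rw [hun] at ha'
  -- the homotopy
  set e : E × ℝ → E × ℝ := fun z =>
    (expand (z.1, max 0 (2 * z.2 - 1)), min 1 (2 - 2 * ‖z.1‖) * (1 - max 0 (2 * z.2 - 1))) with he
  have hec : Continuous e := by
    refine Continuous.prodMk ?_ (by fun_prop)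
    exact continuousOn_expand.comp_continuous (f := fun z : E × ℝ => (z.1, max 0 (2 * z.2 - 1)))
      (by fun_prop) (by simp)
  have hem : MapsTo e (closedBall 0 1 ×ˢ Icc 0 1) (closedBall 0 1 ×ˢ Icc 0 1) := by
    rintro ⟨x, t⟩ ⟨hx, ht⟩
    simp only [mem_closedBall_zero_iff, mem_Icc] at hx ht
    refine ⟨expand_mem (le_max_left _ _), ?_⟩
    have h1 : 0 ≤ min 1 (2 - 2 * ‖x‖) := le_min zero_le_one (by linarith)
    have h2 : min 1 (2 - 2 * ‖x‖) ≤ 1 := min_le_left _ _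
    have h3 : 0 ≤ max 0 (2 * t - 1) := le_max_left _ _
    have h4 : max 0 (2 * t - 1) ≤ 1 := max_le zero_le_one (by linarith)
    simp only [mem_Icc, he]
    constructor
    · exact mul_nonneg h1 (by linarith)
    · exact mul_le_one₀ h2 (by linarith) (by linarith)
  have hm1 : MapsTo (fun z : E × ℝ => ((2 : ℝ) • z.1, 2 * z.2)) (({z | ‖z.1‖ ≤ 1 / 2 ∧ z.2 ≤ 1 / 2} : Set (E × ℝ)) ∩
      closedBall 0 1 ×ˢ Icc 0 1) (closedBall 0 1 ×ˢ Icc 0 1) := by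
    rintro ⟨x, t⟩ ⟨⟨h1, h2⟩, ⟨_, h3⟩⟩
    simp only [mem_Icc] at h3
    exact ⟨two_mem x h1, by simp only at h2; constructor <;> simp only <;> linarith⟩
  -- In the first half of the time the given solution runs on the inner ball of radius 1/2, while
  -- the collar, on which the lift follows A, stands still. In the second half the picture is
  -- deformed through B: the doubling of the inner ball relaxes to the identity by `expand` and the
  -- time parameter of B shrinks to 0.
  obtain ⟨H, hH, hH1, hH2⟩ := exists_glue (f := fun z : E × ℝ => G ((2 : ℝ) • z.1, 2 * z.2))
    (g := fun z => B (e z))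
    (s := ({z | ‖z.1‖ ≤ 1 / 2 ∧ z.2 ≤ 1 / 2} : Set (E × ℝ)) ∩ closedBall 0 1 ×ˢ Icc 0 1)
    (t := ({z | 1 / 2 ≤ ‖z.1‖ ∨ 1 / 2 ≤ z.2} : Set (E × ℝ)) ∩ closedBall 0 1 ×ˢ Icc 0 1)
    (IsClosed.inter (by
      rw [ofPred_and]
      exact (isClosed_le (by fun_prop) (by fun_prop)).inter
        (isClosed_le (by fun_prop) (by fun_prop))) (isClosed_closedBall.prod isClosed_Icc))
    (IsClosed.inter (by
      rw [ofPred_or]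
      exact (isClosed_le (by fun_prop) (by fun_prop)).union
        (isClosed_le (by fun_prop) (by fun_prop))) (isClosed_closedBall.prod isClosed_Icc))
    (hG.comp (by fun_prop) hm1)
    (hB.comp hec.continuousOn (hem.mono_left inter_subset_right))
    (by
      rintro ⟨x, t⟩ ⟨h, h'⟩
      have hz := hm1 h
      obtain ⟨⟨h1, h2⟩, ⟨h3, h4⟩⟩ := h
      simp only [mem_closedBall_zero_iff, mem_Icc] at h1 h2 h3 h4
      have s0 : max 0 (2 * t - 1) = 0 := max_eq_left (by linarith)
      have e1 : min 1 (2 - 2 * ‖x‖) = 1 := min_eq_left (by linarith)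
      simp only [he, s0, e1, sub_zero, mul_one, expand_zero_of_le h1]
      rcases h'.1 with h5 | h5
      · have : ‖x‖ = 1 / 2 := le_antisymm h1 h5
        exact hGS _ (two_mem' x this) _ hz.2
      · have : t = 1 / 2 := le_antisymm h2 h5
        rw [this, mul_one_div_cancel two_ne_zero]
        exact hG1 _ hz.1)
  have hun2 : (({z | ‖z.1‖ ≤ 1 / 2 ∧ z.2 ≤ 1 / 2} : Set (E × ℝ)) ∩ closedBall 0 1 ×ˢ Icc 0 1) ∪
      (({z | 1 / 2 ≤ ‖z.1‖ ∨ 1 / 2 ≤ z.2} : Set (E × ℝ)) ∩ closedBall 0 1 ×ˢ Icc 0 1) =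
      closedBall 0 1 ×ˢ Icc 0 1 := by
    rw [← union_inter_distrib_right, inter_eq_right]
    intro z _
    simp only [mem_union, mem_ofPred_eq]
    rcases le_total ‖z.1‖ (1 / 2) with h | h <;> rcases le_total z.2 (1 / 2) with h' | h' <;> tauto
  rw [hun2] at hH
  have eS : ∀ x ∈ sphere (0 : E) 1, ∀ t ∈ Icc (0 : ℝ) 1, e (x, t) = (x, 0) := by
    intro x hx t ht
    have hx' : ‖x‖ = 1 := by simpa using hx
    simp only [he, hx']
    rw [expand_sphere hx (max_le zero_le_one (by linarith [ht.2]))]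
    norm_num
  refine ⟨a', H, ha', ?_, hH, ?_, ?_, ?_, ?_⟩
  · intro x hx
    have hx' : ‖x‖ = 1 := by simpa using hx
    rw [ha2 ⟨by simp only [mem_ofPred_eq, hx']; norm_num, sphere_subset_closedBall hx⟩]
    simp [hx']
  · intro z hz
    rw [← hun2] at hz
    rcases hz with hz | hz
    · rw [hH1 hz]; exact hGV (hm1 hz)
    · rw [hH2 hz]; exact hBV (hem hz.2)
  · intro x hx
    have hx' : ‖x‖ ≤ 1 := by simpa using hx
    rcases le_total ‖x‖ (1 / 2) with h | h
    · rw [hH1 ⟨⟨h, by norm_num⟩, hx, by simp⟩, ha1 h]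
      simp only [mul_zero]
      exact hG0 _ (two_mem x h)
    · rw [hH2 ⟨Or.inl h, hx, by simp⟩, ha2 ⟨h, hx⟩]
      have h2 : min 1 (2 - 2 * ‖x‖) = 2 - 2 * ‖x‖ := min_eq_right (by linarith)
      have : e (x, 0) = (‖x‖⁻¹ • x, 2 - 2 * ‖x‖) := by
        simp only [he, mul_zero, zero_sub, h2]
        rw [max_eq_left (by norm_num), expand_of_le (by linarith)]
        simp
      simp only [this]
      exact (hAB _ (normalize_mem (by linarith)) _ ⟨by linarith, by linarith⟩).symm
  · intro x hx
    rw [hH2 ⟨Or.inr (by norm_num), hx, by simp⟩]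
    have : e (x, 1) = (x, 0) := by
      simp only [he]
      norm_num
      exact expand_one hx
    simp only [this]
  · intro x hx t ht
    have hx' : ‖x‖ = 1 := by simpa using hx
    rw [hH2 ⟨Or.inl (by simp only [hx']; norm_num), sphere_subset_closedBall hx, ht⟩]
    simp only [eS x hx t ht]

end Ball

/-! ### Extension of controlled lifts from a closed subset -/

section PairLift

variable {X : Type u} {Y : Type v} [TopologicalSpace X] [TopologicalSpace Y]
  {T : Type*} [TopologicalSpace T]

/-- A lift on `A`, up to a homotopy `H`, of a map on `Z` extends to a lift on `Z` up to a homotopy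
extending `H`; all homotopies are required to stay in `V x` at the point `x`. -/
def PairLift (p : X → Y) (V : T → Set Y) (A Z : Set T) : Prop :=
  ∀ (a : T → X) (b : T → Y) (H : T × ℝ → Y), ContinuousOn a A → ContinuousOn b Z →
    (∀ x ∈ Z, b x ∈ V x) → ContinuousOn H (A ×ˢ Icc 0 1) →
    (∀ x ∈ A, ∀ t ∈ Icc (0 : ℝ) 1, H (x, t) ∈ V x) → (∀ x ∈ A, H (x, 0) = p (a x)) →
    (∀ x ∈ A, H (x, 1) = b x) →
    ∃ (a' : T → X) (H' : T × ℝ → Y), ContinuousOn a' Z ∧ EqOn a' a A ∧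
      ContinuousOn H' (Z ×ˢ Icc 0 1) ∧ EqOn H' H (A ×ˢ Icc 0 1) ∧
      (∀ x ∈ Z, ∀ t ∈ Icc (0 : ℝ) 1, H' (x, t) ∈ V x) ∧ (∀ x ∈ Z, H' (x, 0) = p (a' x)) ∧
      ∀ x ∈ Z, H' (x, 1) = b x

variable {p : X → Y} {V : T → Set Y}

theorem PairLift.refl (A : Set T) : PairLift p V A A :=
  fun a _ H ha _ _ hH hHV h0 h1 => ⟨a, H, ha, fun _ _ => rfl, hH, fun _ _ => rfl, hHV, h0, h1⟩

theorem PairLift.trans {A B C : Set T} (hAB : A ⊆ B) (hBC : B ⊆ C) (h : PairLift p V A B)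
    (h' : PairLift p V B C) : PairLift p V A C := by
  intro a b H ha hb hbV hH hHV h0 h1
  obtain ⟨a₁, H₁, ha₁, e₁, hH₁, f₁, hHV₁, h0₁, h1₁⟩ :=
    h a b H ha (hb.mono hBC) (fun x hx => hbV x (hBC hx)) hH hHV h0 h1
  obtain ⟨a₂, H₂, ha₂, e₂, hH₂, f₂, hHV₂, h0₂, h1₂⟩ :=
    h' a₁ b H₁ ha₁ hb hbV hH₁ hHV₁ h0₁ h1₁
  exact ⟨a₂, H₂, ha₂, (e₂.mono hAB).trans e₁, hH₂,
    (f₂.mono (prod_mono hAB subset_rfl)).trans f₁, hHV₂, h0₂, h1₂⟩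

theorem PairLift.union {A B : Set T} (hA : IsClosed A) (hB : IsClosed B)
    (h : PairLift p V (A ∩ B) B) : PairLift p V A (A ∪ B) := by
  intro a b H ha hb hbV hH hHV h0 h1
  obtain ⟨a₁, H₁, ha₁, e₁, hH₁, f₁, hHV₁, h0₁, h1₁⟩ :=
    h a b H (ha.mono inter_subset_left) (hb.mono subset_union_right)
      (fun x hx => hbV x (Or.inr hx)) (hH.mono (prod_mono inter_subset_left subset_rfl))
      (fun x hx => hHV x hx.1) (fun x hx => h0 x hx.1) (fun x hx => h1 x hx.1)
  obtain ⟨a₂, ha₂, e₂, e₂'⟩ := exists_glue hA hB ha ha₁ e₁.symm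
  obtain ⟨H₂, hH₂, f₂, f₂'⟩ := exists_glue (hA.prod isClosed_Icc) (hB.prod isClosed_Icc) hH hH₁
    (by
      rintro ⟨x, t⟩ ⟨hx, hx'⟩
      exact (f₁ ⟨⟨hx.1, hx'.1⟩, hx.2⟩).symm)
  rw [← union_prod] at hH₂
  refine ⟨a₂, H₂, ha₂, e₂, hH₂, f₂, ?_, ?_, ?_⟩
  · rintro x (hx | hx) t ht
    · rw [f₂ ⟨hx, ht⟩]; exact hHV x hx t ht
    · rw [f₂' ⟨hx, ht⟩]; exact hHV₁ x hx t ht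
  · rintro x (hx | hx)
    · rw [f₂ ⟨hx, by simp⟩, e₂ hx]; exact h0 x hx
    · rw [f₂' ⟨hx, by simp⟩, e₂' hx]; exact h0₁ x hx
  · rintro x (hx | hx)
    · rw [f₂ ⟨hx, by simp⟩]; exact h1 x hx
    · rw [f₂' ⟨hx, by simp⟩]; exact h1₁ x hx

/-- Transport of the lifting property along a homeomorphism of pairs, with constant control `W`
on the source; on the target, the control may be smaller than `W` on the subspace `A`. -/
theorem PairLift.transport {T' : Type*} [TopologicalSpace T'] {W : Set Y} {A Z : Set T}
    {A' Z' : Set T'} (h : PairLift p (fun _ => W) A' Z') (e : T' → T) (j : T → T')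
    (he : ContinuousOn e Z') (hj : ContinuousOn j Z) (heZ : MapsTo e Z' Z) (hjZ : MapsTo j Z Z')
    (heA : MapsTo e A' A) (hjA : MapsTo j A A') (hej : ∀ x ∈ Z, e (j x) = x) (hAZ : A ⊆ Z)
    (hAZ' : A' ⊆ Z')
    (hVA : ∀ x ∈ A, V x ⊆ W) (hVZ : ∀ x ∈ Z, x ∉ A → V x = W) : PairLift p V A Z := by
  intro a b H ha hb hbV hH hHV h0 h1
  have hVW : ∀ x ∈ Z, V x ⊆ W := fun x hx => by
    by_cases hxA : x ∈ A
    · exact hVA x hxA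
    · exact (hVZ x hx hxA).subset
  obtain ⟨a₁, H₁, ha₁, e₁, hH₁, f₁, hHV₁, h0₁, h1₁⟩ :=
    h (a ∘ e) (b ∘ e) (fun z => H (e z.1, z.2)) (ha.comp (he.mono hAZ') heA) (hb.comp he heZ)
      (fun x hx => hVW _ (heZ hx) (hbV _ (heZ hx)))
      (hH.comp (ContinuousOn.prodMk ((he.mono hAZ').comp continuousOn_fst fun z hz => hz.1)
        continuousOn_snd) fun z hz => ⟨heA hz.1, hz.2⟩)
      (fun x hx t ht => hVA _ (heA hx) (hHV _ (heA hx) t ht))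
      (fun x hx => h0 _ (heA hx)) (fun x hx => h1 _ (heA hx))
  have hHeq : EqOn (fun z : T × ℝ => H₁ (j z.1, z.2)) H (A ×ˢ Icc 0 1) := by
    rintro ⟨x, t⟩ ⟨hx, ht⟩
    have := f₁ (x := (j x, t)) ⟨hjA hx, ht⟩
    simp only [hej x (hAZ hx)] at this
    exact this
  refine ⟨a₁ ∘ j, fun z => H₁ (j z.1, z.2), ha₁.comp hj hjZ, ?_, ?_, hHeq, ?_, ?_, ?_⟩
  · intro x hx
    simp only [Function.comp, e₁ (hjA hx), hej x (hAZ hx)]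
  · exact hH₁.comp (ContinuousOn.prodMk (hj.comp continuousOn_fst fun z hz => hz.1)
      continuousOn_snd) fun z hz => ⟨hjZ hz.1, hz.2⟩
  · intro x hx t ht
    by_cases hxA : x ∈ A
    · have := hHeq (x := (x, t)) ⟨hxA, ht⟩
      simp only at this ⊢
      rw [this]
      exact hHV x hxA t ht
    · rw [hVZ x hx hxA]
      exact hHV₁ _ (hjZ hx) t ht
  · intro x hx
    exact h0₁ _ (hjZ hx)
  · intro x hx
    have := h1₁ _ (hjZ hx)
    simp only [Function.comp, hej x hx] at this
    exact this

end PairLift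

section Ball

variable {E : Type*} [NormedAddCommGroup E] [NormedSpace ℝ E]
  {X : Type u} {Y : Type v} [TopologicalSpace X] [TopologicalSpace Y]

/-- Extending the reverse of H over the ball replaces b by a map that agrees with p ∘ a on the
sphere, where the lifting problem can be solved relative to the sphere. Concatenating the resulting
homotopy with the reversed extension gives the answer, once it is reparametrized to restrict to H
itself on the sphere. -/
theorem DiskLift.pairLift {p : X → Y} {W : Set Y} (h : DiskLift E p W) :
    PairLift p (fun _ => W) (sphere (0 : E) 1) (closedBall 0 1) := by
  intro a b H ha hb hbV hH hHV h0 h1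
  obtain ⟨F, hF, hF0, hFS, hFV⟩ := exists_homotopy_extension (k := b)
    (h := fun z => H (z.1, 1 - z.2)) hb
    (hH.comp (by fun_prop) (by
      rintro ⟨x, t⟩ ⟨hx, ht⟩
      exact ⟨hx, by simp only [mem_Icc] at ht ⊢; constructor <;> linarith⟩))
    (by intro x hx; simpa using h1 x hx)
  replace hFV := hFV W hbV (by
    rintro ⟨x, t⟩ ⟨hx, ht⟩
    exact hHV x hx _ (by simp only [mem_Icc] at ht ⊢; constructor <;> linarith))
  obtain ⟨g, K, hg, hga, hK, hKV, hK0, hK1, hKS⟩ := h a (fun x => F (x, 1)) ha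
    (hF.comp (by fun_prop) fun x hx => ⟨hx, by simp⟩) (fun x hx => hFV ⟨hx, by simp⟩) (by
      intro x hx
      simp only [Function.comp]
      rw [hFS x hx 1 (by simp), sub_self, h0 x hx])
  -- the collar coordinate
  set w : E × ℝ → ℝ := fun z => max 0 (2 * ‖z.1‖ - 1) with hw
  have hwc : Continuous w := by fun_prop
  have hw0 : ∀ z, 0 ≤ w z := fun z => le_max_left _ _
  have hw1 : ∀ z ∈ closedBall (0 : E) 1 ×ˢ Icc (0 : ℝ) 1, w z ≤ 1 := by
    rintro ⟨x, t⟩ ⟨hx, ht⟩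
    have hx' : ‖x‖ ≤ 1 := by simpa using hx
    exact max_le zero_le_one (by simp only; linarith)
  -- The two homotopies are exchanged at time (1 - w)/(2 - w): this is 1/2 on the inner ball and
  -- drops to 0 on the sphere, so that only H is seen there. In the collar the first homotopy is
  -- evaluated on the sphere, where it is stationary and can be cut off at any time.
  set s : Set (E × ℝ) := {z | (2 - w z) * z.2 ≤ 1 - w z} ∩ closedBall 0 1 ×ˢ Icc 0 1 with hs
  set t : Set (E × ℝ) := {z | 1 - w z ≤ (2 - w z) * z.2} ∩ closedBall 0 1 ×ˢ Icc 0 1 with ht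
  have hst : s ∪ t = closedBall 0 1 ×ˢ Icc 0 1 := by
    rw [hs, ht, ← union_inter_distrib_right, inter_eq_right]
    intro z _
    exact le_total ((2 - w z) * z.2) (1 - w z)
  have hsc : IsClosed s := (isClosed_le (by fun_prop) (by fun_prop)).inter
    (isClosed_closedBall.prod isClosed_Icc)
  have htc : IsClosed t := (isClosed_le (by fun_prop) (by fun_prop)).inter
    (isClosed_closedBall.prod isClosed_Icc)
  set i : E × ℝ → E × ℝ := fun z => (expand (z.1, 0), min 1 (2 * z.2)) with hi
  have hic : Continuous i := Continuous.prodMk (continuousOn_expand.comp_continuous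
    (f := fun z : E × ℝ => (z.1, (0 : ℝ))) (by fun_prop) (by simp)) (by fun_prop)
  have him : MapsTo i (closedBall 0 1 ×ˢ Icc 0 1) (closedBall 0 1 ×ˢ Icc 0 1) := by
    rintro ⟨x, r⟩ ⟨hx, hr⟩
    refine ⟨expand_mem le_rfl, ?_⟩
    simp only [mem_Icc, hi] at hr ⊢
    exact ⟨le_min zero_le_one (by linarith), min_le_left _ _⟩
  set v : E × ℝ → ℝ := fun z => max 0 ((2 - w z) * z.2 - (1 - w z)) with hv
  have hvc : Continuous v := by fun_prop
  have hv0 : ∀ z, 0 ≤ v z := fun z => le_max_left _ _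
  have hv1 : ∀ z ∈ closedBall (0 : E) 1 ×ˢ Icc (0 : ℝ) 1, v z ≤ 1 := by
    intro z hz
    have h1 := hw1 z hz
    have h2 := hz.2.2
    exact max_le zero_le_one (by nlinarith [hw0 z])
  set l : E × ℝ → E × ℝ := fun z => (expand (z.1, v z), 1 - v z) with hl
  have hlc : Continuous l := Continuous.prodMk (continuousOn_expand.comp_continuous
    (f := fun z : E × ℝ => (z.1, v z)) (by fun_prop) (by simpa using fun x t => hv0 (x, t)))
    (by fun_prop)
  have hlm : MapsTo l (closedBall 0 1 ×ˢ Icc 0 1) (closedBall 0 1 ×ˢ Icc 0 1) := by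
    intro z hz
    refine ⟨expand_mem (hv0 z), ?_⟩
    simp only [mem_Icc, hl]
    constructor <;> linarith [hv0 z, hv1 z hz]
  obtain ⟨H', hH', hHs, hHt⟩ := exists_glue (f := K ∘ i) (g := F ∘ l) hsc htc
    (hK.comp hic.continuousOn (him.mono_left inter_subset_right))
    (hF.comp hlc.continuousOn (hlm.mono_left inter_subset_right))
    (by
      rintro ⟨x, r⟩ ⟨⟨h3, h4⟩, ⟨h5, -⟩⟩
      have e : (2 - w (x, r)) * r = 1 - w (x, r) := le_antisymm h3 h5
      have ev : v (x, r) = 0 := by simp only [hv]; rw [e]; simp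
      simp only [Function.comp, hl, ev, hi, sub_zero]
      rcases le_total ‖x‖ (1 / 2) with h | h
      · have e0 : w (x, r) = 0 := max_eq_left (by simp only; linarith)
        rw [e0] at e
        have : min 1 (2 * r) = 1 := min_eq_left (by linarith)
        rw [this, hK1 _ (expand_mem le_rfl)]
      · rw [hKS _ (expand_zero_mem_sphere h)]
        exact (him h4).2)
  rw [hst] at hH'
  have wS : ∀ x ∈ sphere (0 : E) 1, ∀ r, w (x, r) = 1 := by
    intro x hx r
    have hx' : ‖x‖ = 1 := by simpa using hx
    simp only [hw, hx']
    norm_num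
  refine ⟨fun x => g (expand (x, 0)), H', ?_, ?_, hH', ?_, ?_, ?_, ?_⟩
  · exact hg.comp (continuousOn_expand.comp (f := fun x : E => (x, (0 : ℝ))) (by fun_prop)
      (fun x _ => by simp)) fun x _ => expand_mem le_rfl
  · intro x hx
    simp only [expand_sphere hx zero_le_one]
    exact hga hx
  · rintro ⟨x, r⟩ ⟨hx, hr⟩
    simp only at hx hr
    have hz : (x, r) ∈ t := by
      refine ⟨?_, sphere_subset_closedBall hx, hr⟩
      simp only [mem_ofPred_eq, wS x hx r]
      linarith [hr.1]
    have ev : v (x, r) = r := by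
      simp only [hv, wS x hx r]
      rw [max_eq_right] <;> linarith [hr.1]
    rw [hHt hz]
    simp only [Function.comp, hl, ev]
    rw [expand_sphere hx hr.2, hFS x hx _ ⟨by linarith [hr.2], by linarith [hr.1]⟩]
    simp
  · intro x hx r hr
    have hz : (x, r) ∈ s ∪ t := by rw [hst]; exact ⟨hx, hr⟩
    rcases hz with hz | hz
    · rw [hHs hz]; exact hKV (him ⟨hx, hr⟩)
    · rw [hHt hz]; exact hFV (hlm ⟨hx, hr⟩)
  · intro x hx
    have hz : (x, (0 : ℝ)) ∈ s := by
      refine ⟨?_, hx, by simp⟩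
      simp only [mem_ofPred_eq, mul_zero]
      linarith [hw1 (x, 0) ⟨hx, by simp⟩]
    rw [hHs hz]
    simp only [Function.comp, hi, mul_zero]
    rw [min_eq_right zero_le_one]
    exact hK0 _ (expand_mem le_rfl)
  · intro x hx
    have hz : (x, (1 : ℝ)) ∈ t := by
      refine ⟨?_, hx, by simp⟩
      simp only [mem_ofPred_eq, mul_one]
      linarith
    have ev : v (x, 1) = 1 := by
      simp only [hv, mul_one]
      rw [max_eq_right] <;> linarith
    rw [hHt hz]
    simp only [Function.comp, hl, ev, sub_self]
    rw [expand_one hx, hF0 x hx]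

end Ball

section Congr

variable {E E' : Type*} [NormedAddCommGroup E] [NormedSpace ℝ E] [NormedAddCommGroup E']
  [NormedSpace ℝ E'] {X : Type u} {Y : Type v} [TopologicalSpace X] [TopologicalSpace Y]

theorem Solvable.congr {p : X → Y} {V : Set Y} {a : E' → X} {b : E' → Y} (e : E ≃ₗᵢ[ℝ] E')
    (h : Solvable p V (a ∘ e) (b ∘ e)) : Solvable p V a b := by
  obtain ⟨a', H, ha', haa, hH, hHV, h0, h1, hS⟩ := h
  have mB : MapsTo e.symm (closedBall 0 1) (closedBall 0 1) := fun x hx => by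
    simpa using hx
  have mS : MapsTo e.symm (sphere 0 1) (sphere 0 1) := fun x hx => by simpa using hx
  refine ⟨a' ∘ e.symm, fun z => H (e.symm z.1, z.2), ha'.comp (by fun_prop) mB, ?_,
    hH.comp (by fun_prop) fun z hz => ⟨mB hz.1, hz.2⟩, fun z hz => hHV ⟨mB hz.1, hz.2⟩,
    fun x hx => h0 _ (mB hx), ?_, ?_⟩
  · intro x hx
    have := haa (mS hx)
    simpa using this
  · intro x hx
    have := h1 _ (mB hx)
    simpa using this
  · intro x hx t ht
    have := hS _ (mS hx) t ht
    simpa using this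

theorem DiskLift.congr {p : X → Y} {V : Set Y} (e : E ≃ₗᵢ[ℝ] E') (h : DiskLift E p V) :
    DiskLift E' p V := by
  intro a b ha hb hbV hab
  have mB : MapsTo e (closedBall 0 1) (closedBall 0 1) := fun x hx => by simpa using hx
  have mS : MapsTo e (sphere 0 1) (sphere 0 1) := fun x hx => by simpa using hx
  exact Solvable.congr e (h _ _ (ha.comp e.continuous.continuousOn mS)
    (hb.comp e.continuous.continuousOn mB) (fun x hx => hbV (mB hx)) fun x hx => hab (mS hx))

/-- All lifting problems for cubes, with values over `V`, are solvable. -/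
def LiftsOver (p : X → Y) (V : Set Y) : Prop :=
  ∀ n : ℕ, DiskLift (Fin n → ℝ) p V

theorem LiftsOver.diskLift {p : X → Y} {V : Set Y} (h : LiftsOver p V) (ι : Type) [Fintype ι] :
    DiskLift (ι → ℝ) p V :=
  (h (Fintype.card ι)).congr
    { LinearEquiv.funCongrLeft ℝ ℝ (Fintype.equivFin ι) with
      norm_map' := fun x => by
        refine le_antisymm ((pi_norm_le_iff_of_nonneg (norm_nonneg _)).2 fun i =>
          norm_le_pi_norm x _) ((pi_norm_le_iff_of_nonneg (norm_nonneg _)).2 fun i => ?_)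
        obtain ⟨j, rfl⟩ := (Fintype.equivFin ι).surjective i
        exact norm_le_pi_norm (x ∘ Fintype.equivFin ι) j }

end Congr

/-! ### Cubical grids and cell-by-cell extension -/

section Grid

/-- The label of the open cell of the standard subdivision of `ℝ` that contains `y`: the points
`k` get the label `2 * k`, the open intervals from `k` to `k + 1` the label `2 * k + 1`. -/
def label (y : ℝ) : ℤ := ⌊y⌋ + ⌈y⌉

/-- The closed cell with a given label. -/
def lineCell (c : ℤ) : Set ℝ := Icc ((c / 2 : ℤ) : ℝ) (((c + 1) / 2 : ℤ) : ℝ)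

theorem label_div_two (y : ℝ) : label y / 2 = ⌊y⌋ ∧ (label y + 1) / 2 = ⌈y⌉ := by
  have h1 : ⌈y⌉ ≤ ⌊y⌋ + 1 := Int.ceil_le_floor_add_one y
  have h2 : ⌊y⌋ ≤ ⌈y⌉ := Int.floor_le_ceil y
  unfold label
  omega

theorem mem_lineCell_label (y : ℝ) : y ∈ lineCell (label y) := by
  rw [lineCell, (label_div_two y).1, (label_div_two y).2]
  exact ⟨Int.floor_le y, Int.le_ceil y⟩

theorem lineCell_label_subset {y : ℝ} {c : ℤ} (hy : y ∈ lineCell c) :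
    lineCell (label y) ⊆ lineCell c := by
  rw [lineCell, (label_div_two y).1, (label_div_two y).2]
  exact Icc_subset_Icc (by exact_mod_cast Int.le_floor.2 hy.1)
    (by exact_mod_cast Int.ceil_le.2 hy.2)

theorem mem_lineCell_even {y : ℝ} {c : ℤ} (hc : ¬ Odd c) : y ∈ lineCell c ↔ 2 * y = c := by
  rw [Int.not_odd_iff_even] at hc
  obtain ⟨k, rfl⟩ := hc
  have h1 : (k + k) / 2 = k := by omega
  have h2 : (k + k + 1) / 2 = k := by omega
  rw [lineCell, h1, h2, Icc_self, mem_singleton_iff]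
  push_cast
  constructor <;> intro h <;> linarith

theorem mem_lineCell_odd {y : ℝ} {c : ℤ} (hc : Odd c) : y ∈ lineCell c ↔ abs (2 * y - c) ≤ 1 := by
  obtain ⟨k, rfl⟩ := hc
  have h1 : (2 * k + 1) / 2 = k := by omega
  have h2 : (2 * k + 1 + 1) / 2 = k + 1 := by omega
  rw [lineCell, h1, h2, mem_Icc, abs_le]
  push_cast
  constructor <;> rintro ⟨h, h'⟩ <;> constructor <;> linarith

theorem label_eq_of_even {y : ℝ} {c : ℤ} (hc : ¬ Odd c) (hy : y ∈ lineCell c) : label y = c := by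
  rw [mem_lineCell_even hc] at hy
  rw [Int.not_odd_iff_even] at hc
  obtain ⟨k, rfl⟩ := hc
  have : y = k := by push_cast at hy; linarith
  rw [label, this, Int.floor_intCast, Int.ceil_intCast]

theorem label_eq_iff_of_odd {y : ℝ} {c : ℤ} (hc : Odd c) (hy : y ∈ lineCell c) :
    label y = c ↔ abs (2 * y - c) ≠ 1 := by
  rw [mem_lineCell_odd hc] at hy
  obtain ⟨k, rfl⟩ := hc
  have hy' := abs_le.1 hy
  push_cast at hy hy' ⊢
  constructor
  · intro h h'
    rcases (abs_eq zero_le_one).1 h' with h1 | h1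
    · have : y = (k + 1 : ℤ) := by push_cast; linarith
      rw [label, this, Int.floor_intCast, Int.ceil_intCast] at h
      omega
    · have : y = k := by linarith
      rw [label, this, Int.floor_intCast, Int.ceil_intCast] at h
      omega
  · intro h
    have h' := abs_lt.1 (lt_of_le_of_ne hy h)
    have e1 : ⌊y⌋ = k := Int.floor_eq_iff.2 ⟨by linarith, by linarith⟩
    have e2 : ⌈y⌉ = k + 1 := Int.ceil_eq_iff.2 ⟨by push_cast; linarith, by push_cast; linarith⟩
    rw [label, e1, e2]
    ring

theorem odd_of_odd_label {y : ℝ} {c : ℤ} (hy : y ∈ lineCell c) (h : Odd (label y)) :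
    label y = c := by
  by_cases hc : Odd c
  · by_contra hne
    rw [label_eq_iff_of_odd hc hy, not_not] at hne
    obtain ⟨k, rfl⟩ := hc
    push_cast at hne
    rcases (abs_eq zero_le_one).1 hne with h1 | h1
    · have : y = (k + 1 : ℤ) := by push_cast; linarith
      rw [label, this, Int.floor_intCast, Int.ceil_intCast, ← two_mul] at h
      exact (Int.not_even_iff_odd.2 h) (even_two_mul _)
    · have : y = k := by linarith
      rw [label, this, Int.floor_intCast, Int.ceil_intCast, ← two_mul] at h
      exact (Int.not_even_iff_odd.2 h) (even_two_mul _)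
  · exact label_eq_of_even hc hy

variable {n : ℕ} (N : ℝ)

/-- The label of the open cell of the cubical grid of mesh `1 / N` that contains `x`. -/
def gridLabel (x : Fin n → ℝ) : Fin n → ℤ := fun i => label (N * x i)

/-- The closed grid cell with a given label. -/
def gridCell (c : Fin n → ℤ) : Set (Fin n → ℝ) := {x | ∀ i, N * x i ∈ lineCell (c i)}

/-- The union of the open grid cells with labels in `T`. -/
def gridUnion (T : Finset (Fin n → ℤ)) : Set (Fin n → ℝ) := {x | gridLabel N x ∈ T}

/-- The set of labels contains the labels of all faces of its cells. -/
def IsLowerLabels (T : Finset (Fin n → ℤ)) : Prop :=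
  ∀ c ∈ T, ∀ x ∈ gridCell N c, gridLabel N x ∈ T

/-- The dimension of a cell. -/
def cellDim (c : Fin n → ℤ) : ℕ := (Finset.univ.filter fun i => Odd (c i)).card

theorem mem_gridCell_gridLabel (x : Fin n → ℝ) : x ∈ gridCell N (gridLabel N x) :=
  fun _ => mem_lineCell_label _

theorem gridCell_gridLabel_subset {x : Fin n → ℝ} {c : Fin n → ℤ} (hx : x ∈ gridCell N c) :
    gridCell N (gridLabel N x) ⊆ gridCell N c :=
  fun _ hy i => lineCell_label_subset (hx i) (hy i)

theorem isClosed_gridCell (c : Fin n → ℤ) : IsClosed (gridCell N c) := by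
  have : gridCell N c = ⋂ i, {x | N * x i ∈ lineCell (c i)} := by
    ext x; simp [gridCell]
  rw [this]
  exact isClosed_iInter fun i => isClosed_Icc.preimage (by fun_prop)

theorem IsLowerLabels.gridUnion_eq {T : Finset (Fin n → ℤ)} (hT : IsLowerLabels N T) :
    gridUnion N T = ⋃ c ∈ T, gridCell N c := by
  ext x
  simp only [mem_iUnion, exists_prop]
  exact ⟨fun h => ⟨_, h, mem_gridCell_gridLabel N x⟩, fun ⟨c, hc, hx⟩ => hT c hc x hx⟩

theorem IsLowerLabels.isClosed {T : Finset (Fin n → ℤ)} (hT : IsLowerLabels N T) :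
    IsClosed (gridUnion N T) := by
  rw [hT.gridUnion_eq]
  exact T.finite_toSet.isClosed_biUnion fun c _ => isClosed_gridCell N c

/-- In passing to a face, a coordinate that varies in the face also varies in the cell, with the
same label. If the labels differ at all, some varying coordinate has become fixed. -/
theorem cellDim_lt {x : Fin n → ℝ} {c : Fin n → ℤ} (hx : x ∈ gridCell N c)
    (hne : gridLabel N x ≠ c) : cellDim (gridLabel N x) < cellDim c := by
  have key : ∀ i, Odd (gridLabel N x i) → gridLabel N x i = c i :=
    fun i hi => odd_of_odd_label (hx i) hi
  obtain ⟨i, hi⟩ := Function.ne_iff.1 hne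
  have hci : Odd (c i) := by
    by_contra h
    exact hi (label_eq_of_even h (hx i))
  refine Finset.card_lt_card ((Finset.ssubset_iff_of_subset fun j hj => ?_).2 ⟨i, ?_, ?_⟩)
  · simp only [Finset.mem_filter, Finset.mem_univ, true_and] at hj ⊢
    rw [← key j hj]
    exact hj
  · simpa using hci
  · simpa using fun h => hi (key i h)

variable {X : Type u} {Y : Type v} [TopologicalSpace X] [TopologicalSpace Y]

variable {N} in
/-- The lifting property for the boundary of a single grid cell. -/
theorem pairLift_gridCell (hN : 0 < N) {p : X → Y} {W : (Fin n → ℤ) → Set Y}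
    (hW : ∀ c, ∀ x ∈ gridCell N c, W (gridLabel N x) ⊆ W c) (c : Fin n → ℤ)
    (h : LiftsOver p (W c)) :
    PairLift p (fun x => W (gridLabel N x)) {x | x ∈ gridCell N c ∧ gridLabel N x ≠ c}
      (gridCell N c) := by
  classical
  have hN' := hN.ne'
  have mem_iff : ∀ x, x ∈ gridCell N c ↔
      (∀ i, Odd (c i) → abs (2 * (N * x i) - c i) ≤ 1) ∧ ∀ i, ¬ Odd (c i) → 2 * (N * x i) = c i := by
    intro x
    constructor
    · exact fun h => ⟨fun i hi => (mem_lineCell_odd hi).1 (h i),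
        fun i hi => (mem_lineCell_even hi).1 (h i)⟩
    · intro h i
      by_cases hi : Odd (c i)
      · exact (mem_lineCell_odd hi).2 (h.1 i hi)
      · exact (mem_lineCell_even hi).2 (h.2 i hi)
  have ne_iff : ∀ x ∈ gridCell N c, gridLabel N x ≠ c ↔
      ∃ i, Odd (c i) ∧ abs (2 * (N * x i) - c i) = 1 := by
    intro x hx
    rw [Function.ne_iff]
    refine exists_congr fun i => ?_
    by_cases hi : Odd (c i)
    · simp only [hi, true_and]
      have := label_eq_iff_of_odd hi (hx i)
      rw [ne_eq, gridLabel, this, not_not]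
    · simp only [hi, false_and, iff_false, ne_eq, not_not]
      exact label_eq_of_even hi (hx i)
  -- Only coordinates with odd label vary in the cell. Such a coordinate ranges over an interval
  -- with midpoint c i / (2N) and half-length 1 / (2N), so the cell is an affine copy of the unit
  -- ball of the sup norm, and its proper faces form the sphere.
  let e : ({i // Odd (c i)} → ℝ) → Fin n → ℝ := fun y i =>
    if hi : Odd (c i) then (c i + y ⟨i, hi⟩) / (2 * N) else c i / (2 * N)
  let j : (Fin n → ℝ) → {i // Odd (c i)} → ℝ := fun x i => 2 * (N * x i) - c i
  have he : Continuous e := by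
    refine continuous_pi fun i => ?_
    by_cases hi : Odd (c i)
    · simp only [e, hi, dite_true]; fun_prop
    · simp only [e, hi, dite_false]; fun_prop
  have hj : Continuous j := by fun_prop
  have hje : ∀ y, j (e y) = y := by
    intro y
    ext i
    simp only [e, j, i.2, dite_true]
    field_simp
    ring
  have he_even : ∀ y i, ¬ Odd (c i) → 2 * (N * e y i) = c i := by
    intro y i hi
    simp only [e, hi, dite_false]
    field_simp
  have he_odd : ∀ y i, Odd (c i) → ∀ hi : Odd (c i), 2 * (N * e y i) - c i = y ⟨i, hi⟩ :=
    fun y i hi _ => congr_fun (hje y) ⟨i, hi⟩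
  have heB : MapsTo e (closedBall 0 1) (gridCell N c) := by
    intro y hy
    rw [mem_iff]
    refine ⟨fun i hi => ?_, he_even y⟩
    rw [he_odd y i hi hi]
    exact (norm_le_pi_norm y ⟨i, hi⟩).trans (by simpa using hy)
  have hjB : MapsTo j (gridCell N c) (closedBall 0 1) := by
    intro x hx
    rw [mem_closedBall_zero_iff, pi_norm_le_iff_of_nonneg zero_le_one]
    exact fun i => ((mem_iff x).1 hx).1 i i.2
  refine (h.diskLift {i // Odd (c i)}).pairLift.transport e j he.continuousOn hj.continuousOn heB
    hjB ?_ ?_ ?_ (fun x hx => hx.1) sphere_subset_closedBall (fun x hx => hW c x hx.1) ?_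
  · intro y hy
    refine ⟨heB (sphere_subset_closedBall hy), ?_⟩
    rw [ne_iff _ (heB (sphere_subset_closedBall hy))]
    have hy' : ‖y‖ = 1 := by simpa using hy
    by_contra hcon
    push Not at hcon
    have : ‖y‖ < 1 := by
      rw [pi_norm_lt_iff zero_lt_one]
      intro i
      have h1 := hcon i i.2
      rw [he_odd y i i.2 i.2] at h1
      exact lt_of_le_of_ne (hy' ▸ norm_le_pi_norm y i) h1
    exact this.ne hy'
  · rintro x ⟨hx, hx'⟩
    rw [ne_iff x hx] at hx'
    obtain ⟨i, hi, hi'⟩ := hx'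
    rw [mem_sphere_zero_iff_norm]
    refine le_antisymm (by simpa using hjB hx) ?_
    have := norm_le_pi_norm (j x) ⟨i, hi⟩
    rw [← hi']
    exact this
  · intro x hx
    ext i
    by_cases hi : Odd (c i)
    · simp only [e, j, hi, dite_true]
      field_simp
      ring
    · simp only [e, hi, dite_false]
      rw [← ((mem_iff x).1 hx).2 i hi]
      field_simp
  · intro x hx hx'
    have : gridLabel N x = c := by
      by_contra hne
      exact hx' ⟨hx, hne⟩
    simp only [this]

variable {N} in
-- Induction on the number of missing cells. A missing cell of least dimension has all its proper
-- faces present already, so it meets the current union exactly in its boundary.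
theorem pairLift_gridUnion (hN : 0 < N) {p : X → Y} {W : (Fin n → ℤ) → Set Y}
    (hW : ∀ c, ∀ x ∈ gridCell N c, W (gridLabel N x) ⊆ W c)
    {T₂ : Finset (Fin n → ℤ)} (hT₂ : IsLowerLabels N T₂) (h : ∀ c ∈ T₂, LiftsOver p (W c))
    (T₁ : Finset (Fin n → ℤ)) (hT₁ : IsLowerLabels N T₁) (hT : T₁ ⊆ T₂) :
    PairLift p (fun x => W (gridLabel N x)) (gridUnion N T₁) (gridUnion N T₂) := by
  classical
  induction hk : (T₂ \ T₁).card using Nat.strong_induction_on generalizing T₁ with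
  | _ k ih =>
  rcases (T₂ \ T₁).eq_empty_or_nonempty with h0 | hne
  · have : T₁ = T₂ := hT.antisymm (Finset.sdiff_eq_empty_iff_subset.1 h0)
    subst this
    exact PairLift.refl _
  · obtain ⟨c, hc, hmin⟩ := Finset.exists_min_image (T₂ \ T₁) cellDim hne
    rw [Finset.mem_sdiff] at hc
    have face : ∀ x ∈ gridCell N c, gridLabel N x ≠ c → gridLabel N x ∈ T₁ := by
      intro x hx hxc
      by_contra hx1
      exact absurd (hmin _ (Finset.mem_sdiff.2 ⟨hT₂ c hc.1 x hx, hx1⟩))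
        (not_le.2 (cellDim_lt N hx hxc))
    have hT' : insert c T₁ ⊆ T₂ := Finset.insert_subset hc.1 hT
    have hlow : IsLowerLabels N (insert c T₁) := by
      intro d hd x hx
      rcases Finset.mem_insert.1 hd with rfl | hd
      · by_cases hxc : gridLabel N x = d
        · rw [hxc]; exact Finset.mem_insert_self _ _
        · exact Finset.mem_insert_of_mem (face x hx hxc)
      · exact Finset.mem_insert_of_mem (hT₁ d hd x hx)
    have hun : gridUnion N (insert c T₁) = gridUnion N T₁ ∪ gridCell N c := by
      rw [hlow.gridUnion_eq, Finset.set_biUnion_insert, ← hT₁.gridUnion_eq, union_comm]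
    have hint : gridUnion N T₁ ∩ gridCell N c = {x | x ∈ gridCell N c ∧ gridLabel N x ≠ c} := by
      ext x
      constructor
      · rintro ⟨h1, h2⟩
        refine ⟨h2, fun h3 => hc.2 ?_⟩
        rw [← h3]
        exact h1
      · rintro ⟨h1, h2⟩
        exact ⟨face x h1 h2, h1⟩
    have step : PairLift p (fun x => W (gridLabel N x)) (gridUnion N T₁)
        (gridUnion N (insert c T₁)) := by
      rw [hun]
      refine PairLift.union hT₁.isClosed (isClosed_gridCell N c) ?_
      rw [hint]
      exact pairLift_gridCell hN hW c (h c hc.1)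
    refine step.trans ?_ ?_ (ih _ ?_ (insert c T₁) hlow hT' rfl)
    · rw [hun]; exact subset_union_left
    · exact fun x hx => hT' hx
    · rw [← hk]
      refine Finset.card_lt_card (Finset.ssubset_iff_of_subset
        (Finset.sdiff_subset_sdiff subset_rfl (Finset.subset_insert _ _))|>.2 ⟨c, ?_, ?_⟩)
      · exact Finset.mem_sdiff.2 hc
      · simp

end Grid

/-! ### Lifting over a target covered by two open sets -/

section Cover

variable {X : Type u} {Y : Type v} [TopologicalSpace X] [TopologicalSpace Y]

/-- Lebesgue numbers for a cover by two sets. -/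
theorem exists_ball_subset_preimage {E : Type*} [PseudoMetricSpace E] {D : Set E}
    (hD : IsCompact D) {b : E → Y} (hb : ContinuousOn b D) {O : Bool → Set Y}
    (hO : ∀ i, IsOpen (O i)) (hbO : ∀ x ∈ D, ∃ i, b x ∈ O i) :
    ∃ δ > 0, ∀ x ∈ D, ∃ i, ∀ y ∈ ball x δ, y ∈ D → b y ∈ O i := by
  have hc : ∀ i, ∃ c : Set E, IsOpen c ∧ b ⁻¹' O i ∩ D = c ∩ D := fun i =>
    (continuousOn_iff'.1 hb) (O i) (hO i)
  choose c hc hcD using hc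
  obtain ⟨δ, hδ, h⟩ := lebesgue_number_lemma_of_metric hD hc (fun x hx => by
    obtain ⟨i, hi⟩ := hbO x hx
    have : x ∈ c i ∩ D := by rw [← hcD i]; exact ⟨hi, hx⟩
    exact mem_iUnion.2 ⟨i, this.1⟩)
  refine ⟨δ, hδ, fun x hx => ?_⟩
  obtain ⟨i, hi⟩ := h x hx
  refine ⟨i, fun y hy hyD => ?_⟩
  have : y ∈ b ⁻¹' O i ∩ D := by rw [hcD i]; exact ⟨hi hy, hyD⟩
  exact this.1

theorem mem_Icc_of_mem_lineCell {m : ℕ} {y z : ℝ} (hy : y ∈ lineCell (label z))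
    (hz : z ∈ Icc (-(m : ℝ)) m) : y ∈ Icc (-(m : ℝ)) m := by
  rw [lineCell, (label_div_two z).1, (label_div_two z).2] at hy
  have h1 : (-(m : ℤ)) ≤ ⌊z⌋ := Int.le_floor.2 (by push_cast; exact hz.1)
  have h2 : ⌈z⌉ ≤ (m : ℤ) := Int.ceil_le.2 (by push_cast; exact hz.2)
  have h1' : (-(m : ℝ)) ≤ ⌊z⌋ := by exact_mod_cast h1
  have h2' : (⌈z⌉ : ℝ) ≤ m := by exact_mod_cast h2
  exact ⟨h1'.trans hy.1, hy.2.trans h2'⟩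

theorem label_mem_Icc {m : ℕ} {z : ℝ} (hz : z ∈ Icc (-(m : ℝ)) m) :
    label z ∈ Finset.Icc (-(2 * m : ℤ)) (2 * m) := by
  have h1 : (-(m : ℤ)) ≤ ⌊z⌋ := Int.le_floor.2 (by push_cast; exact hz.1)
  have h2 : ⌈z⌉ ≤ (m : ℤ) := Int.ceil_le.2 (by push_cast; exact hz.2)
  have h3 := Int.floor_le_ceil z
  rw [Finset.mem_Icc, label]
  omega

theorem abs_sub_le_one_of_mem_lineCell {y z : ℝ} {c : ℤ} (hy : y ∈ lineCell c)
    (hz : z ∈ lineCell c) : abs (y - z) ≤ 1 := by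
  have h : (c + 1) / 2 ≤ c / 2 + 1 := by omega
  have h' : (((c + 1) / 2 : ℤ) : ℝ) ≤ ((c / 2 : ℤ) : ℝ) + 1 := by exact_mod_cast h
  rw [abs_le]
  constructor <;> linarith [hy.1, hy.2, hz.1, hz.2]

/-- A map that has the lifting property over both members of a cover by two (relatively) open sets
and over their intersection has the lifting property. -/
theorem LiftsOver.of_cover {p : X → Y} {V : Set Y} {O : Bool → Set Y} (hO : ∀ i, IsOpen (O i))
    (hVO : ∀ y ∈ V, ∃ i, y ∈ O i) (h : ∀ i, LiftsOver p (V ∩ O i))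
    (h' : LiftsOver p (V ∩ O true ∩ O false)) : LiftsOver p V := by
  classical
  intro n a b ha hb hbV hab
  obtain ⟨δ, hδ, hball⟩ := exists_ball_subset_preimage (isCompact_closedBall (0 : Fin n → ℝ) 1)
    hb hO fun x hx => hVO _ (hbV hx)
  obtain ⟨m, hm⟩ := exists_nat_one_div_lt hδ
  -- The mesh 1 / N is below the Lebesgue number δ, and N is an integer so that the ball and its
  -- sphere are unions of grid cells.
  set N : ℝ := ((m + 1 : ℕ) : ℝ) with hN
  have hN0 : 0 < N := by rw [hN]; positivity
  have hNδ : 1 < N * δ := by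
    rw [div_lt_iff₀ (by positivity)] at hm
    rw [hN]; push_cast; linarith
  have mem_ball_iff : ∀ x : Fin n → ℝ, x ∈ closedBall (0 : Fin n → ℝ) 1 ↔
      ∀ i, N * x i ∈ Icc (-(((m + 1 : ℕ) : ℝ))) ((m + 1 : ℕ) : ℝ) := by
    intro x
    rw [mem_closedBall_zero_iff, pi_norm_le_iff_of_nonneg zero_le_one]
    refine forall_congr' fun i => ?_
    rw [Real.norm_eq_abs, abs_le, ← hN, mem_Icc]
    constructor
    · rintro ⟨h1, h2⟩; constructor <;> nlinarith
    · rintro ⟨h1, h2⟩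
      constructor
      · by_contra hc; nlinarith
      · by_contra hc; nlinarith
  have cell_sub : ∀ x ∈ closedBall (0 : Fin n → ℝ) 1,
      gridCell N (gridLabel N x) ⊆ closedBall 0 1 := by
    intro x hx y hy
    rw [mem_ball_iff] at hx ⊢
    exact fun i => mem_Icc_of_mem_lineCell (hy i) (hx i)
  have cell_sub_sphere : ∀ x ∈ sphere (0 : Fin n → ℝ) 1,
      gridCell N (gridLabel N x) ⊆ sphere 0 1 := by
    intro x hx y hy
    have hxB := sphere_subset_closedBall hx
    have hyB := cell_sub x hxB hy
    rw [mem_sphere_zero_iff_norm]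
    refine le_antisymm (by simpa using hyB) ?_
    have hx' : ‖x‖ = 1 := by simpa using hx
    obtain ⟨i, hi⟩ : ∃ i, 1 ≤ ‖x i‖ := by
      by_contra hcon
      push Not at hcon
      exact absurd ((pi_norm_lt_iff zero_lt_one).2 hcon) (by rw [hx']; exact lt_irrefl _)
    have hi' : ‖x i‖ = 1 := le_antisymm (hx' ▸ norm_le_pi_norm x i) hi
    have hyx : N * y i = N * x i := by
      have hyi := hy i
      have hint : ∃ k : ℤ, N * x i = k := by
        rw [Real.norm_eq_abs] at hi'
        rcases (abs_eq zero_le_one).1 hi' with h1 | h1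
        · exact ⟨(m + 1 : ℕ), by rw [h1, hN]; push_cast; ring⟩
        · exact ⟨-(m + 1 : ℕ), by rw [h1, hN]; push_cast; ring⟩
      obtain ⟨k, hk⟩ := hint
      rw [gridLabel, lineCell, (label_div_two _).1, (label_div_two _).2, hk, Int.floor_intCast,
        Int.ceil_intCast, Icc_self] at hyi
      rw [hk]
      exact hyi
    have : y i = x i := mul_left_cancel₀ hN0.ne' hyx
    rw [← hi', ← this]
    exact norm_le_pi_norm y i
  have cell_ball : ∀ x : Fin n → ℝ, gridCell N (gridLabel N x) ⊆ ball x δ := by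
    intro x y hy
    rw [mem_ball, dist_pi_lt_iff hδ]
    intro i
    have h1 := abs_sub_le_one_of_mem_lineCell (hy i) (mem_gridCell_gridLabel N x i)
    rw [← mul_sub, abs_mul, abs_of_pos hN0] at h1
    rw [Real.dist_eq]
    by_contra hcon
    push Not at hcon
    nlinarith
  -- the labels of the cells of the ball and of the sphere
  set T₀ : Finset (Fin n → ℤ) := Fintype.piFinset fun _ =>
    Finset.Icc (-(2 * (m + 1 : ℕ) : ℤ)) (2 * (m + 1 : ℕ)) with hT₀
  set T₂ := T₀.filter fun c => ∃ x ∈ closedBall (0 : Fin n → ℝ) 1, gridLabel N x = c with hT₂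
  set T₁ := T₀.filter fun c => ∃ x ∈ sphere (0 : Fin n → ℝ) 1, gridLabel N x = c with hT₁
  have mem_T₀ : ∀ x ∈ closedBall (0 : Fin n → ℝ) 1, gridLabel N x ∈ T₀ := by
    intro x hx
    rw [mem_ball_iff] at hx
    exact Fintype.mem_piFinset.2 fun i => label_mem_Icc (hx i)
  have low₂ : IsLowerLabels N T₂ := by
    intro c hc x hx
    obtain ⟨-, y, hy, rfl⟩ := Finset.mem_filter.1 hc
    have := cell_sub y hy hx
    exact Finset.mem_filter.2 ⟨mem_T₀ x this, x, this, rfl⟩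
  have low₁ : IsLowerLabels N T₁ := by
    intro c hc x hx
    obtain ⟨-, y, hy, rfl⟩ := Finset.mem_filter.1 hc
    have := cell_sub_sphere y hy hx
    exact Finset.mem_filter.2 ⟨mem_T₀ x (sphere_subset_closedBall this), x, this, rfl⟩
  have un₂ : gridUnion N T₂ = closedBall 0 1 := by
    ext x
    constructor
    · intro hx
      obtain ⟨-, y, hy, hyx⟩ := Finset.mem_filter.1 (show gridLabel N x ∈ T₂ from hx)
      exact cell_sub y hy (hyx ▸ mem_gridCell_gridLabel N x)
    · exact fun hx => Finset.mem_filter.2 ⟨mem_T₀ x hx, x, hx, rfl⟩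
  have un₁ : gridUnion N T₁ = sphere 0 1 := by
    ext x
    constructor
    · intro hx
      obtain ⟨-, y, hy, hyx⟩ := Finset.mem_filter.1 (show gridLabel N x ∈ T₁ from hx)
      exact cell_sub_sphere y hy (hyx ▸ mem_gridCell_gridLabel N x)
    · exact fun hx => Finset.mem_filter.2 ⟨mem_T₀ x (sphere_subset_closedBall hx), x, hx, rfl⟩
  -- The homotopy on a cell must stay in every member of the cover that contains the image of the
  -- closed cell. Faces satisfy more such conditions, so W decreases under passage to faces, as the
  -- induction over cells requires. For a cell of the ball at least one condition is present, so W
  -- is V ∩ O i or the triple intersection.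
  set W : (Fin n → ℤ) → Set Y := fun c =>
    {y | y ∈ V ∧ ∀ i, MapsTo b (gridCell N c) (O i) → y ∈ O i} with hW
  have hWlift : ∀ c ∈ T₂, LiftsOver p (W c) := by
    intro c hc
    obtain ⟨-, x, hx, rfl⟩ := Finset.mem_filter.1 hc
    obtain ⟨i, hi⟩ := hball x hx
    have hi' : MapsTo b (gridCell N (gridLabel N x)) (O i) :=
      fun y hy => hi y (cell_ball x hy) (cell_sub x hx hy)
    by_cases hboth : MapsTo b (gridCell N (gridLabel N x)) (O (!i))
    · have : W (gridLabel N x) = V ∩ O true ∩ O false := by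
        ext y
        constructor
        · rintro ⟨h1, h2⟩
          cases i
          · exact ⟨⟨h1, h2 _ hboth⟩, h2 _ hi'⟩
          · exact ⟨⟨h1, h2 _ hi'⟩, h2 _ hboth⟩
        · rintro ⟨⟨h1, h2⟩, h3⟩
          exact ⟨h1, fun k _ => by cases k <;> assumption⟩
      rw [this]
      exact h'
    · have : W (gridLabel N x) = V ∩ O i := by
        ext y
        constructor
        · rintro ⟨h1, h2⟩
          exact ⟨h1, h2 _ hi'⟩
        · rintro ⟨h1, h2⟩
          refine ⟨h1, fun k hk => ?_⟩
          rcases Bool.eq_or_eq_not k i with rfl | rfl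
          · exact h2
          · exact absurd hk hboth
      rw [this]
      exact h i
  have hbW : ∀ x ∈ closedBall (0 : Fin n → ℝ) 1, b x ∈ W (gridLabel N x) := fun x hx =>
    ⟨hbV hx, fun i hi => hi (mem_gridCell_gridLabel N x)⟩
  have key := pairLift_gridUnion hN0 (p := p) (W := W)
    (fun c x hx y hy => ⟨hy.1, fun i hi => hy.2 i (hi.mono_left (gridCell_gridLabel_subset N hx))⟩)
    low₂ hWlift T₁ low₁
    (fun c hc => by
      obtain ⟨h1, x, hx, rfl⟩ := Finset.mem_filter.1 hc
      exact Finset.mem_filter.2 ⟨h1, x, sphere_subset_closedBall hx, rfl⟩)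
  rw [un₁, un₂] at key
  -- The homotopy prescribed on the sphere is the constant one; its extension is then automatically
  -- relative to the sphere.
  obtain ⟨a', H, ha', haa, hH, hHb, hHV, h0, h1⟩ := key a b (fun z => b z.1) ha hb hbW
    ((hb.mono sphere_subset_closedBall).comp continuousOn_fst fun z hz => hz.1)
    (fun x hx t _ => hbW x (sphere_subset_closedBall hx)) (fun x hx => (hab hx).symm)
    (fun x _ => rfl)
  exact ⟨a', H, ha', haa, hH, fun z hz => (hHV z.1 hz.1 z.2 hz.2).1, h0, h1,
    fun x hx t ht => hHb (x := (x, t)) ⟨hx, ht⟩⟩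

end Cover

theorem notMem_sphere_fin_zero (z : Fin 0 → ℝ) : z ∉ sphere (0 : Fin 0 → ℝ) 1 := by
  rw [Subsingleton.elim z 0, mem_sphere_zero_iff_norm, norm_zero]
  exact zero_ne_one

/-! ### Loops on cubes as maps of balls -/

section Cubes

variable {n : ℕ}

/-- The affine map from the unit ball of `Fin n → ℝ` to the standard cube. -/
def toCube (x : Fin n → ℝ) : Fin n → unitInterval :=
  fun i => projIcc 0 1 zero_le_one ((x i + 1) / 2)

/-- The affine map from the standard cube to the unit ball of `Fin n → ℝ`. -/
def fromCube (y : Fin n → unitInterval) : Fin n → ℝ := fun i => 2 * (y i : ℝ) - 1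

theorem continuous_toCube : Continuous (toCube (n := n)) :=
  continuous_pi fun i => continuous_projIcc.comp (by fun_prop)

theorem continuous_fromCube : Continuous (fromCube (n := n)) := by
  unfold fromCube
  fun_prop

theorem fromCube_mem (y : Fin n → unitInterval) : fromCube y ∈ closedBall (0 : Fin n → ℝ) 1 := by
  rw [mem_closedBall_zero_iff, pi_norm_le_iff_of_nonneg zero_le_one]
  intro i
  rw [Real.norm_eq_abs, abs_le, fromCube]
  constructor <;> linarith [(y i).2.1, (y i).2.2]

theorem fromCube_toCube {x : Fin n → ℝ} (hx : x ∈ closedBall (0 : Fin n → ℝ) 1) :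
    fromCube (toCube x) = x := by
  rw [mem_closedBall_zero_iff, pi_norm_le_iff_of_nonneg zero_le_one] at hx
  ext i
  have hi := hx i
  rw [Real.norm_eq_abs, abs_le] at hi
  simp only [fromCube, toCube]
  rw [projIcc_of_mem zero_le_one (x := (x i + 1) / 2) ⟨by linarith, by linarith⟩]
  ring

theorem toCube_fromCube (y : Fin n → unitInterval) : toCube (fromCube y) = y := by
  ext i
  simp [toCube, fromCube]

theorem fromCube_boundary {y : Fin n → unitInterval} (hy : y ∈ Cube.boundary (Fin n)) :
    fromCube y ∈ sphere (0 : Fin n → ℝ) 1 := by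
  obtain ⟨i, hi⟩ := hy
  rw [mem_sphere_zero_iff_norm]
  refine le_antisymm (by simpa using fromCube_mem y) ?_
  refine le_trans ?_ (norm_le_pi_norm (fromCube y) i)
  rcases hi with hi | hi <;> (simp [fromCube, hi]; try norm_num)

theorem toCube_boundary {x : Fin n → ℝ} (hx : x ∈ sphere (0 : Fin n → ℝ) 1) :
    toCube x ∈ Cube.boundary (Fin n) := by
  have hx' : ‖x‖ = 1 := by simpa using hx
  obtain ⟨i, hi⟩ : ∃ i, 1 ≤ ‖x i‖ := by
    by_contra hcon
    push Not at hcon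
    exact absurd ((pi_norm_lt_iff zero_lt_one).2 hcon) (by rw [hx']; exact lt_irrefl _)
  refine ⟨i, ?_⟩
  rw [Real.norm_eq_abs, le_abs'] at hi
  simp only [toCube]
  rcases hi with h | h
  · exact Or.inl (projIcc_of_le_left _ (by linarith))
  · exact Or.inr (projIcc_of_right_le _ (by linarith))

variable {X : Type u} [TopologicalSpace X]

/-- The loop given by a function on the unit ball that is constant on the unit sphere. -/
def toGenLoop (a : (Fin n → ℝ) → X) (x : X) (ha : ContinuousOn a (closedBall 0 1))
    (hS : ∀ z ∈ sphere (0 : Fin n → ℝ) 1, a z = x) : GenLoop (Fin n) X x :=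
  ⟨⟨a ∘ fromCube, ha.comp_continuous continuous_fromCube fromCube_mem⟩,
    fun _ hy => hS _ (fromCube_boundary hy)⟩

theorem exists_homotopy_of_homotopic {x : X} {α β : GenLoop (Fin n) X x}
    (h : GenLoop.Homotopic α β) :
    ∃ G : (Fin n → ℝ) × ℝ → X, Continuous G ∧ (∀ z, G (z, 0) = α (toCube z)) ∧
      (∀ z, G (z, 1) = β (toCube z)) ∧ ∀ z ∈ sphere (0 : Fin n → ℝ) 1, ∀ t, G (z, t) = x := by
  obtain ⟨F⟩ := h
  refine ⟨fun z => F (projIcc 0 1 zero_le_one z.2, toCube z.1), ?_, ?_, ?_, ?_⟩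
  · exact F.continuous.comp ((continuous_projIcc.comp continuous_snd).prodMk
      (continuous_toCube.comp continuous_fst))
  · intro z
    simp only [projIcc_left]
    exact F.apply_zero _
  · intro z
    simp only [projIcc_right]
    exact F.apply_one _
  · intro z hz t
    exact (F.eq_fst _ (toCube_boundary hz)).trans (α.2 _ (toCube_boundary hz))

theorem homotopic_of_homotopy {x : X} {α β : GenLoop (Fin n) X x} (G : (Fin n → ℝ) × ℝ → X)
    (hG : ContinuousOn G (closedBall 0 1 ×ˢ Icc 0 1)) (h0 : ∀ y, G (fromCube y, 0) = α y)
    (h1 : ∀ y, G (fromCube y, 1) = β y)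
    (hS : ∀ z ∈ sphere (0 : Fin n → ℝ) 1, ∀ t ∈ Icc (0 : ℝ) 1, G (z, t) = x) :
    GenLoop.Homotopic α β :=
  ⟨{ toFun := fun z => G (fromCube z.2, z.1)
     continuous_toFun := hG.comp_continuous
      ((continuous_fromCube.comp continuous_snd).prodMk (by fun_prop))
      fun z => ⟨fromCube_mem _, z.1.2⟩
     map_zero_left := fun y => h0 y
     map_one_left := fun y => h1 y
     prop' := fun t y hy => (hS _ (fromCube_boundary hy) t t.2).trans (α.2 y hy).symm }⟩

theorem joined_of_homotopy {E : Type*} [TopologicalSpace E] {D : Set E} {G : E × ℝ → X}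
    (hG : ContinuousOn G (D ×ˢ Icc 0 1)) {z : E} (hz : z ∈ D) : Joined (G (z, 0)) (G (z, 1)) :=
  ⟨{ toFun := fun t => G (z, t)
     continuous_toFun := hG.comp_continuous (by fun_prop) fun t => ⟨hz, t.2⟩
     source' := rfl
     target' := rfl }⟩

end Cubes

/-! ### Weak equivalences solve lifting problems -/

section Forward

variable {X : Type u} {Y : Type v} [TopologicalSpace X] [TopologicalSpace Y]

theorem joined_of_joined_map {f : C(X, Y)} (hf : WeakEquiv.IsWeakEquivalence f) {x x' : X}
    (h : Joined (f x) (f x')) : Joined x x' := by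
  have : ZerothHomotopy.mk x = ZerothHomotopy.mk x' :=
    hf.1.1 (Quotient.sound (s := pathSetoid Y) h)
  exact Quotient.exact (s := pathSetoid X) this

theorem exists_joined_map {f : C(X, Y)} (hf : WeakEquiv.IsWeakEquivalence f) (y : Y) :
    ∃ x, Joined (f x) y := by
  obtain ⟨x, hx⟩ := hf.1.2 (ZerothHomotopy.mk y)
  obtain ⟨x, rfl⟩ := ZerothHomotopy.mk_surjective x
  exact ⟨x, Quotient.exact (s := pathSetoid Y) hx⟩

/-- This is the injectivity half of the hypothesis: on path components for n = 0, and otherwise on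
the n-th homotopy group, comparing the class of α with that of the constant loop. -/
theorem exists_nullhomotopy {f : C(X, Y)} (hf : WeakEquiv.IsWeakEquivalence f) {n : ℕ}
    {x₀ : X} {α : (Fin n → ℝ) → X} (hα : ContinuousOn α (closedBall 0 1))
    (hαS : ∀ z ∈ sphere (0 : Fin n → ℝ) 1, α z = x₀) {K : (Fin n → ℝ) × ℝ → Y}
    (hK : ContinuousOn K (closedBall 0 1 ×ˢ Icc 0 1))
    (hK0 : ∀ z ∈ closedBall (0 : Fin n → ℝ) 1, K (z, 0) = f (α z))
    (hK1 : ∀ z ∈ closedBall (0 : Fin n → ℝ) 1, K (z, 1) = f x₀)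
    (hKS : ∀ z ∈ sphere (0 : Fin n → ℝ) 1, ∀ t ∈ Icc (0 : ℝ) 1, K (z, t) = f x₀) :
    ∃ G : (Fin n → ℝ) × ℝ → X, ContinuousOn G (closedBall 0 1 ×ˢ Icc 0 1) ∧
      (∀ z ∈ closedBall (0 : Fin n → ℝ) 1, G (z, 0) = α z) ∧
      (∀ z ∈ closedBall (0 : Fin n → ℝ) 1, G (z, 1) = x₀) ∧
      ∀ z ∈ sphere (0 : Fin n → ℝ) 1, ∀ t ∈ Icc (0 : ℝ) 1, G (z, t) = x₀ := by
  cases n with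
  | zero =>
    have hz : ∀ z : Fin 0 → ℝ, z = 0 := fun z => Subsingleton.elim _ _
    have h := joined_of_homotopy hK (z := 0) (by simp)
    rw [hK0 0 (by simp), hK1 0 (by simp)] at h
    obtain ⟨γ⟩ := joined_of_joined_map hf h
    refine ⟨fun z => γ.extend z.2, (γ.continuous_extend.comp continuous_snd).continuousOn, ?_, ?_,
      ?_⟩
    · intro z _
      rw [hz z]
      simp
    · simp
    · exact fun z hz' => absurd hz' (notMem_sphere_fin_zero z)
  | succ n =>
    let A := toGenLoop α x₀ hα hαS
    have h1 : WeakEquiv.piMap f (n + 1) x₀ (Quotient.mk _ A) =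
        WeakEquiv.piMap f (n + 1) x₀ (Quotient.mk _ GenLoop.const) := by
      refine Quotient.sound (s := GenLoop.Homotopic.setoid (Fin (n + 1)) (f x₀))
        (homotopic_of_homotopy K hK (fun y => hK0 _ (fromCube_mem y))
        (fun y => hK1 _ (fromCube_mem y)) hKS)
    have h2 : GenLoop.Homotopic A GenLoop.const :=
      Quotient.exact (s := GenLoop.Homotopic.setoid (Fin (n + 1)) x₀) ((hf.2 n x₀).1 h1)
    obtain ⟨G, hG, hG0, hG1, hGS⟩ := exists_homotopy_of_homotopic h2
    refine ⟨G, hG.continuousOn, fun z hz => ?_, fun z _ => hG1 z, fun z hz t _ => hGS z hz t⟩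
    rw [hG0]
    change α (fromCube (toCube z)) = α z
    rw [fromCube_toCube hz]

/-- A ball whose boundary goes to f x₀ is an element of a homotopy group of the target; surjectivity
provides the lift, and the homotopy of loops is relative to the boundary. -/
theorem solvable_const {f : C(X, Y)} (hf : WeakEquiv.IsWeakEquivalence f) {n : ℕ} (x₀ : X)
    {b : (Fin (n + 1) → ℝ) → Y} (hb : ContinuousOn b (closedBall 0 1))
    (hbS : ∀ z ∈ sphere (0 : Fin (n + 1) → ℝ) 1, b z = f x₀) :
    Solvable f univ (fun _ => x₀) b := by
  let B := toGenLoop b (f x₀) hb hbS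
  obtain ⟨A, hA⟩ := (hf.2 n x₀).2 (Quotient.mk _ B)
  obtain ⟨A, rfl⟩ := Quotient.exists_rep A
  have h : GenLoop.Homotopic (WeakEquiv.genLoopMap f (n + 1) x₀ A) B :=
    Quotient.exact (s := GenLoop.Homotopic.setoid (Fin (n + 1)) (f x₀)) hA
  obtain ⟨G, hG, hG0, hG1, hGS⟩ := exists_homotopy_of_homotopic h
  refine ⟨fun z => A (toCube z), G, (A.1.continuous.comp continuous_toCube).continuousOn,
    fun z hz => A.2 _ (toCube_boundary hz), hG.continuousOn, mapsTo_univ _ _, fun z _ => hG0 z,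
    fun z hz => ?_, fun z hz t _ => ?_⟩
  · rw [hG1]
    change b (fromCube (toCube z)) = b z
    rw [fromCube_toCube hz]
  · rw [hGS z hz t, hbS z hz]

/-- All lifting problems that restrict to the given map on the sphere are solvable. -/
def AllSolvable {E : Type*} [NormedAddCommGroup E] [NormedSpace ℝ E] (p : X → Y) (a : E → X) :
    Prop :=
  ∀ b : E → Y, ContinuousOn b (closedBall 0 1) → EqOn (p ∘ a) b (sphere 0 1) →
    Solvable p univ a b

theorem Solvable.congr_right {E : Type*} [NormedAddCommGroup E] [NormedSpace ℝ E] {p : X → Y}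
    {V : Set Y} {a a₁ : E → X} {b b₁ : E → Y} (h : Solvable p V a b)
    (ha : EqOn a a₁ (sphere 0 1)) (hb : EqOn b b₁ (closedBall 0 1)) : Solvable p V a₁ b₁ := by
  obtain ⟨a', H, h1, h2, h3, h4, h5, h6, h7⟩ := h
  exact ⟨a', H, h1, h2.trans ha, h3, h4, h5, fun x hx => (h6 x hx).trans (hb hx),
    fun x hx t ht => (h7 x hx t ht).trans (hb (sphere_subset_closedBall hx))⟩

/-- Quantifying over all b is what lets the data on the sphere alone be deformed: the image of A
extends, starting from b, to a homotopy of the whole ball, and a problem over the deformed sphere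
map results. -/
theorem AllSolvable.of_homotopy {E : Type*} [NormedAddCommGroup E] [NormedSpace ℝ E] {p : X → Y}
    (hp : Continuous p) {a a₁ : E → X} {A : E × ℝ → X}
    (hA : ContinuousOn A (sphere 0 1 ×ˢ Icc 0 1))
    (h0 : ∀ x ∈ sphere (0 : E) 1, A (x, 0) = a x) (h1 : ∀ x ∈ sphere (0 : E) 1, A (x, 1) = a₁ x)
    (h : AllSolvable p a₁) : AllSolvable p a := by
  intro b hb hab
  obtain ⟨B, hB, hB0, hBS, -⟩ := exists_homotopy_extension hb (hp.comp_continuousOn hA)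
    (fun x hx => by simp only [Function.comp, h0 x hx]; exact hab hx)
  have := Solvable.of_homotopy (p := p) (V := univ) hA hB (mapsTo_univ _ _)
    (fun x hx t ht => (hBS x hx t ht).symm)
    ((h (fun x => B (x, 1)) (hB.comp (by fun_prop) fun x hx => ⟨hx, by simp⟩) (fun x hx => by
      simp only [hBS x hx 1 (by simp), Function.comp, h1 x hx])).congr_right (fun x hx => (h1 x hx).symm)
      fun _ _ => rfl)
  exact this.congr_right h0 hB0

section Prism

variable {E : Type*} [NormedAddCommGroup E]

/-- The boundary of a prism without its top face. -/
def openBox (E : Type*) [NormedAddCommGroup E] : Set (ℝ × E) :=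
  sphere 0 1 ∩ ({z | z.1 = -1} ∪ {z | ‖z.2‖ = 1})

/-- The top face of a prism. -/
def lid (E : Type*) [NormedAddCommGroup E] : Set (ℝ × E) := {1} ×ˢ closedBall 0 1

theorem isClosed_openBox : IsClosed (openBox E) :=
  isClosed_sphere.inter ((isClosed_eq (by fun_prop) (by fun_prop)).union
    (isClosed_eq (by fun_prop) (by fun_prop)))

theorem isClosed_lid : IsClosed (lid E) := isClosed_singleton.prod isClosed_closedBall

theorem mem_prism_ball {z : ℝ × E} :
    z ∈ closedBall (0 : ℝ × E) 1 ↔ z.1 ∈ Icc (-1 : ℝ) 1 ∧ z.2 ∈ closedBall (0 : E) 1 := by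
  rw [mem_closedBall_zero_iff, mem_closedBall_zero_iff, Prod.norm_def, max_le_iff,
    Real.norm_eq_abs, abs_le, mem_Icc]

theorem mem_prism_sphere {z : ℝ × E} :
    z ∈ sphere (0 : ℝ × E) 1 ↔ z ∈ closedBall (0 : ℝ × E) 1 ∧ (z.1 = 1 ∨ z.1 = -1 ∨ ‖z.2‖ = 1) := by
  constructor
  · intro h
    refine ⟨sphere_subset_closedBall h, ?_⟩
    rw [mem_sphere_zero_iff_norm, Prod.norm_def] at h
    rcases max_choice ‖z.1‖ ‖z.2‖ with h' | h'
    · rw [h', Real.norm_eq_abs, abs_eq zero_le_one] at h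
      tauto
    · rw [h'] at h
      tauto
  · rintro ⟨h, h'⟩
    rw [mem_sphere_zero_iff_norm]
    refine le_antisymm (by simpa using h) ?_
    rw [Prod.norm_def]
    rcases h' with h' | h' | h'
    · exact le_max_of_le_left (by rw [h']; simp)
    · exact le_max_of_le_left (by rw [h']; simp)
    · exact le_max_of_le_right h'.ge

theorem prism_sphere_eq : sphere (0 : ℝ × E) 1 = openBox E ∪ lid E := by
  ext z
  constructor
  · intro h
    obtain ⟨h1, h2⟩ := mem_prism_sphere.1 h
    rcases h2 with h2 | h2 | h2
    · exact Or.inr ⟨h2, (mem_prism_ball.1 h1).2⟩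
    · exact Or.inl ⟨h, Or.inl h2⟩
    · exact Or.inl ⟨h, Or.inr h2⟩
  · rintro (h | h)
    · exact h.1
    · have h1 : z.1 = 1 := h.1
      exact mem_prism_sphere.2 ⟨mem_prism_ball.2 ⟨by rw [h1]; norm_num, h.2⟩, Or.inl h1⟩

theorem lid_mem {x : E} (hx : x ∈ closedBall (0 : E) 1) : ((1 : ℝ), x) ∈ sphere (0 : ℝ × E) 1 := by
  rw [prism_sphere_eq]
  exact Or.inr ⟨rfl, hx⟩

theorem openBox_of_sphere {x : E} (hx : x ∈ sphere (0 : E) 1) {s : ℝ} (hs : s ∈ Icc (-1 : ℝ) 1) :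
    (s, x) ∈ openBox E := by
  have hx' : ‖x‖ = 1 := by simpa using hx
  exact ⟨mem_prism_sphere.2 ⟨mem_prism_ball.2 ⟨hs, sphere_subset_closedBall hx⟩,
    Or.inr (Or.inr hx')⟩, Or.inr hx'⟩

theorem bottom_mem {x : E} (hx : x ∈ closedBall (0 : E) 1) : ((-1 : ℝ), x) ∈ openBox E :=
  ⟨mem_prism_sphere.2 ⟨mem_prism_ball.2 ⟨by norm_num, hx⟩, Or.inr (Or.inl rfl)⟩, Or.inl rfl⟩

theorem exists_glue_prism {h : (ℝ × E) × ℝ → X} {F : E × ℝ → X}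
    (hh : ContinuousOn h (openBox E ×ˢ Icc 0 1)) (hF : ContinuousOn F (closedBall 0 1 ×ˢ Icc 0 1))
    (hhF : ∀ x ∈ sphere (0 : E) 1, ∀ t ∈ Icc (0 : ℝ) 1, h ((1, x), t) = F (x, t)) :
    ∃ A : (ℝ × E) × ℝ → X, ContinuousOn A (sphere 0 1 ×ˢ Icc 0 1) ∧
      EqOn A h (openBox E ×ˢ Icc 0 1) ∧
      ∀ x ∈ closedBall (0 : E) 1, ∀ t ∈ Icc (0 : ℝ) 1, A ((1, x), t) = F (x, t) := by
  obtain ⟨A, hA, hA1, hA2⟩ := exists_glue (isClosed_openBox.prod isClosed_Icc)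
    (isClosed_lid.prod isClosed_Icc) hh
    (hF.comp (f := fun z : (ℝ × E) × ℝ => (z.1.2, z.2)) (s := lid E ×ˢ Icc 0 1) (by fun_prop)
      fun z hz => ⟨hz.1.2, hz.2⟩)
    (by
      rintro ⟨⟨s, x⟩, t⟩ ⟨⟨h1, ht⟩, ⟨h2, -⟩⟩
      have hs : s = 1 := h2.1
      subst hs
      refine hhF x ?_ t ht
      rcases h1.2 with h3 | h3
      · have : (1 : ℝ) = -1 := h3
        norm_num at this
      · simpa using h3)
  rw [← union_prod, ← prism_sphere_eq] at hA
  exact ⟨A, hA, hA1, fun x hx t ht => hA2 (x := ((1, x), t)) ⟨⟨rfl, hx⟩, ht⟩⟩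

/-- A homotopy on the open box extends to the boundary of the prism. -/
theorem exists_extension_prism [NormedSpace ℝ E] {a : ℝ × E → X} (ha : ContinuousOn a (sphere 0 1))
    {h : (ℝ × E) × ℝ → X} (hh : ContinuousOn h (openBox E ×ˢ Icc 0 1))
    (h0 : ∀ z ∈ openBox E, h (z, 0) = a z) :
    ∃ A : (ℝ × E) × ℝ → X, ContinuousOn A (sphere 0 1 ×ˢ Icc 0 1) ∧
      EqOn A h (openBox E ×ˢ Icc 0 1) ∧ ∀ z ∈ sphere (0 : ℝ × E) 1, A (z, 0) = a z := by
  obtain ⟨F, hF, hF0, hFS, -⟩ := exists_homotopy_extension (k := fun x : E => a (1, x))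
    (h := fun z => h ((1, z.1), z.2)) (ha.comp (by fun_prop) fun x hx => lid_mem hx)
    (hh.comp (by fun_prop) fun z hz => ⟨openBox_of_sphere hz.1 (by norm_num), hz.2⟩)
    (fun x hx => h0 _ (openBox_of_sphere hx (by norm_num)))
  obtain ⟨A, hA, hA1, hA2⟩ := exists_glue_prism hh hF fun x hx t ht => (hFS x hx t ht).symm
  refine ⟨A, hA, hA1, fun z hz => ?_⟩
  rw [prism_sphere_eq] at hz
  rcases hz with hz | ⟨h1, h2⟩
  · rw [hA1 (x := (z, 0)) ⟨hz, by simp⟩, h0 z hz]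
  · obtain ⟨s, x⟩ := z
    have hs : s = 1 := h1
    subst hs
    rw [hA2 x h2 0 (by simp), hF0 x h2]

end Prism

/-- The boundary of a prism is an open box, which is contractible, together with a lid. Deforming
the map to be constant on the box turns the lid into a loop, whose image bounds through b.
Injectivity contracts this loop in the source, and what is left is a map constant on the whole
sphere, settled by surjectivity. -/
theorem diskLift_prism {f : C(X, Y)} (hf : WeakEquiv.IsWeakEquivalence f) {n : ℕ}
    (e : (Fin (n + 1) → ℝ) ≃ₗᵢ[ℝ] ℝ × (Fin n → ℝ)) :
    DiskLift (ℝ × (Fin n → ℝ)) f univ := by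
  -- the case of a map that is constant on the sphere
  have s4 : ∀ x₀ : X, AllSolvable f (fun _ : ℝ × (Fin n → ℝ) => x₀) := by
    intro x₀ b hb hab
    refine Solvable.congr e (solvable_const hf x₀ (hb.comp e.continuous.continuousOn ?_) ?_)
    · intro z hz; simpa using hz
    · intro z hz
      exact (hab (x := e z) (by simpa using hz)).symm
  -- the case of a map that is constant on the open box
  have s3 : ∀ (x₀ : X) (a : ℝ × (Fin n → ℝ) → X), ContinuousOn a (sphere 0 1) →
      (∀ z ∈ openBox (Fin n → ℝ), a z = x₀) → AllSolvable f a := by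
    intro x₀ a ha haJ b hb hab
    -- Read from the lid down to the bottom, b itself is a nullhomotopy of the image of the lid: 1 -
    -- 2t runs from 1 to -1.
    obtain ⟨G, hG, hG0, hG1, hGS⟩ := exists_nullhomotopy hf (x₀ := x₀) (α := fun x => a (1, x))
      (ha.comp (by fun_prop) fun x hx => lid_mem hx)
      (fun x hx => haJ _ (openBox_of_sphere hx (by norm_num)))
      (K := fun z => b (1 - 2 * z.2, z.1))
      (hb.comp (by fun_prop) (by
        rintro ⟨x, t⟩ ⟨hx, ht⟩
        simp only [mem_Icc] at ht
        exact mem_prism_ball.2 ⟨by simp only [mem_Icc]; constructor <;> linarith, hx⟩))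
      (by
        intro x hx
        have := hab (lid_mem hx)
        simp only [Function.comp] at this
        simp [this])
      (by
        intro x hx
        have h1 := hab (bottom_mem hx).1
        simp only [Function.comp] at h1
        rw [haJ _ (bottom_mem hx)] at h1
        simp only [h1]
        norm_num)
      (by
        intro x hx t ht
        simp only [mem_Icc] at ht
        have h3 := openBox_of_sphere hx (s := 1 - 2 * t) (by constructor <;> linarith)
        have h1 := hab h3.1
        simp only [Function.comp] at h1
        rw [haJ _ h3] at h1
        simp only [h1])
    obtain ⟨A, hA, hA1, hA2⟩ := exists_glue_prism (h := fun _ => x₀) (F := G) continuousOn_const hG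
      (fun x hx t ht => (hGS x hx t ht).symm)
    refine AllSolvable.of_homotopy f.continuous (a₁ := fun _ => x₀) hA ?_ ?_ (s4 x₀) b hb hab
    · intro z hz
      rw [prism_sphere_eq] at hz
      rcases hz with hz | ⟨h1, h2⟩
      · rw [hA1 (x := (z, 0)) ⟨hz, by simp⟩, haJ z hz]
      · obtain ⟨s, x⟩ := z
        have hs : s = 1 := h1
        subst hs
        rw [hA2 x h2 0 (by simp), hG0 x h2]
    · intro z hz
      rw [prism_sphere_eq] at hz
      rcases hz with hz | ⟨h1, h2⟩
      · exact hA1 (x := (z, 1)) ⟨hz, by simp⟩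
      · obtain ⟨s, x⟩ := z
        have hs : s = 1 := h1
        subst hs
        rw [hA2 x h2 1 (by simp), hG1 x h2]
  -- contract the bottom face
  have s2 : ∀ a : ℝ × (Fin n → ℝ) → X, ContinuousOn a (sphere 0 1) →
      (∀ z ∈ openBox (Fin n → ℝ), a z = a (-1, z.2)) → AllSolvable f a := by
    intro a ha haJ
    have m : ∀ z ∈ openBox (Fin n → ℝ), ∀ t ∈ Icc (0 : ℝ) 1,
        (1 - t) • z.2 ∈ closedBall (0 : Fin n → ℝ) 1 := by
      intro z hz t ht
      have h1 := (mem_prism_ball.1 (sphere_subset_closedBall hz.1)).2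
      rw [mem_closedBall_zero_iff] at h1 ⊢
      rw [norm_smul, Real.norm_of_nonneg (by linarith [ht.2])]
      exact mul_le_one₀ (by linarith [ht.1]) (norm_nonneg _) h1
    obtain ⟨A, hA, hA1, hA0⟩ := exists_extension_prism ha
      (h := fun z => a (-1, (1 - z.2) • z.1.2))
      (ha.comp (by fun_prop) fun z hz => (bottom_mem (m z.1 hz.1 z.2 hz.2)).1)
      (fun z hz => by simpa using (haJ z hz).symm)
    refine AllSolvable.of_homotopy f.continuous (a₁ := fun z => A (z, 1)) hA hA0 (fun _ _ => rfl)
      (s3 (a (-1, 0)) _ (hA.comp (by fun_prop) fun z hz => ⟨hz, by simp⟩) ?_)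
    intro z hz
    rw [hA1 (x := (z, 1)) ⟨hz, by simp⟩]
    simp
  -- push the sides down to the bottom face
  intro a b ha hb _ hab
  refine (?_ : AllSolvable f a) b hb hab
  obtain ⟨A, hA, hA1, hA0⟩ := exists_extension_prism ha
    (h := fun z => a ((1 - z.2) * z.1.1 - z.2, z.1.2))
    (ha.comp (by fun_prop) (by
      rintro ⟨⟨s, x⟩, t⟩ ⟨hz, ht⟩
      simp only [mem_Icc] at ht
      have h1 := (mem_prism_ball.1 (sphere_subset_closedBall hz.1))
      rcases hz.2 with h | h
      · have hs : s = -1 := h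
        subst hs
        have : (1 - t) * -1 - t = -1 := by ring
        simp only [this]
        exact (bottom_mem h1.2).1
      · have h' : ‖x‖ = 1 := h
        have h2 := h1.1
        simp only [mem_Icc] at h2
        exact (openBox_of_sphere (by simpa using h')
          (by simp only [mem_Icc]; constructor <;> nlinarith)).1))
    (fun z _ => by simp)
  refine AllSolvable.of_homotopy f.continuous (a₁ := fun z => A (z, 1)) hA hA0 (fun _ _ => rfl)
      (s2 _ (hA.comp (by fun_prop) fun z hz => ⟨hz, by simp⟩) ?_)
  intro z hz
  have h1 := (mem_prism_ball.1 (sphere_subset_closedBall hz.1)).2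
  rw [hA1 (x := (z, 1)) ⟨hz, by simp⟩, hA1 (x := ((-1, z.2), 1)) ⟨bottom_mem h1, by simp⟩]
  simp

/-- The isometry between a cube and a prism over a cube. -/
def prismIsometry (n : ℕ) : ℝ × (Fin n → ℝ) ≃ₗᵢ[ℝ] (Fin (n + 1) → ℝ) :=
  { Fin.consLinearEquiv ℝ (fun _ : Fin (n + 1) => ℝ) with
    norm_map' := fun z => by
      change ‖(Fin.cons z.1 z.2 : Fin (n + 1) → ℝ)‖ = ‖z‖
      rw [Prod.norm_def]
      refine le_antisymm ((pi_norm_le_iff_of_nonneg (le_max_of_le_left (norm_nonneg _))).2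
        fun i => ?_) (max_le ?_ ((pi_norm_le_iff_of_nonneg (norm_nonneg _)).2 fun i => ?_))
      · refine Fin.cases ?_ (fun j => ?_) i
        · exact le_max_left _ _
        · exact le_max_of_le_right (norm_le_pi_norm z.2 j)
      · exact norm_le_pi_norm (Fin.cons z.1 z.2 : Fin (n + 1) → ℝ) 0
      · exact norm_le_pi_norm (Fin.cons z.1 z.2 : Fin (n + 1) → ℝ) i.succ }

/-- In dimension 0 the sphere is empty and the problem is surjectivity on path components; every
other cube is a prism over a cube. -/
theorem _root_.WeakEquiv.IsWeakEquivalence.liftsOver {f : C(X, Y)}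
    (hf : WeakEquiv.IsWeakEquivalence f) : LiftsOver f univ := by
  intro n
  cases n with
  | zero =>
    intro a b _ _ _ _
    have hz : ∀ z : Fin 0 → ℝ, z = 0 := fun z => Subsingleton.elim _ _
    obtain ⟨x, ⟨γ⟩⟩ := exists_joined_map hf (b 0)
    refine ⟨fun _ => x, fun z => γ.extend z.2, continuousOn_const, ?_,
      (γ.continuous_extend.comp continuous_snd).continuousOn, mapsTo_univ _ _, ?_, ?_, ?_⟩
    · exact fun z hz' => absurd hz' (notMem_sphere_fin_zero z)
    · simp
    · intro z _
      rw [hz z]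
      simp
    · exact fun z hz' => absurd hz' (notMem_sphere_fin_zero z)
  | succ n => exact (diskLift_prism hf (prismIsometry n).symm).congr (prismIsometry n)

end Forward

/-! ### Solvable lifting problems give weak equivalences -/

section Backward

variable {X : Type u} {Y : Type v} [TopologicalSpace X] [TopologicalSpace Y]

/-- A homotopy in the target, relative to the sphere, between images of maps lifts. -/
theorem LiftsOver.exists_homotopy {f : X → Y} (h : LiftsOver f univ) {n : ℕ}
    {α β : (Fin n → ℝ) → X} (hα : ContinuousOn α (closedBall 0 1))
    (hβ : ContinuousOn β (closedBall 0 1)) (hαβ : EqOn α β (sphere 0 1))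
    {K : (Fin n → ℝ) × ℝ → Y} (hK : ContinuousOn K (closedBall 0 1 ×ˢ Icc 0 1))
    (hK0 : ∀ z ∈ closedBall (0 : Fin n → ℝ) 1, K (z, 0) = f (α z))
    (hK1 : ∀ z ∈ closedBall (0 : Fin n → ℝ) 1, K (z, 1) = f (β z))
    (hKS : ∀ z ∈ sphere (0 : Fin n → ℝ) 1, ∀ t ∈ Icc (0 : ℝ) 1, K (z, t) = f (α z)) :
    ∃ G : (Fin n → ℝ) × ℝ → X, ContinuousOn G (closedBall 0 1 ×ˢ Icc 0 1) ∧
      (∀ z ∈ closedBall (0 : Fin n → ℝ) 1, G (z, 0) = α z) ∧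
      (∀ z ∈ closedBall (0 : Fin n → ℝ) 1, G (z, 1) = β z) ∧
      ∀ z ∈ sphere (0 : Fin n → ℝ) 1, ∀ t ∈ Icc (0 : ℝ) 1, G (z, t) = α z := by
  -- On the boundary of the prism α is used below height 0 and β above. At height 0 only the sides
  -- belong to the boundary, and there α and β agree.
  obtain ⟨a, ha, ha1, ha2⟩ := exists_glue (f := fun z : ℝ × (Fin n → ℝ) => α z.2)
    (g := fun z => β z.2) (s := sphere 0 1 ∩ {z | z.1 ≤ 0}) (t := sphere 0 1 ∩ {z | 0 ≤ z.1})
    (isClosed_sphere.inter (isClosed_le (by fun_prop) (by fun_prop)))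
    (isClosed_sphere.inter (isClosed_le (by fun_prop) (by fun_prop)))
    (hα.comp (by fun_prop) fun z hz => (mem_prism_ball.1 (sphere_subset_closedBall hz.1)).2)
    (hβ.comp (by fun_prop) fun z hz => (mem_prism_ball.1 (sphere_subset_closedBall hz.1)).2)
    (by
      rintro ⟨s, x⟩ ⟨⟨h1, h2⟩, ⟨-, h3⟩⟩
      have hs : s = 0 := le_antisymm h2 h3
      obtain ⟨-, h4⟩ := mem_prism_sphere.1 h1
      simp only [hs] at h4
      norm_num at h4
      exact hαβ (by simpa using h4))
  have hun : (sphere (0 : ℝ × (Fin n → ℝ)) 1 ∩ {z | z.1 ≤ 0}) ∪ (sphere 0 1 ∩ {z | 0 ≤ z.1}) =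
      sphere 0 1 := by
    rw [← inter_union_distrib_left, inter_eq_left]
    intro z _
    exact le_total z.1 0
  rw [hun] at ha
  have hα' : ∀ x ∈ closedBall (0 : Fin n → ℝ) 1, a (-1, x) = α x := fun x hx =>
    ha1 (x := (-1, x)) ⟨(bottom_mem hx).1, by simp⟩
  have hβ' : ∀ x ∈ closedBall (0 : Fin n → ℝ) 1, a (1, x) = β x := fun x hx =>
    ha2 (x := (1, x)) ⟨lid_mem hx, by simp⟩
  have hS' : ∀ x ∈ sphere (0 : Fin n → ℝ) 1, ∀ s ∈ Icc (-1 : ℝ) 1, a (s, x) = α x := by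
    intro x hx s hs
    have h1 := (openBox_of_sphere hx hs).1
    rcases le_total s 0 with h | h
    · exact ha1 (x := (s, x)) ⟨h1, h⟩
    · rw [ha2 (x := (s, x)) ⟨h1, h⟩, hαβ hx]
  -- The lift over the prism is already the desired homotopy, after the height is rescaled from [-1,
  -- 1] to [0, 1]; the homotopy in the target is discarded.
  obtain ⟨a', -, ha', haa, -, -, -, -, -⟩ := ((h (n + 1)).congr (prismIsometry n).symm) a
    (fun z => K (z.2, (z.1 + 1) / 2)) ha (hK.comp (by fun_prop) (by
      rintro ⟨s, x⟩ hz
      obtain ⟨h1, h2⟩ := mem_prism_ball.1 hz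
      simp only [mem_Icc] at h1
      exact ⟨h2, by simp only [mem_Icc]; constructor <;> linarith⟩)) (mapsTo_univ _ _) (by
      rintro ⟨s, x⟩ hz
      obtain ⟨h1, h2⟩ := mem_prism_sphere.1 hz
      obtain ⟨h3, h4⟩ := mem_prism_ball.1 h1
      simp only [Function.comp] at h2 h3 h4 ⊢
      rcases h2 with rfl | rfl | h2
      · rw [hβ' x h4]
        norm_num
        exact (hK1 x h4).symm
      · rw [hα' x h4]
        norm_num
        exact (hK0 x h4).symm
      · have hx : x ∈ sphere (0 : Fin n → ℝ) 1 := by simpa using h2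
        rw [hS' x hx s h3]
        exact (hKS x hx _ ⟨by linarith [h3.1], by linarith [h3.2]⟩).symm)
  refine ⟨fun z => a' (2 * z.2 - 1, z.1), ha'.comp (by fun_prop) ?_, ?_, ?_, ?_⟩
  · rintro ⟨x, t⟩ ⟨hx, ht⟩
    simp only [mem_Icc] at ht
    exact mem_prism_ball.2 ⟨by simp only [mem_Icc]; constructor <;> linarith, hx⟩
  · intro x hx
    simp only [mul_zero, zero_sub]
    rw [haa (bottom_mem hx).1, hα' x hx]
  · intro x hx
    have : (2 : ℝ) * 1 - 1 = 1 := by norm_num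
    simp only [this]
    rw [haa (lid_mem hx), hβ' x hx]
  · intro x hx t ht
    simp only [mem_Icc] at ht
    have hs : 2 * t - 1 ∈ Icc (-1 : ℝ) 1 := by constructor <;> linarith
    simp only
    rw [haa (openBox_of_sphere hx hs).1, hS' x hx _ hs]

/-- Surjectivity on each π_n is a lifting problem for the n-ball, injectivity one for the (n +
1)-ball. Lifting data are total functions into X, so the lifting property is vacuous for empty X;
hence the separate condition `hne`. -/
theorem LiftsOver.isWeakEquivalence {f : C(X, Y)} (h : LiftsOver f univ)
    (hne : Nonempty Y → Nonempty X) : WeakEquiv.IsWeakEquivalence f := by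
  refine ⟨⟨?_, ?_⟩, fun n x => ⟨?_, ?_⟩⟩
  · intro x x' hxx
    obtain ⟨x, rfl⟩ := ZerothHomotopy.mk_surjective x
    obtain ⟨x', rfl⟩ := ZerothHomotopy.mk_surjective x'
    obtain ⟨γ⟩ : Joined (f x) (f x') := Quotient.exact (s := pathSetoid Y) hxx
    obtain ⟨G, hG, hG0, hG1, -⟩ := h.exists_homotopy (n := 0) (α := fun _ => x) (β := fun _ => x')
      continuousOn_const continuousOn_const
      (fun z hz => absurd hz (notMem_sphere_fin_zero z)) (K := fun z => γ.extend z.2)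
      (γ.continuous_extend.comp continuous_snd).continuousOn (by simp) (by simp)
      (fun z hz => absurd hz (notMem_sphere_fin_zero z))
    have := joined_of_homotopy hG (z := 0) (by simp)
    rw [hG0 0 (by simp), hG1 0 (by simp)] at this
    exact Quotient.sound (s := pathSetoid X) this
  · intro y
    obtain ⟨y, rfl⟩ := ZerothHomotopy.mk_surjective y
    obtain ⟨x₀⟩ := hne ⟨y⟩
    obtain ⟨a, H, -, -, hH, -, h0, h1, -⟩ := h 0 (fun _ => x₀) (fun _ => y) continuousOn_const
      continuousOn_const (mapsTo_univ _ _)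
      (fun z hz => absurd hz (notMem_sphere_fin_zero z))
    have := joined_of_homotopy hH (z := 0) (by simp)
    rw [h0 0 (by simp), h1 0 (by simp)] at this
    exact ⟨ZerothHomotopy.mk (a 0), Quotient.sound (s := pathSetoid Y) this⟩
  · intro A B hAB
    obtain ⟨A, rfl⟩ := Quotient.exists_rep A
    obtain ⟨B, rfl⟩ := Quotient.exists_rep B
    have hAB' : GenLoop.Homotopic (WeakEquiv.genLoopMap f (n + 1) x A)
        (WeakEquiv.genLoopMap f (n + 1) x B) :=
      Quotient.exact (s := GenLoop.Homotopic.setoid (Fin (n + 1)) (f x)) hAB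
    obtain ⟨K, hK, hK0, hK1, hKS⟩ := exists_homotopy_of_homotopic hAB'
    have hcA : Continuous fun z => A (toCube z) := A.1.continuous.comp continuous_toCube
    have hcB : Continuous fun z => B (toCube z) := B.1.continuous.comp continuous_toCube
    have hAS : ∀ z ∈ sphere (0 : Fin (n + 1) → ℝ) 1, A (toCube z) = x :=
      fun z hz => A.2 _ (toCube_boundary hz)
    have hBS : ∀ z ∈ sphere (0 : Fin (n + 1) → ℝ) 1, B (toCube z) = x :=
      fun z hz => B.2 _ (toCube_boundary hz)
    obtain ⟨G, hG, hG0, hG1, hGS⟩ := h.exists_homotopy hcA.continuousOn hcB.continuousOn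
      (fun z hz => by rw [hAS z hz, hBS z hz]) hK.continuousOn (fun z _ => hK0 z)
      (fun z _ => hK1 z) (fun z hz t _ => by rw [hKS z hz t, hAS z hz])
    refine Quotient.sound (s := GenLoop.Homotopic.setoid (Fin (n + 1)) x)
      (homotopic_of_homotopy G hG (fun y => ?_) (fun y => ?_) fun z hz t ht => ?_)
    · rw [hG0 _ (fromCube_mem y), toCube_fromCube]
    · rw [hG1 _ (fromCube_mem y), toCube_fromCube]
    · rw [hGS z hz t ht, hAS z hz]
  · intro B
    obtain ⟨B, rfl⟩ := Quotient.exists_rep B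
    have hBS : ∀ z ∈ sphere (0 : Fin (n + 1) → ℝ) 1, B (toCube z) = f x :=
      fun z hz => B.2 _ (toCube_boundary hz)
    obtain ⟨a, H, ha, haa, hH, -, h0, h1, hS⟩ := h (n + 1) (fun _ => x) (fun z => B (toCube z))
      continuousOn_const (B.1.continuous.comp continuous_toCube).continuousOn (mapsTo_univ _ _)
      (fun z hz => (hBS z hz).symm)
    refine ⟨Quotient.mk _ (toGenLoop a x ha haa),
      Quotient.sound (s := GenLoop.Homotopic.setoid (Fin (n + 1)) (f x))
        (homotopic_of_homotopy H hH (fun y => ?_) (fun y => ?_) fun z hz t ht => ?_)⟩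
    · exact h0 _ (fromCube_mem y)
    · simp only [h1 _ (fromCube_mem y), toCube_fromCube]
    · simp only [hS z hz t ht, hBS z hz]

end Backward

/-! ### Interior and radial push of a simplex -/

section Simplex

variable {n : ℕ}

/-- The standard topological simplex. -/
abbrev TopSimplex (n : ℕ) : Type := stdSimplex ℝ (Fin (n + 1))

/-- The smallest barycentric coordinate of a point of a simplex. -/
def minCoord (t : TopSimplex n) : ℝ := Finset.univ.inf' Finset.univ_nonempty fun i => t i

theorem continuous_coord (i : Fin (n + 1)) : Continuous fun t : TopSimplex n => t i :=
  (continuous_apply i).comp continuous_subtype_val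

theorem continuous_minCoord : Continuous (minCoord (n := n)) :=
  Continuous.finset_inf'_apply _ fun i _ => continuous_coord i

theorem minCoord_le (t : TopSimplex n) (i : Fin (n + 1)) : minCoord t ≤ t i :=
  Finset.inf'_le _ (Finset.mem_univ i)

theorem exists_eq_minCoord (t : TopSimplex n) : ∃ i, t i = minCoord t := by
  obtain ⟨i, -, hi⟩ := Finset.exists_mem_eq_inf' Finset.univ_nonempty fun i => t i
  exact ⟨i, hi.symm⟩

theorem minCoord_nonneg (t : TopSimplex n) : 0 ≤ minCoord t := by
  obtain ⟨i, hi⟩ := exists_eq_minCoord t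
  rw [← hi]
  exact stdSimplex.zero_le t i

/-- The interior of the standard simplex. -/
def IsInterior (t : TopSimplex n) : Prop := 0 < minCoord t

theorem isInterior_iff {t : TopSimplex n} : IsInterior t ↔ ∀ i, 0 < t i := by
  constructor
  · exact fun h i => lt_of_lt_of_le h (minCoord_le t i)
  · intro h
    obtain ⟨i, hi⟩ := exists_eq_minCoord t
    rw [IsInterior, ← hi]
    exact h i

theorem isOpen_isInterior : IsOpen ({t | IsInterior t} : Set (TopSimplex n)) :=
  isOpen_lt continuous_const continuous_minCoord

theorem minCoord_of_not_isInterior {t : TopSimplex n} (h : ¬ IsInterior t) : minCoord t = 0 :=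
  le_antisymm (not_lt.1 h) (minCoord_nonneg t)

theorem card_mul_minCoord_le (t : TopSimplex n) : (n + 1) * minCoord t ≤ 1 := by
  have h := Finset.sum_le_sum fun i (_ : i ∈ Finset.univ) => minCoord_le t i
  rw [stdSimplex.sum_eq_one] at h
  simpa using h

/-- The barycenter of the standard simplex. -/
def center (n : ℕ) : TopSimplex n :=
  ⟨fun _ => 1 / (n + 1), fun _ => by positivity, by
    simp only [Finset.sum_const, Finset.card_univ, Fintype.card_fin, nsmul_eq_mul]
    push_cast
    field_simp⟩

theorem eq_center_iff {t : TopSimplex n} : t = center n ↔ (n + 1) * minCoord t = 1 := by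
  constructor
  · rintro rfl
    obtain ⟨i, hi⟩ := exists_eq_minCoord (center n)
    rw [← hi]
    change ((n : ℝ) + 1) * (1 / (n + 1)) = 1
    field_simp
  · intro h
    have hm : minCoord t = 1 / (n + 1) := by
      rw [eq_div_iff (by positivity)]
      linarith
    have hsum : ∑ i, (t i - 1 / ((n : ℝ) + 1)) = 0 := by
      rw [Finset.sum_sub_distrib, stdSimplex.sum_eq_one]
      simp only [Finset.sum_const, Finset.card_univ, Fintype.card_fin, nsmul_eq_mul]
      push_cast
      field_simp
      ring
    have h0 := (Finset.sum_eq_zero_iff_of_nonneg fun i _ => by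
      rw [sub_nonneg, ← hm]; exact minCoord_le t i).1 hsum
    ext i
    exact sub_eq_zero.1 (h0 i (Finset.mem_univ i))

theorem isInterior_center : IsInterior (center n) := by
  rw [isInterior_iff]
  intro i
  change (0 : ℝ) < 1 / (n + 1)
  positivity

/-- The coordinates of the radial push of a point away from the barycenter. -/
def pushCoord (z : TopSimplex n × ℝ) (i : Fin (n + 1)) : ℝ :=
  -- Radial projection from the barycenter subtracts the smallest coordinate from all coordinates
  -- and rescales to total 1; the push is the straight-line homotopy to it. The denominator vanishes
  -- only at the barycenter.
  (1 - z.2) * z.1 i + z.2 * ((z.1 i - minCoord z.1) / (1 - (n + 1) * minCoord z.1))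

theorem card_mul_minCoord_lt {t : TopSimplex n} (h : t ≠ center n) : (n + 1) * minCoord t < 1 :=
  lt_of_le_of_ne (card_mul_minCoord_le t) fun h' => h (eq_center_iff.2 h')

theorem pushCoord_mem {t : TopSimplex n} (h : t ≠ center n) {s : ℝ} (hs : s ∈ Icc (0 : ℝ) 1) :
    pushCoord (t, s) ∈ stdSimplex ℝ (Fin (n + 1)) := by
  have h' := card_mul_minCoord_lt h
  have hpos : 0 < 1 - (n + 1) * minCoord t := by linarith
  refine ⟨fun i => add_nonneg (mul_nonneg (by linarith [hs.2]) (stdSimplex.zero_le t i))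
    (mul_nonneg hs.1 (div_nonneg (by linarith [minCoord_le t i]) hpos.le)), ?_⟩
  simp only [pushCoord]
  rw [Finset.sum_add_distrib, ← Finset.mul_sum, ← Finset.mul_sum, ← Finset.sum_div,
    Finset.sum_sub_distrib, stdSimplex.sum_eq_one]
  simp only [Finset.sum_const, Finset.card_univ, Fintype.card_fin, nsmul_eq_mul]
  push_cast
  rw [div_self hpos.ne']
  ring

open Classical in
/-- The radial push of a point of a simplex from the barycenter towards the boundary. -/
def pushSimplex (z : TopSimplex n × ℝ) : TopSimplex n :=
  if h : pushCoord z ∈ stdSimplex ℝ (Fin (n + 1)) then ⟨pushCoord z, h⟩ else z.1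

theorem pushSimplex_apply {t : TopSimplex n} (h : t ≠ center n) {s : ℝ}
    (hs : s ∈ Icc (0 : ℝ) 1) (i : Fin (n + 1)) : pushSimplex (t, s) i = pushCoord (t, s) i := by
  simp only [pushSimplex, pushCoord_mem h hs, dite_true]
  rfl

theorem continuousOn_pushSimplex :
    ContinuousOn (pushSimplex (n := n)) ({t | t ≠ center n} ×ˢ Icc 0 1) := by
  rw [IsInducing.subtypeVal.continuousOn_iff]
  refine continuousOn_pi.2 fun i => ?_
  have hi : Continuous fun z : TopSimplex n × ℝ => z.1 i := (continuous_coord i).comp continuous_fst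
  have hm' : Continuous fun z : TopSimplex n × ℝ => minCoord z.1 := continuous_minCoord.comp continuous_fst
  have : ContinuousOn (fun z : TopSimplex n × ℝ => pushCoord z i)
      ({t | t ≠ center n} ×ˢ Icc 0 1) := by
    unfold pushCoord
    refine ContinuousOn.add (Continuous.continuousOn (by fun_prop)) (ContinuousOn.mul
      (by fun_prop)
      (ContinuousOn.div (Continuous.continuousOn (by fun_prop)) (Continuous.continuousOn (by fun_prop)) ?_))
    rintro ⟨t, s⟩ ⟨ht, -⟩
    have := card_mul_minCoord_lt ht
    simp only
    linarith
  exact this.congr fun z hz => pushSimplex_apply hz.1 hz.2 i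

theorem pushSimplex_zero {t : TopSimplex n} (h : t ≠ center n) : pushSimplex (t, 0) = t := by
  ext i
  rw [pushSimplex_apply h (by simp)]
  simp [pushCoord]

theorem pushSimplex_of_not_isInterior {t : TopSimplex n} (h : ¬ IsInterior t) {s : ℝ}
    (hs : s ∈ Icc (0 : ℝ) 1) : pushSimplex (t, s) = t := by
  have hc : t ≠ center n := by
    rintro rfl
    exact h isInterior_center
  ext i
  rw [pushSimplex_apply hc hs]
  simp only [pushCoord, minCoord_of_not_isInterior h]
  ring

theorem minCoord_pushSimplex {t : TopSimplex n} (h : t ≠ center n) {s : ℝ}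
    (hs : s ∈ Icc (0 : ℝ) 1) : minCoord (pushSimplex (t, s)) ≤ (1 - s) * minCoord t := by
  obtain ⟨i, hi⟩ := exists_eq_minCoord t
  refine (minCoord_le _ i).trans ?_
  rw [pushSimplex_apply h hs]
  simp only [pushCoord, hi]
  simp

theorem pushSimplex_ne_center {t : TopSimplex n} (h : t ≠ center n) {s : ℝ}
    (hs : s ∈ Icc (0 : ℝ) 1) : pushSimplex (t, s) ≠ center n := by
  intro hc
  have h1 := eq_center_iff.1 hc
  have h2 := minCoord_pushSimplex h hs
  have h3 := card_mul_minCoord_lt h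
  have h4 := minCoord_nonneg t
  have h5 : (0 : ℝ) ≤ n := Nat.cast_nonneg n
  have h6 : (1 - s) * minCoord t ≤ minCoord t := by nlinarith [hs.1]
  nlinarith

theorem not_isInterior_pushSimplex {t : TopSimplex n} (h : t ≠ center n) :
    ¬ IsInterior (pushSimplex (t, 1)) := by
  have := minCoord_pushSimplex h (s := 1) (by simp)
  rw [sub_self, zero_mul] at this
  exact not_lt.2 this

end Simplex

/-! ### Spaces filtered by cells N × Δⁿ -/

/-- A space built by successively attaching products of spaces with simplices along the product
with the boundary of the simplex. -/
structure CellStructure (R : Type u) [TopologicalSpace R] where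
  /-- The spaces of cells. -/
  N : ℕ → TopCat.{u}
  /-- The characteristic maps of the cells. -/
  q : ∀ n, N n × TopSimplex n → R
  continuous_q : ∀ n, Continuous (q n)
  /-- The dimension of the open cell that contains a point. -/
  dim : R → ℕ
  exists_rep : ∀ z, ∃ y : N (dim z) × TopSimplex (dim z), IsInterior y.2 ∧ q (dim z) y = z
  dim_q : ∀ n (y : N n × TopSimplex n), IsInterior y.2 → dim (q n y) = n
  dim_q_lt : ∀ n (y : N n × TopSimplex n), ¬ IsInterior y.2 → dim (q n y) < n
  q_inj : ∀ n (y y' : N n × TopSimplex n), IsInterior y.2 → IsInterior y'.2 → q n y = q n y' →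
    y = y'
  isClosed_of_preimage : ∀ K : Set R, (∀ n, IsClosed (q n ⁻¹' K)) → IsClosed K
  -- Attaching maps are not part of the data. This condition is what replaces their continuity:
  -- closedness in lower cells is inherited by the boundary of an n-cell.
  isClosed_boundary : ∀ n (K : Set R), (∀ m < n, IsClosed (q m ⁻¹' K)) →
    IsClosed (q n ⁻¹' K ∩ {y | ¬ IsInterior y.2})

namespace CellStructure

variable {R : Type u} [TopologicalSpace R] (C : CellStructure R)

theorem dim_q_le (n : ℕ) (y : C.N n × TopSimplex n) : C.dim (C.q n y) ≤ n := by
  by_cases h : IsInterior y.2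
  · exact (C.dim_q n y h).le
  · exact (C.dim_q_lt n y h).le

/-- In a cell of dimension at least k the set K meets only the boundary, where closedness follows by
induction from the lower cells. -/
theorem isClosed_of_dim_lt {k : ℕ} {K : Set R} (hK : ∀ z ∈ K, C.dim z < k)
    (h : ∀ n < k, IsClosed (C.q n ⁻¹' K)) : IsClosed K := by
  refine C.isClosed_of_preimage K fun n => ?_
  induction n using Nat.strong_induction_on with
  | _ n ih =>
  by_cases hn : n < k
  · exact h n hn
  · have : C.q n ⁻¹' K = C.q n ⁻¹' K ∩ {y | ¬ IsInterior y.2} := by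
      refine (inter_eq_left.2 fun y hy => ?_).symm
      intro hy'
      have := hK _ hy
      rw [C.dim_q n y hy'] at this
      exact hn this
    rw [this]
    exact C.isClosed_boundary n K ih

theorem isClosed_dim_lt (k : ℕ) : IsClosed {z | C.dim z < k} := by
  refine C.isClosed_of_dim_lt (k := k) (fun z hz => hz) fun n hn => ?_
  have : C.q n ⁻¹' {z | C.dim z < k} = univ :=
    eq_univ_of_forall fun y => lt_of_le_of_lt (C.dim_q_le n y) hn
  rw [this]
  exact isClosed_univ

/-- The points with fixed barycentric coordinates. -/
def slice {k : ℕ} (t : TopSimplex k) : Set R := range fun x : C.N k => C.q k (x, t)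

theorem q_mem_slice_iff {k : ℕ} {t : TopSimplex k} (ht : IsInterior t) (y : C.N k × TopSimplex k) :
    C.q k y ∈ C.slice t ↔ y.2 = t := by
  constructor
  · rintro ⟨x, hx⟩
    have hx' : C.q k (x, t) = C.q k y := hx
    have hy : IsInterior y.2 := by
      by_contra hy
      have := C.dim_q_lt k y hy
      rw [← hx', C.dim_q k _ ht] at this
      exact lt_irrefl _ this
    rw [← C.q_inj k _ _ ht hy hx']
  · rintro rfl
    exact ⟨y.1, rfl⟩

theorem dim_of_mem_slice {k : ℕ} {t : TopSimplex k} (ht : IsInterior t) {z : R}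
    (hz : z ∈ C.slice t) : C.dim z = k := by
  obtain ⟨x, rfl⟩ := hz
  exact C.dim_q k _ ht

theorem isClosed_slice {k : ℕ} {t : TopSimplex k} (ht : IsInterior t) : IsClosed (C.slice t) := by
  refine C.isClosed_of_dim_lt (k := k + 1)
    (fun z hz => by rw [C.dim_of_mem_slice ht hz]; exact Nat.lt_succ_self k) fun n hn => ?_
  rcases Nat.lt_succ_iff_lt_or_eq.1 hn with hn | rfl
  · have : C.q n ⁻¹' C.slice t = ∅ := by
      refine eq_empty_of_forall_notMem fun y hy => ?_
      have h1 := C.dim_q_le n y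
      rw [C.dim_of_mem_slice ht hy] at h1
      omega
    rw [this]
    exact isClosed_empty
  · have : C.q n ⁻¹' C.slice t = {y | y.2 = t} := by
      ext y
      exact C.q_mem_slice_iff ht y
    rw [this]
    exact isClosed_eq continuous_snd continuous_const

/-- The usual argument with an infinite discrete set fails because points need not be closed, so
each chosen point is replaced by the slice through it. Each S i is closed, since only finitely many
slices meet the cells of a given dimension. Their complements form a directed cover, yet none
contains K. -/
theorem exists_dim_lt_of_isCompact {K : Set R} (hK : IsCompact K) : ∃ k, ∀ z ∈ K, C.dim z < k := by
  by_contra hcon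
  push Not at hcon
  choose y hy hqy using C.exists_rep
  choose z hzK hz using hcon
  set S : ℕ → Set R := fun i => ⋃ j ∈ {j | i ≤ C.dim (z j)}, C.slice (y (z j)).2 with hS
  have mem_slice : ∀ w, w ∈ C.slice (y w).2 := fun w => ⟨(y w).1, hqy w⟩
  have hSc : ∀ i, IsClosed (S i) := by
    intro i
    refine C.isClosed_of_preimage _ fun n => ?_
    have : C.q n ⁻¹' S i = ⋃ j ∈ {j | i ≤ C.dim (z j) ∧ j ≤ n}, C.q n ⁻¹' C.slice (y (z j)).2 := by
      ext w
      simp only [hS, mem_preimage, mem_iUnion, exists_prop, mem_ofPred_eq]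
      constructor
      · rintro ⟨j, hj, hw⟩
        refine ⟨j, ⟨hj, ?_⟩, hw⟩
        have h1 := C.dim_of_mem_slice (hy (z j)) hw
        have h2 := C.dim_q_le n w
        have h3 := hz j
        omega
      · rintro ⟨j, ⟨hj, -⟩, hw⟩
        exact ⟨j, hj, hw⟩
    rw [this]
    refine Finite.isClosed_biUnion ((finite_Iic n).subset fun j hj => hj.2) fun j _ => ?_
    exact (C.isClosed_slice (hy (z j))).preimage (C.continuous_q n)
  obtain ⟨i, hi⟩ := hK.elim_directed_cover (fun i => (S i)ᶜ) (fun i => (hSc i).isOpen_compl) (by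
      intro w _
      refine mem_iUnion.2 ⟨C.dim w + 1, fun hw => ?_⟩
      simp only [hS, mem_iUnion, exists_prop, mem_ofPred_eq] at hw
      obtain ⟨j, hj, hw⟩ := hw
      have h1 := C.dim_of_mem_slice (hy (z j)) hw
      omega) (by
      refine directed_of_isDirected_le fun i j hij => ?_
      refine compl_subset_compl.2 (biUnion_subset_biUnion_left fun l hl => ?_)
      exact le_trans hij hl)
  refine hi (hzK i) ?_
  simp only [hS, mem_iUnion, exists_prop, mem_ofPred_eq]
  exact ⟨i, hz i, mem_slice (z i)⟩

/-- An open cell family is embedded. -/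
theorem isInducing_q (k : ℕ) :
    IsInducing fun y : {y : C.N k × TopSimplex k // IsInterior y.2} => C.q k y := by
  refine ⟨le_antisymm ((C.continuous_q k).comp continuous_subtype_val).le_induced fun O hO => ?_⟩
  obtain ⟨O', hO', rfl⟩ := hO
  -- K is the complement, inside the k-skeleton only, of the part of the open cells given by O'.
  -- Higher cells then need no inspection, and the complement of K traces O' on the open cells.
  set K : Set R := {z | C.dim z < k + 1 ∧ ¬ ∃ y : C.N k × TopSimplex k, IsInterior y.2 ∧ y ∈ O' ∧
    C.q k y = z} with hK
  have hKc : IsClosed K := by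
    refine C.isClosed_of_dim_lt (k := k + 1) (fun z hz => hz.1) fun n hn => ?_
    rcases Nat.lt_succ_iff_lt_or_eq.1 hn with hn | rfl
    · have : C.q n ⁻¹' K = univ := by
        refine eq_univ_of_forall fun y => ⟨lt_of_le_of_lt (C.dim_q_le n y) (by omega), ?_⟩
        rintro ⟨y', hy', -, h⟩
        have h1 := C.dim_q_le n y
        rw [← h, C.dim_q k y' hy'] at h1
        omega
      rw [this]
      exact isClosed_univ
    · have : C.q n ⁻¹' K = (O' ∩ Prod.snd ⁻¹' {t | IsInterior t})ᶜ := by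
        ext y
        constructor
        · rintro ⟨-, h⟩ ⟨h1, h2⟩
          exact h ⟨y, h2, h1, rfl⟩
        · intro h
          refine ⟨Nat.lt_succ_of_le (C.dim_q_le n y), ?_⟩
          rintro ⟨y', h1, h2, h3⟩
          have hy : IsInterior y.2 := by
            by_contra hy
            have := C.dim_q_lt n y hy
            rw [← h3, C.dim_q n _ h1] at this
            exact lt_irrefl _ this
          have := C.q_inj n _ _ h1 hy h3
          subst this
          exact h ⟨h2, h1⟩
      rw [this]
      exact (hO'.inter (isOpen_isInterior.preimage continuous_snd)).isClosed_compl
  refine ⟨Kᶜ, hKc.isOpen_compl, ?_⟩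
  ext ⟨y, hy⟩
  constructor
  · intro h
    by_contra h'
    refine h ⟨Nat.lt_succ_of_le (C.dim_q_le k y), ?_⟩
    rintro ⟨y', h1, h2, h3⟩
    exact h' (C.q_inj k _ _ h1 hy h3 ▸ h2)
  · rintro h ⟨-, h'⟩
    exact h' ⟨y, hy, h, rfl⟩

/-- Over an open cell family a continuous map has continuous coordinates in N_k and in the simplex.
-/
theorem continuousOn_of_continuousOn_q {E : Type*} [TopologicalSpace E] {D : Set E} {k : ℕ}
    {y : E → C.N k × TopSimplex k} (hy : ∀ x ∈ D, IsInterior (y x).2)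
    (h : ContinuousOn (fun x => C.q k (y x)) D) : ContinuousOn y D := by
  rw [continuousOn_iff_continuous_domRestrict] at h ⊢
  have : Continuous fun x : D => (⟨y x, hy x x.2⟩ : {y : C.N k × TopSimplex k // IsInterior y.2}) :=
    (C.isInducing_q k).continuous_iff.2 h
  exact continuous_subtype_val.comp this

/-- The complement of the barycenters of the `k`-cells in the `k`-skeleton. -/
def collar (k : ℕ) : Set R := {z | C.dim z < k + 1 ∧ z ∉ C.slice (center k)}

theorem q_mem_collar {k : ℕ} {y : C.N k × TopSimplex k} (hy : y.2 ≠ center k) :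
    C.q k y ∈ C.collar k :=
  ⟨Nat.lt_succ_of_le (C.dim_q_le k y), fun h => hy ((C.q_mem_slice_iff isInterior_center y).1 h)⟩

theorem mem_collar_of_dim_lt {k : ℕ} {z : R} (hz : C.dim z < k) : z ∈ C.collar k :=
  ⟨Nat.lt_succ_of_lt hz, fun h => hz.ne (C.dim_of_mem_slice isInterior_center h)⟩

theorem exists_rep_of_mem_collar {k : ℕ} {z : R} (hz : z ∈ C.collar k) (hk : ¬ C.dim z < k) :
    ∃ y : C.N k × TopSimplex k, IsInterior y.2 ∧ y.2 ≠ center k ∧ C.q k y = z := by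
  have hd : C.dim z = k := by have := hz.1; omega
  obtain ⟨y, hy, hyz⟩ : ∃ y : C.N k × TopSimplex k, IsInterior y.2 ∧ C.q k y = z :=
    hd ▸ C.exists_rep z
  exact ⟨y, hy, fun h => hz.2 (hyz ▸ (C.q_mem_slice_iff isInterior_center y).2 h), hyz⟩

open Classical in
/-- The radial push of the collar onto the lower skeleton. -/
def push (k : ℕ) (z : R × ℝ) : R :=
  if h : z.1 ∈ C.collar k ∧ ¬ C.dim z.1 < k then
    C.q k ((C.exists_rep_of_mem_collar h.1 h.2).choose.1,
      pushSimplex ((C.exists_rep_of_mem_collar h.1 h.2).choose.2, z.2))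
  else z.1

theorem push_of_dim_lt {k : ℕ} {z : R} (hz : C.dim z < k) (s : ℝ) : C.push k (z, s) = z := by
  rw [push, dif_neg]
  exact fun h => h.2 hz

theorem push_q {k : ℕ} {y : C.N k × TopSimplex k} (hy : y.2 ≠ center k) {s : ℝ}
    (hs : s ∈ Icc (0 : ℝ) 1) : C.push k (C.q k y, s) = C.q k (y.1, pushSimplex (y.2, s)) := by
  by_cases hi : IsInterior y.2
  · have h : C.q k y ∈ C.collar k ∧ ¬ C.dim (C.q k y) < k :=
      ⟨C.q_mem_collar hy, by rw [C.dim_q k y hi]; exact lt_irrefl k⟩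
    obtain ⟨h1, -, h2⟩ := (C.exists_rep_of_mem_collar h.1 h.2).choose_spec
    have e := C.q_inj k _ _ h1 hi h2
    rw [push, dif_pos h, e]
  · rw [C.push_of_dim_lt (C.dim_q_lt k y hi), pushSimplex_of_not_isInterior hi hs]

theorem mem_collar_cases {k : ℕ} {z : R} (hz : z ∈ C.collar k) :
    C.dim z < k ∨ ∃ y : C.N k × TopSimplex k, y.2 ≠ center k ∧ C.q k y = z := by
  by_cases hk : C.dim z < k
  · exact Or.inl hk
  · obtain ⟨y, -, h1, h2⟩ := C.exists_rep_of_mem_collar hz hk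
    exact Or.inr ⟨y, h1, h2⟩

theorem push_zero {k : ℕ} {z : R} (hz : z ∈ C.collar k) : C.push k (z, 0) = z := by
  rcases C.mem_collar_cases hz with h | ⟨y, hy, rfl⟩
  · exact C.push_of_dim_lt h 0
  · rw [C.push_q hy (by simp), pushSimplex_zero hy]

theorem push_mem {k : ℕ} {z : R} (hz : z ∈ C.collar k) {s : ℝ} (hs : s ∈ Icc (0 : ℝ) 1) :
    C.push k (z, s) ∈ C.collar k := by
  rcases C.mem_collar_cases hz with h | ⟨y, hy, rfl⟩
  · rw [C.push_of_dim_lt h]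
    exact hz
  · rw [C.push_q hy hs]
    exact C.q_mem_collar (pushSimplex_ne_center hy hs)

theorem dim_push_one {k : ℕ} {z : R} (hz : z ∈ C.collar k) : C.dim (C.push k (z, 1)) < k := by
  rcases C.mem_collar_cases hz with h | ⟨y, hy, rfl⟩
  · rwa [C.push_of_dim_lt h]
  · rw [C.push_q hy (by simp)]
    exact C.dim_q_lt k _ (not_isInterior_pushSimplex hy)

/-- The presentation of the collar as a quotient. -/
def collarMap (k : ℕ) : (Σ n : Fin k, C.N n × TopSimplex n) ⊕
    {y : C.N k × TopSimplex k // y.2 ≠ center k} → C.collar k :=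
  Sum.elim (fun y => ⟨C.q y.1 y.2, C.mem_collar_of_dim_lt
    (lt_of_le_of_lt (C.dim_q_le _ _) y.1.2)⟩) fun y => ⟨C.q k y, C.q_mem_collar y.2⟩

/-- A subspace of a quotient need not carry the quotient topology. Here it does: the collar is open
in the closed k-skeleton, so a set with open preimages has a complement in the skeleton that can be
tested for closedness cell by cell. -/
theorem isQuotientMap_collarMap (k : ℕ) : IsQuotientMap (C.collarMap k) := by
  have hc : Continuous (C.collarMap k) := by
    refine continuous_sum_dom.2 ⟨?_, ?_⟩
    · exact Continuous.subtype_mk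
        (continuous_sigma (f := fun y : (Σ n : Fin k, C.N n × TopSimplex n) => C.q y.1 y.2)
          fun n => C.continuous_q n) _
    · exact Continuous.subtype_mk ((C.continuous_q k).comp continuous_subtype_val) _
  have hs : Function.Surjective (C.collarMap k) := by
    rintro ⟨z, hz⟩
    rcases C.mem_collar_cases hz with h | ⟨y, hy, rfl⟩
    · obtain ⟨y, -, hyz⟩ := C.exists_rep z
      exact ⟨Sum.inl ⟨⟨C.dim z, h⟩, y⟩, Subtype.ext hyz⟩
    · exact ⟨Sum.inr ⟨y, hy⟩, rfl⟩
  refine (isQuotientMap_iff _).2 ⟨isCoinducing_iff.2 fun O => ⟨fun h => ?_, fun h => h.preimage hc⟩,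
    hs⟩
  set K : Set R := {z | C.dim z < k + 1 ∧ ¬ ∃ h : z ∈ C.collar k, ⟨z, h⟩ ∈ O} with hK
  have hKc : IsClosed K := by
    refine C.isClosed_of_dim_lt (k := k + 1) (fun z hz => hz.1) fun n hn => ?_
    rcases Nat.lt_succ_iff_lt_or_eq.1 hn with hn | rfl
    · have : C.q n ⁻¹' K =
          ((fun y => Sum.inl ⟨⟨n, hn⟩, y⟩) ⁻¹' (C.collarMap k ⁻¹' O))ᶜ := by
        ext y
        constructor
        · rintro ⟨-, h1⟩ h2
          exact h1 ⟨_, h2⟩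
        · intro h1
          exact ⟨lt_of_le_of_lt (C.dim_q_le n y) (by omega), fun ⟨_, h2⟩ => h1 h2⟩
      rw [this]
      exact (h.preimage (continuous_inl.comp
        (continuous_sigmaMk (σ := fun n : Fin k => C.N n × TopSimplex n)))).isClosed_compl
    · have h' : IsOpen (Sum.inr ⁻¹' (C.collarMap n ⁻¹' O)) := h.preimage continuous_inr
      have ho : IsOpen ({y | y.2 ≠ center n} : Set (C.N n × TopSimplex n)) :=
        isOpen_ne_fun continuous_snd continuous_const
      have : C.q n ⁻¹' K = (Subtype.val '' (Sum.inr ⁻¹' (C.collarMap n ⁻¹' O)))ᶜ := by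
        ext y
        constructor
        · rintro ⟨-, h1⟩ ⟨⟨y', hy'⟩, h2, rfl⟩
          exact h1 ⟨_, h2⟩
        · intro h1
          refine ⟨Nat.lt_succ_of_le (C.dim_q_le n y), fun ⟨h2, h3⟩ => h1 ?_⟩
          exact ⟨⟨y, fun hy => h2.2 ((C.q_mem_slice_iff isInterior_center y).2 hy)⟩, h3, rfl⟩
      rw [this]
      exact (ho.isOpenMap_subtype_val _ h').isClosed_compl
  have : O = Subtype.val ⁻¹' Kᶜ := by
    ext ⟨z, hz⟩
    constructor
    · rintro h1 ⟨-, h2⟩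
      exact h2 ⟨hz, h1⟩
    · intro h1
      by_contra h2
      exact h1 ⟨hz.1, fun ⟨_, h3⟩ => h2 h3⟩
  rw [this]
  exact hKc.isOpen_compl.preimage continuous_subtype_val

/-- The push is continuous on the pieces presenting the collar: stationary on lower cells and
`pushSimplex` on the k-cells. It descends because the product of a quotient map with the locally
compact interval is again a quotient map. -/
theorem continuousOn_push (k : ℕ) : ContinuousOn (C.push k) (C.collar k ×ˢ Icc 0 1) := by
  have key : Continuous fun z : C.collar k × Icc (0 : ℝ) 1 => C.push k (z.1, z.2) := by
    refine (C.isQuotientMap_collarMap k).continuous_lift_prod_left ?_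
    rw [← (Homeomorph.sumProdDistrib (X := (Σ n : Fin k, C.N n × TopSimplex n))
      (Y := {y : C.N k × TopSimplex k // y.2 ≠ center k})
      (Z := Icc (0 : ℝ) 1)).symm.comp_continuous_iff']
    refine continuous_sum_dom.2 ⟨?_, ?_⟩
    · have : Continuous fun z : (Σ n : Fin k, C.N n × TopSimplex n) × Icc (0 : ℝ) 1 =>
          C.q z.1.1 z.1.2 :=
        (continuous_sigma (f := fun z : (Σ n : Fin k, C.N n × TopSimplex n) => C.q z.1 z.2)
          fun n => C.continuous_q n).comp continuous_fst
      refine this.congr fun z => ?_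
      exact (C.push_of_dim_lt (lt_of_le_of_lt (C.dim_q_le _ _) z.1.1.2) _).symm
    · have : Continuous fun z : {y : C.N k × TopSimplex k // y.2 ≠ center k} × Icc (0 : ℝ) 1 =>
          C.q k (z.1.1.1, pushSimplex (z.1.1.2, z.2)) := by
        refine (C.continuous_q k).comp (Continuous.prodMk (by fun_prop) ?_)
        exact continuousOn_pushSimplex.comp_continuous
          (f := fun z : {y : C.N k × TopSimplex k // y.2 ≠ center k} × Icc (0 : ℝ) 1 =>
            ((z.1.1.2, (z.2 : ℝ)) : TopSimplex k × ℝ)) (by fun_prop) fun z => ⟨z.1.2, z.2.2⟩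
      refine this.congr fun z => ?_
      exact (C.push_q z.1.2 z.2.2).symm
  rw [continuousOn_iff_continuous_domRestrict]
  exact key.comp (f := fun z : (C.collar k ×ˢ Icc (0 : ℝ) 1 : Set (R × ℝ)) =>
    ((⟨z.1.1, z.2.1⟩, ⟨z.1.2, z.2.2⟩) : C.collar k × Icc (0 : ℝ) 1))
    (Continuous.prodMk (Continuous.subtype_mk (by fun_prop) _)
      (Continuous.subtype_mk (by fun_prop) _))

end CellStructure

theorem Solvable.mono {E : Type*} [NormedAddCommGroup E] [NormedSpace ℝ E] {X : Type u}
    {Y : Type v} [TopologicalSpace X] [TopologicalSpace Y] {p : X → Y}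
    {V W : Set Y} {a : E → X} {b : E → Y} (h : Solvable p V a b) (hVW : V ⊆ W) :
    Solvable p W a b := by
  obtain ⟨a', H, h1, h2, h3, h4, h5⟩ := h
  exact ⟨a', H, h1, h2, h3, h4.mono_right hVW, h5⟩

/-! ### Lifting properties of cellular maps -/

namespace CellStructure

variable {R R' : Type u} [TopologicalSpace R] [TopologicalSpace R'] {C : CellStructure R}
  {C' : CellStructure R'} {F : R → R'} {g : ∀ n, C.N n → C'.N n}

theorem dim_map (hF : ∀ n x t, F (C.q n (x, t)) = C'.q n (g n x, t)) (z : R) :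
    C'.dim (F z) = C.dim z := by
  obtain ⟨⟨x, t⟩, ht, hz⟩ := C.exists_rep z
  have := C'.dim_q (C.dim z) (g _ x, t) ht
  rwa [← hF, hz] at this

/-- Lifting over a product of the space of `k`-cells with a set of interior points. -/
theorem liftsOver_cell (hF : ∀ n x t, F (C.q n (x, t)) = C'.q n (g n x, t)) {k : ℕ}
    (hg : LiftsOver (g k) univ) (hne : Nonempty (C'.N k) → Nonempty (C.N k))
    {W : Set (TopSimplex k)} (hW : ∀ t ∈ W, IsInterior t) :
    LiftsOver F (C'.q k '' (univ ×ˢ W)) := by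
  intro n a b ha hb hbV hab
  have h0 : (0 : Fin n → ℝ) ∈ closedBall (0 : Fin n → ℝ) 1 := by simp
  obtain ⟨y₀, -, -⟩ := hbV h0
  have hy : ∀ x, ∃ y : C'.N k × TopSimplex k,
      x ∈ closedBall (0 : Fin n → ℝ) 1 → y.2 ∈ W ∧ C'.q k y = b x := by
    intro x
    by_cases hx : x ∈ closedBall (0 : Fin n → ℝ) 1
    · obtain ⟨y, hy, hyb⟩ := hbV hx
      exact ⟨y, fun _ => ⟨hy.2, hyb⟩⟩
    · exact ⟨y₀, fun h => absurd h hx⟩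
  choose y hy using hy
  have hyc : ContinuousOn y (closedBall 0 1) := C'.continuousOn_of_continuousOn_q
    (fun x hx => hW _ (hy x hx).1) (hb.congr fun x hx => (hy x hx).2)
  obtain ⟨w₀⟩ := hne ⟨y₀.1⟩
  have hw : ∀ x, ∃ w : C.N k × TopSimplex k,
      x ∈ sphere (0 : Fin n → ℝ) 1 → IsInterior w.2 ∧ C.q k w = a x := by
    intro x
    by_cases hx : x ∈ sphere (0 : Fin n → ℝ) 1
    · have hxB := sphere_subset_closedBall hx
      have hd : C.dim (a x) = k := by
        rw [← dim_map hF, show F (a x) = b x from hab hx, ← (hy x hxB).2]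
        exact C'.dim_q k _ (hW _ (hy x hxB).1)
      obtain ⟨w, hw⟩ : ∃ w : C.N k × TopSimplex k, IsInterior w.2 ∧ C.q k w = a x :=
        hd ▸ C.exists_rep (a x)
      exact ⟨w, fun _ => hw⟩
    · exact ⟨(w₀, y₀.2), fun h => absurd h hx⟩
  choose w hw using hw
  have hwc : ContinuousOn w (sphere 0 1) := C.continuousOn_of_continuousOn_q
    (fun x hx => (hw x hx).1) (ha.congr fun x hx => (hw x hx).2)
  have hwy : ∀ x ∈ sphere (0 : Fin n → ℝ) 1, (g k (w x).1, (w x).2) = y x := by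
    intro x hx
    have hxB := sphere_subset_closedBall hx
    refine C'.q_inj k _ _ (hw x hx).1 (hW _ (hy x hxB).1) ?_
    rw [← hF, (hy x hxB).2, ← hab hx]
    exact congrArg F (hw x hx).2
  -- F is g k times the identity on open cells, so only the N-coordinate has to be lifted; the
  -- simplex coordinate of b is kept throughout, which also keeps the homotopy over W.
  obtain ⟨a', H, ha', haa, hH, -, hH0, hH1, hHS⟩ := hg n (fun x => (w x).1) (fun x => (y x).1)
    (continuous_fst.comp_continuousOn hwc) (continuous_fst.comp_continuousOn hyc)
    (mapsTo_univ _ _) (fun x hx => congrArg Prod.fst (hwy x hx))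
  refine ⟨fun x => C.q k (a' x, (y x).2), fun z => C'.q k (H z, (y z.1).2), ?_, ?_, ?_, ?_, ?_, ?_,
    ?_⟩
  · exact (C.continuous_q k).comp_continuousOn
      (ha'.prodMk (continuous_snd.comp_continuousOn hyc))
  · intro x hx
    have h1 : (w x).2 = (y x).2 := congrArg Prod.snd (hwy x hx)
    simp only [haa hx, ← h1]
    exact (hw x hx).2
  · exact (C'.continuous_q k).comp_continuousOn (hH.prodMk
      (continuous_snd.comp_continuousOn (hyc.comp continuousOn_fst fun z hz => hz.1)))
  · intro z hz
    exact ⟨(H z, (y z.1).2), ⟨mem_univ _, (hy z.1 hz.1).1⟩, rfl⟩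
  · intro x hx
    simp only [hH0 x hx, hF]
  · intro x hx
    simp only [hH1 x hx]
    exact (hy x hx).2
  · intro x hx t ht
    simp only [hHS x hx t ht]
    exact (hy x (sphere_subset_closedBall hx)).2

theorem mem_collar_of_map (hF : ∀ n x t, F (C.q n (x, t)) = C'.q n (g n x, t)) {k : ℕ} {z : R}
    (hz : F z ∈ C'.collar k) : z ∈ C.collar k := by
  refine ⟨by rw [← dim_map hF]; exact hz.1, ?_⟩
  rintro ⟨x, rfl⟩
  exact hz.2 ⟨g k x, (hF k x _).symm⟩

theorem map_push (hF : ∀ n x t, F (C.q n (x, t)) = C'.q n (g n x, t)) {k : ℕ} {z : R}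
    (hz : z ∈ C.collar k) {s : ℝ} (hs : s ∈ Icc (0 : ℝ) 1) :
    F (C.push k (z, s)) = C'.push k (F z, s) := by
  rcases C.mem_collar_cases hz with h | ⟨⟨x, t⟩, hy, rfl⟩
  · rw [C.push_of_dim_lt h, C'.push_of_dim_lt (by rwa [dim_map hF])]
  · rw [C.push_q hy hs, hF, hF, C'.push_q (y := (g k x, t)) hy hs]

/-- The radial pushes of source and target commute with F, so they deform the lifting problem into
one over the lower skeleton, and solvability is invariant under such deformations. -/
theorem liftsOver_collar (hF : ∀ n x t, F (C.q n (x, t)) = C'.q n (g n x, t)) {k : ℕ}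
    (h : LiftsOver F {z | C'.dim z < k}) : LiftsOver F (C'.collar k) := by
  intro n a b ha hb hbV hab
  have haV : MapsTo a (sphere 0 1) (C.collar k) := fun x hx => mem_collar_of_map hF (by
    rw [show F (a x) = b x from hab hx]
    exact hbV (sphere_subset_closedBall hx))
  have hA : ContinuousOn (fun z : (Fin n → ℝ) × ℝ => C.push k (a z.1, z.2))
      (sphere 0 1 ×ˢ Icc 0 1) :=
    (C.continuousOn_push k).comp ((ha.comp continuousOn_fst fun z hz => hz.1).prodMk
      continuousOn_snd) fun z hz => ⟨haV hz.1, hz.2⟩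
  have hB : ContinuousOn (fun z : (Fin n → ℝ) × ℝ => C'.push k (b z.1, z.2))
      (closedBall 0 1 ×ˢ Icc 0 1) :=
    (C'.continuousOn_push k).comp ((hb.comp continuousOn_fst fun z hz => hz.1).prodMk
      continuousOn_snd) fun z hz => ⟨hbV hz.1, hz.2⟩
  have hAB : ∀ x ∈ sphere (0 : Fin n → ℝ) 1, ∀ t ∈ Icc (0 : ℝ) 1,
      F (C.push k (a x, t)) = C'.push k (b x, t) := by
    intro x hx t ht
    rw [map_push hF (haV hx) ht, show F (a x) = b x from hab hx]
  have h1 : Solvable F (C'.collar k) (fun x => C.push k (a x, 1))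
      (fun x => C'.push k (b x, 1)) :=
    (h n _ _ (hA.comp (f := fun x => (x, (1 : ℝ))) (by fun_prop) fun x hx => ⟨hx, by simp⟩)
      (hB.comp (f := fun x => (x, (1 : ℝ))) (by fun_prop) fun x hx => ⟨hx, by simp⟩)
      (fun x hx => C'.dim_push_one (hbV hx)) fun x hx => hAB x hx 1 (by simp)).mono
      fun z hz => C'.mem_collar_of_dim_lt hz
  exact (Solvable.of_homotopy hA hB (fun z hz => C'.push_mem (hbV hz.1) hz.2) hAB h1).congr_right
    (fun x hx => C.push_zero (haV hx)) fun x hx => C'.push_zero (hbV hx)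

theorem dim_eq_iff {k : ℕ} {z : R} :
    C.dim z = k ↔ z ∈ C.q k '' (univ ×ˢ {t | IsInterior t}) := by
  constructor
  · intro hd
    obtain ⟨y, hy⟩ : ∃ y : C.N k × TopSimplex k, IsInterior y.2 ∧ C.q k y = z :=
      hd ▸ C.exists_rep z
    exact ⟨y, ⟨mem_univ _, hy.1⟩, hy.2⟩
  · rintro ⟨y, ⟨-, hy⟩, rfl⟩
    exact C.dim_q k y hy

/-- A map of cell structures that is a weak equivalence on spaces of cells has the lifting
property. -/
theorem liftsOver_univ (hF : ∀ n x t, F (C.q n (x, t)) = C'.q n (g n x, t))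
    (hg : ∀ n, LiftsOver (g n) univ) (hne : ∀ n, Nonempty (C'.N n) → Nonempty (C.N n)) :
    LiftsOver F univ := by
  have key : ∀ k, LiftsOver F {z | C'.dim z < k} := by
    intro k
    induction k with
    | zero =>
      intro n a b _ _ hbV _
      exact absurd (hbV (x := 0) (by simp)) (Nat.not_lt_zero _)
    | succ k ih =>
      -- Within the k-skeleton, `true` gives the complement of the barycenters of the k-cells and
      -- `false` the open k-cells; they intersect in the open cells punctured at the barycenter.
      refine LiftsOver.of_cover
        (O := fun i => if i then (C'.slice (center k))ᶜ else {z | C'.dim z < k}ᶜ) ?_ ?_ ?_ ?_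
      · rintro (_ | _)
        · exact (C'.isClosed_dim_lt k).isOpen_compl
        · exact (C'.isClosed_slice isInterior_center).isOpen_compl
      · intro z hz
        by_cases h : C'.dim z < k
        · exact ⟨true, (C'.mem_collar_of_dim_lt h).2⟩
        · exact ⟨false, h⟩
      · rintro (_ | _)
        · have e : ({z | C'.dim z < k + 1} ∩ {z | C'.dim z < k}ᶜ : Set R') =
              C'.q k '' (univ ×ˢ {t | IsInterior t}) := by
            ext z
            rw [← dim_eq_iff, mem_inter_iff, mem_compl_iff, mem_ofPred_eq, mem_ofPred_eq]
            omega
          have := liftsOver_cell hF (hg k) (hne k) (W := {t | IsInterior t}) fun t ht => ht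
          rw [← e] at this
          exact this
        · exact liftsOver_collar hF ih
      · have e : ({z | C'.dim z < k + 1} ∩ (C'.slice (center k))ᶜ ∩ {z | C'.dim z < k}ᶜ : Set R') =
            C'.q k '' (univ ×ˢ {t | IsInterior t ∧ t ≠ center k}) := by
          ext z
          constructor
          · rintro ⟨h1, h2⟩
            obtain ⟨y, h3, h4, h5⟩ := C'.exists_rep_of_mem_collar h1 h2
            exact ⟨y, ⟨mem_univ _, h3, h4⟩, h5⟩
          · rintro ⟨y, ⟨-, h1, h2⟩, rfl⟩
            exact ⟨C'.q_mem_collar h2, fun h => h.ne (C'.dim_q k y h1)⟩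
        have := liftsOver_cell hF (hg k) (hne k) (W := {t | IsInterior t ∧ t ≠ center k})
          fun t ht => ht.1
        rw [← e] at this
        exact this
  intro n a b ha hb _ hab
  -- The image of the ball is compact, hence lies in a skeleton.
  obtain ⟨k, hk⟩ := C'.exists_dim_lt_of_isCompact ((isCompact_closedBall _ _).image_of_continuousOn hb)
  exact (key k n a b ha hb (fun x hx => hk _ (mem_image_of_mem b hx)) hab).mono (subset_univ _)

end CellStructure

open SimplicialSpace

/-! ### Simplicial operators on topological simplices -/

section SimplexMaps

variable {k m n : SimplexCategory}

/-- The affine map of topological simplices induced by a morphism of the simplex category. -/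
def simplexMap (θ : m ⟶ n) (t : TopSimplex m.len) : TopSimplex n.len :=
  stdSimplex.map θ t

theorem continuous_simplexMap (θ : m ⟶ n) : Continuous (simplexMap θ) :=
  stdSimplex.continuous_map θ

theorem simplexMap_id (t : TopSimplex m.len) : simplexMap (𝟙 m) t = t :=
  stdSimplex.map_id_apply t

theorem simplexMap_comp (θ : k ⟶ m) (ψ : m ⟶ n) (t : TopSimplex k.len) :
    simplexMap (θ ≫ ψ) t = simplexMap ψ (simplexMap θ t) :=
  stdSimplex.map_comp_apply θ ψ t |>.symm

theorem simplexMap_apply (θ : m ⟶ n) (t : TopSimplex m.len) (i : Fin (n.len + 1)) :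
    simplexMap θ t i = ∑ j with θ j = i, t j := by
  change FunOnFinite.linearMap ℝ ℝ θ t i = _
  rw [FunOnFinite.linearMap_apply_apply]

theorem simplexMap_pos_iff (θ : m ⟶ n) (t : TopSimplex m.len) (i : Fin (n.len + 1)) :
    0 < simplexMap θ t i ↔ ∃ j, θ j = i ∧ 0 < t j := by
  rw [simplexMap_apply, Finset.sum_pos_iff_of_nonneg fun j _ => stdSimplex.zero_le t j]
  simp

theorem isInterior_simplexMap (θ : m ⟶ n) [Epi θ] {t : TopSimplex m.len} (ht : IsInterior t) :
    IsInterior (simplexMap θ t) := by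
  rw [isInterior_iff] at ht ⊢
  intro i
  obtain ⟨j, hj⟩ := SimplexCategory.epi_iff_surjective.1 ‹Epi θ› i
  exact (simplexMap_pos_iff θ t i).2 ⟨j, hj, ht j⟩

theorem epi_of_isInterior_simplexMap (θ : m ⟶ n) {t : TopSimplex m.len}
    (ht : IsInterior (simplexMap θ t)) : Epi θ := by
  rw [isInterior_iff] at ht
  refine SimplexCategory.epi_iff_surjective.2 fun i => ?_
  obtain ⟨j, hj, -⟩ := (simplexMap_pos_iff θ t i).1 (ht i)
  exact ⟨j, hj⟩

theorem simplexMap_injective (δ : m ⟶ n) [Mono δ] : Function.Injective (simplexMap δ) := by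
  have hδ := SimplexCategory.mono_iff_injective.1 ‹Mono δ›
  have key : ∀ (t : TopSimplex m.len) j, simplexMap δ t (δ j) = t j := by
    intro t j
    rw [simplexMap_apply]
    rw [Finset.sum_eq_single j]
    · intro b hb hbj
      exact absurd (hδ (Finset.mem_filter.1 hb).2) hbj
    · simp
  intro t t' h
  refine stdSimplex.ext (funext fun j => ?_)
  rw [← key t j, h, key t' j]

/-- Every point of a simplex lies in the interior of a face. -/
theorem exists_support (t : TopSimplex k.len) :
    ∃ (m : SimplexCategory) (δ : m ⟶ k) (_ : Mono δ) (s : TopSimplex m.len),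
      IsInterior s ∧ simplexMap δ s = t := by
  set S : Finset (Fin (k.len + 1)) := Finset.univ.filter fun i => 0 < t i with hS
  have hsum : ∑ i ∈ S, t i = 1 := by
    rw [← stdSimplex.sum_eq_one t]
    refine Finset.sum_subset (Finset.subset_univ _) fun i _ hi => ?_
    have : ¬ 0 < t i := fun h => hi (by simp [hS, h])
    exact le_antisymm (not_lt.1 this) (stdSimplex.zero_le t i)
  have hne : S.Nonempty := by
    rw [Finset.nonempty_iff_ne_empty]
    rintro h
    rw [h] at hsum
    simp at hsum
  obtain ⟨r, hr⟩ : ∃ r, S.card = r + 1 := ⟨S.card - 1, by have := hne.card_pos; omega⟩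
  let e := S.orderEmbOfFin hr
  let δ : ⦋r⦌ ⟶ k := SimplexCategory.Hom.mk e.toOrderHom
  have hδ : ∀ j, δ j = e j := fun j => rfl
  have : Mono δ := SimplexCategory.mono_iff_injective.2 e.injective
  have hsum' : ∑ j, t (e j) = 1 := by
    refine (Finset.sum_map Finset.univ e.toEmbedding fun i => t i).symm.trans ?_
    rw [← hsum]
    congr 1
    exact Finset.map_orderEmbOfFin_univ S hr
  refine ⟨⦋r⦌, δ, this, ⟨fun j => t (e j), fun j => stdSimplex.zero_le t _, hsum'⟩, ?_, ?_⟩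
  · rw [isInterior_iff]
    intro j
    exact (Finset.mem_filter.1 (S.orderEmbOfFin_mem hr j)).2
  · refine stdSimplex.ext (funext fun i => ?_)
    change simplexMap δ _ i = t i
    rw [simplexMap_apply]
    by_cases hi : i ∈ S
    · obtain ⟨j, rfl⟩ : ∃ j, e j = i := by
        have : i ∈ Set.range e := by
          rw [Finset.range_orderEmbOfFin]; exact hi
        exact this
      rw [Finset.sum_eq_single j]
      · rfl
      · intro b hb hbj
        exact absurd (e.injective (Finset.mem_filter.1 hb).2) hbj
      · intro h
        exact absurd (Finset.mem_filter.2 ⟨Finset.mem_univ j, hδ j⟩) h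
    · have h0 : t i = 0 :=
        le_antisymm (not_lt.1 fun h => hi (by simp [hS, h])) (stdSimplex.zero_le t i)
      rw [h0]
      refine Finset.sum_eq_zero fun j hj => ?_
      exact absurd ((Finset.mem_filter.1 hj).2 ▸ S.orderEmbOfFin_mem hr j) hi

/-- The face of a simplex whose interior contains a given point is unique. -/
theorem support_unique {m m' : SimplexCategory} (δ : m ⟶ k) (δ' : m' ⟶ k) [Mono δ] [Mono δ']
    {s : TopSimplex m.len} {s' : TopSimplex m'.len} (hs : IsInterior s) (hs' : IsInterior s')
    (h : simplexMap δ s = simplexMap δ' s') :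
    (⟨m, δ, s⟩ : Σ m : SimplexCategory, (m ⟶ k) × TopSimplex m.len) = ⟨m', δ', s'⟩ := by
  have hr : Set.range δ = Set.range δ' := by
    rw [isInterior_iff] at hs hs'
    ext i
    have h1 := simplexMap_pos_iff δ s i
    have h2 := simplexMap_pos_iff δ' s' i
    rw [h] at h1
    constructor
    · rintro ⟨j, hj⟩
      obtain ⟨j', hj', -⟩ := h2.1 (h1.2 ⟨j, hj, hs j⟩)
      exact ⟨j', hj'⟩
    · rintro ⟨j, hj⟩
      obtain ⟨j', hj', -⟩ := h1.1 (h2.2 ⟨j, hj, hs' j⟩)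
      exact ⟨j', hj'⟩
  have hδ : Function.Injective δ := SimplexCategory.mono_iff_injective.1 ‹Mono δ›
  have hδ' : Function.Injective δ' := SimplexCategory.mono_iff_injective.1 ‹Mono δ'›
  have hlen : m = m' := by
    have h1 := Nat.card_range_of_injective hδ
    have h2 := Nat.card_range_of_injective hδ'
    rw [hr, h2] at h1
    simp only [Nat.card_eq_fintype_card, Fintype.card_fin] at h1
    ext
    omega
  subst hlen
  have hδδ : δ = δ' := by
    have h1 : StrictMono δ := δ.toOrderHom.monotone.strictMono_of_injective hδ
    have h2 : StrictMono δ' := δ'.toOrderHom.monotone.strictMono_of_injective hδ'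
    have := (StrictMono.range_inj h1 h2).1 hr
    ext i : 3
    exact congrFun this i
  subst hδδ
  rw [simplexMap_injective δ h]

end SimplexMaps

/-! ### Unique presentation of simplices as degeneracies -/

section Splitting

variable {X : SimplicialObject TopCat.{u}} (s : SimplicialObject.Splitting X)

/-- The space of simplices of a split simplicial space as a disjoint union. -/
def splittingHomeo (Δ : SimplexCategoryᵒᵖ) :
    (Σ A : SimplicialObject.Splitting.IndexSet Δ, s.N A.1.unop.len) ≃ₜ X.obj Δ :=
  TopCat.homeoOfIso (Limits.IsColimit.coconePointUniqueUpToIso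
    (TopCat.sigmaCofanIsColimit.{0, u} (SimplicialObject.Splitting.summand s.N Δ))
    (s.isColimit Δ))

theorem splittingHomeo_apply (Δ : SimplexCategoryᵒᵖ)
    (A : SimplicialObject.Splitting.IndexSet Δ) (y : s.N A.1.unop.len) :
    splittingHomeo s Δ ⟨A, y⟩ = X.map A.e.op (s.ι _ y) := by
  have := Limits.IsColimit.comp_coconePointUniqueUpToIso_hom
    (TopCat.sigmaCofanIsColimit.{0, u} (SimplicialObject.Splitting.summand s.N Δ))
    (s.isColimit Δ) ⟨A⟩
  exact ConcreteCategory.congr_hom this y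

theorem exists_degeneracy (m : SimplexCategory) (x : X.obj (op m)) :
    ∃ (n : ℕ) (σ : m ⟶ ⦋n⦌) (_ : Epi σ) (y : s.N n), X.map σ.op (s.ι n y) = x := by
  obtain ⟨⟨A, y⟩, rfl⟩ := (splittingHomeo s (op m)).surjective x
  exact ⟨A.1.unop.len, A.e, inferInstance, y, (splittingHomeo_apply s _ A y).symm⟩

/-- The Eilenberg–Zilber uniqueness is here the injectivity of the coproduct decomposition. The
conclusion is an equality of dependent tuples so that dimension, operator and simplex can be
identified at once. -/
theorem degeneracy_unique {m : SimplexCategory} {n n' : ℕ} (σ : m ⟶ ⦋n⦌) (σ' : m ⟶ ⦋n'⦌)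
    [Epi σ] [Epi σ'] {y : s.N n} {y' : s.N n'}
    (h : X.map σ.op (s.ι n y) = X.map σ'.op (s.ι n' y')) :
    (⟨n, σ, y⟩ : Σ n : ℕ, (m ⟶ ⦋n⦌) × s.N n) = ⟨n', σ', y'⟩ := by
  have h1 := splittingHomeo_apply s (op m) (SimplicialObject.Splitting.IndexSet.mk σ) y
  have h2 := splittingHomeo_apply s (op m) (SimplicialObject.Splitting.IndexSet.mk σ') y'
  have h3 := (splittingHomeo s (op m)).injective ((h1.trans h).trans h2.symm)
  let Φ : (Σ A : SimplicialObject.Splitting.IndexSet (op m), s.N A.1.unop.len) →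
    Σ n : ℕ, (m ⟶ ⦋n⦌) × s.N n := fun p => ⟨p.1.1.unop.len, p.1.e, p.2⟩
  exact congrArg Φ h3

end Splitting

theorem epi_of_mono_of_len_eq {m n : SimplexCategory} (δ : m ⟶ n) [Mono δ]
    (h : m.len = n.len) : Epi δ := by
  refine SimplexCategory.epi_iff_surjective.2 ?_
  have := SimplexCategory.mono_iff_injective.1 ‹Mono δ›
  exact ((Fintype.bijective_iff_injective_and_card _).2 ⟨this, by simp [h]⟩).2

/-! ### Normal forms of points of the realization -/

section NormalForm

variable {X : SimplicialObject TopCat.{u}} (s : SimplicialObject.Splitting X)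

theorem map_comp_op_apply {k m n : SimplexCategory} (θ : k ⟶ m) (ψ : m ⟶ n) (x : X.obj (op n)) :
    X.map (θ ≫ ψ).op x = X.map θ.op (X.map ψ.op x) := by
  rw [op_comp, X.map_comp, TopCat.comp_app]

theorem map_id_op_apply {n : SimplexCategory} (x : X.obj (op n)) : X.map (𝟙 n).op x = x := by
  rw [op_id, X.map_id, TopCat.id_app]

/-- The class of a simplex and a point of the standard simplex in the realization. -/
def realizationMk (n : SimplexCategory) (x : X.obj (op n)) (t : TopSimplex n.len) :
    Realization X :=
  Quot.mk _ (⟨n, x, t⟩ : PreRealization X)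

theorem realizationMk_map {m n : SimplexCategory} (θ : m ⟶ n) (x : X.obj (op n))
    (t : TopSimplex m.len) :
    realizationMk m (X.map θ.op x) t = realizationMk n x (simplexMap θ t) :=
  Quot.sound (GlueRel.mk θ x t)

/-- The nondegenerate simplex `z.2.1` and the point `z.2.2` represent the same point of the
realization as `p`, as witnessed by a face operator followed by a degeneracy. -/
def IsNormalForm (p : PreRealization X) (z : Σ n : ℕ, s.N n × TopSimplex n) : Prop :=
  ∃ (m : SimplexCategory) (δ : m ⟶ p.1) (_ : Mono δ) (σ : m ⟶ ⦋z.1⦌) (_ : Epi σ)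
    (r : TopSimplex m.len), IsInterior r ∧ simplexMap δ r = p.2.2 ∧
      X.map δ.op p.2.1 = X.map σ.op (s.ι _ z.2.1) ∧ simplexMap σ r = z.2.2

variable {s}

theorem IsNormalForm.isInterior {p : PreRealization X} {z : Σ n : ℕ, s.N n × TopSimplex n}
    (h : IsNormalForm s p z) : IsInterior z.2.2 := by
  obtain ⟨m, δ, _, σ, _, r, hr, -, -, h4⟩ := h
  rw [← h4]
  exact isInterior_simplexMap σ hr

theorem IsNormalForm.realizationMk_eq {p : PreRealization X}
    {z : Σ n : ℕ, s.N n × TopSimplex n} (h : IsNormalForm s p z) :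
    realizationMk ⦋z.1⦌ (s.ι _ z.2.1) z.2.2 = Quot.mk _ p := by
  obtain ⟨n, x, t⟩ := p
  obtain ⟨m, δ, _, σ, _, r, hr, h2, h3, h4⟩ := h
  rw [← h4, ← realizationMk_map, ← h3, realizationMk_map, h2]
  rfl

/-- A boundary point is supported on a proper face, and the degeneracy that follows cannot raise the
dimension. -/
theorem IsNormalForm.lt {p : PreRealization X} {z : Σ n : ℕ, s.N n × TopSimplex n}
    (h : IsNormalForm s p z) (hp : ¬ IsInterior (n := p.1.len) p.2.2) : z.1 < p.1.len := by
  obtain ⟨m, δ, _, σ, _, r, hr, h2, -, -⟩ := h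
  have h1 : z.1 ≤ m.len := SimplexCategory.len_le_of_epi σ
  refine lt_of_le_of_lt h1 (lt_of_le_of_ne (SimplexCategory.len_le_of_mono δ) fun he => hp ?_)
  have := epi_of_mono_of_len_eq δ he
  rw [← h2]
  exact isInterior_simplexMap δ hr

theorem IsNormalForm.unique {p : PreRealization X} {z z' : Σ n : ℕ, s.N n × TopSimplex n}
    (h : IsNormalForm s p z) (h' : IsNormalForm s p z') : z = z' := by
  obtain ⟨n, y, t⟩ := z
  obtain ⟨n', y', t'⟩ := z'
  obtain ⟨m, δ, _, σ, _, r, hr, h2, h3, h4⟩ := h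
  obtain ⟨m', δ', _, σ', _, r', hr', h2', h3', h4'⟩ := h'
  cases support_unique δ δ' hr hr' (h2.trans h2'.symm)
  cases degeneracy_unique s σ σ' (h3.symm.trans h3')
  have ht : t = t' := h4.symm.trans h4'
  rw [ht]

theorem isNormalForm_self {n : ℕ} (y : s.N n) {t : TopSimplex n} (ht : IsInterior t) :
    IsNormalForm s ⟨⦋n⦌, s.ι n y, t⟩ ⟨n, y, t⟩ :=
  ⟨⦋n⦌, 𝟙 _, inferInstance, 𝟙 _, inferInstance, t, ht, simplexMap_id (m := ⦋n⦌) t, rfl,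
    simplexMap_id (m := ⦋n⦌) t⟩

variable (s) in
theorem exists_isNormalForm (p : PreRealization X) : ∃ z, IsNormalForm s p z := by
  obtain ⟨m, δ, hδ, r, hr, h⟩ := exists_support (k := p.1) p.2.2
  obtain ⟨n, σ, hσ, y, hy⟩ := exists_degeneracy s m (X.map δ.op p.2.1)
  exact ⟨⟨n, y, simplexMap σ r⟩, m, δ, hδ, σ, hσ, r, hr, h, hy.symm, rfl⟩

/-- Restrict θ to the face supporting t and factor the result as a surjection followed by an
injection. The surjection keeps points interior, so by uniqueness of supports the injection is the
face in the normal form of p'; the surjection is absorbed into the degeneracy. With uniqueness of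
normal forms, this one direction suffices. -/
theorem IsNormalForm.of_glueRel {p p' : PreRealization X} (h : GlueRel X p p')
    {z : Σ n : ℕ, s.N n × TopSimplex n} (hz : IsNormalForm s p' z) : IsNormalForm s p z := by
  obtain @⟨m, n, θ, x, t⟩ := h
  obtain ⟨c', δ', _, σ', _, r', hr', h2, h3, h4⟩ := hz
  obtain ⟨c, δ, hδ, r, hr, h⟩ := exists_support (k := m) t
  obtain ⟨I, e, i, he, hi, fac⟩ : ∃ (I : SimplexCategory) (e : c ⟶ I) (i : I ⟶ n),
      Epi e ∧ Mono i ∧ e ≫ i = δ ≫ θ :=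
    ⟨_, Limits.factorThruImage (δ ≫ θ), Limits.image.ι (δ ≫ θ), inferInstance, inferInstance,
      Limits.image.fac _⟩
  have key : simplexMap i (simplexMap e r) = simplexMap δ' r' := by
    rw [← simplexMap_comp, fac, simplexMap_comp, h, h2]
    rfl
  cases support_unique i δ' (isInterior_simplexMap e hr) hr' key
  refine ⟨c, δ, hδ, e ≫ σ', epi_comp _ _, r, hr, h, ?_, ?_⟩
  · change X.map δ.op (X.map θ.op x) = _
    rw [← map_comp_op_apply, ← fac, map_comp_op_apply, map_comp_op_apply]
    exact congrArg _ h3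
  · rw [simplexMap_comp]
    exact h4

variable (s) in
/-- The normal form of a point of the realization of a split simplicial space. -/
def normalForm : Realization X → Σ n : ℕ, s.N n × TopSimplex n :=
  Quot.lift (fun p => (exists_isNormalForm s p).choose) fun p p' h =>
    (exists_isNormalForm s p).choose_spec.unique
      ((exists_isNormalForm s p').choose_spec.of_glueRel h)

theorem isNormalForm_normalForm (p : PreRealization X) :
    IsNormalForm s p (normalForm s (Quot.mk _ p)) :=
  (exists_isNormalForm s p).choose_spec

theorem IsNormalForm.eq {p : PreRealization X} {z : Σ n : ℕ, s.N n × TopSimplex n}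
    (h : IsNormalForm s p z) : normalForm s (Quot.mk _ p) = z :=
  (isNormalForm_normalForm p).unique h

end NormalForm

/-! ### The cell structure of the realization -/

section Cells

variable {X : SimplicialObject TopCat.{u}} (s : SimplicialObject.Splitting X)

theorem continuous_realizationMk (n : SimplexCategory) :
    Continuous fun p : X.obj (op n) × TopSimplex n.len => realizationMk n p.1 p.2 :=
  continuous_quot_mk.comp
    (continuous_sigmaMk (σ := fun n : SimplexCategory =>
      X.obj (op n) × SimplexCategory.toTop₀.obj n) (i := n))

/-- The characteristic map of the cells of dimension `n`. -/
def cellMap (n : ℕ) (y : s.N n × TopSimplex n) : Realization X :=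
  realizationMk ⦋n⦌ (s.ι n y.1) y.2

theorem continuous_cellMap (n : ℕ) : Continuous (cellMap s n) :=
  (continuous_realizationMk ⦋n⦌).comp
    (((s.ι n).hom.continuous.comp continuous_fst).prodMk continuous_snd)

/-- A set which is closed in the cells of dimension at most `n` is closed in `X_n × Δⁿ`. -/
theorem isClosed_realizationMk_preimage {K : Set (Realization X)} (Δ : SimplexCategory)
    (hK : ∀ n ≤ Δ.len, IsClosed (cellMap s n ⁻¹' K)) :
    IsClosed ({p | realizationMk Δ p.1 p.2 ∈ K} : Set (X.obj (op Δ) × TopSimplex Δ.len)) := by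
  have hcl : ∀ A : SimplicialObject.Splitting.IndexSet (op Δ),
      IsClosed ((Prod.map (fun y => splittingHomeo s (op Δ) ⟨A, y⟩) id :
        s.N A.1.unop.len × TopSimplex Δ.len → X.obj (op Δ) × TopSimplex Δ.len) ''
        ({y | cellMap s A.1.unop.len (y.1, simplexMap A.e y.2) ∈ K})) := by
    intro A
    have he : IsClosedEmbedding fun y => splittingHomeo s (op Δ) ⟨A, y⟩ :=
      (splittingHomeo s (op Δ)).isClosedEmbedding.comp .sigmaMk
    refine (he.prodMap IsClosedEmbedding.id).isClosedMap _ ?_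
    refine (hK A.1.unop.len (SimplexCategory.len_le_of_epi A.e)).preimage
      (f := fun y : s.N A.1.unop.len × TopSimplex Δ.len => (y.1, simplexMap A.e y.2)) ?_
    exact continuous_fst.prodMk ((continuous_simplexMap A.e).comp continuous_snd)
  -- X_k × Δᵏ is a union of closed pieces, one for each of the finitely many surjections out of [k];
  -- on such a piece the map to the realization factors through a cell of dimension at most k.
  convert isClosed_iUnion_of_finite hcl using 1
  ext ⟨x, t⟩
  simp only [mem_iUnion]
  have hmk : ∀ (A : SimplicialObject.Splitting.IndexSet (op Δ)) (y : s.N A.1.unop.len)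
      (t : TopSimplex Δ.len), realizationMk Δ (splittingHomeo s (op Δ) ⟨A, y⟩) t =
        cellMap s A.1.unop.len (y, simplexMap A.e t) := by
    intro A y t
    rw [splittingHomeo_apply]
    exact realizationMk_map A.e _ t
  constructor
  · intro h
    obtain ⟨⟨A, y⟩, rfl⟩ := (splittingHomeo s (op Δ)).surjective x
    refine ⟨A, (y, t), ?_, rfl⟩
    change cellMap s _ _ ∈ K
    rw [← hmk]
    exact h
  · rintro ⟨A, ⟨y, t'⟩, h, h'⟩
    cases h'
    change realizationMk Δ (splittingHomeo s (op Δ) ⟨A, y⟩) t' ∈ K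
    rw [hmk]
    exact h

theorem isClosed_of_cellMap {K : Set (Realization X)}
    (hK : ∀ n, IsClosed (cellMap s n ⁻¹' K)) : IsClosed K := by
  refine isQuotientMap_quot_mk.isClosed_preimage.1 ?_
  refine isClosed_sigma_iff.2 fun Δ => ?_
  exact isClosed_realizationMk_preimage s Δ fun n _ => hK n

/-- The boundary of Δⁿ is the union of the images of the finitely many operators from lower
simplices. On each of those simplices the preimage of K involves only cells of dimension below n. -/
theorem isClosed_cell_boundary (n : ℕ) {K : Set (Realization X)}
    (hK : ∀ m < n, IsClosed (cellMap s m ⁻¹' K)) :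
    IsClosed (cellMap s n ⁻¹' K ∩ {y | ¬ IsInterior y.2}) := by
  have hcl : ∀ (m : Fin n) (θ : ⦋(m : ℕ)⦌ ⟶ ⦋n⦌),
      IsClosed ((Prod.map id (simplexMap θ) : s.N n × TopSimplex m → s.N n × TopSimplex n) ''
        ({y | realizationMk ⦋(m : ℕ)⦌ (X.map θ.op (s.ι n y.1)) y.2 ∈ K})) := by
    intro m θ
    -- A map from a compact simplex to a Hausdorff one is proper, so its product with the arbitrary
    -- space N_n is still a closed map.
    have hp : IsProperMap (simplexMap θ) := (continuous_simplexMap θ).isProperMap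
    refine (isProperMap_id.prodMap hp).isClosedMap _ ?_
    refine (isClosed_realizationMk_preimage s ⦋(m : ℕ)⦌ fun k hk =>
      hK k (lt_of_le_of_lt hk m.2)).preimage
      (f := fun y : s.N n × TopSimplex m => (X.map θ.op (s.ι n y.1), y.2)) ?_
    exact ((X.map θ.op).hom.continuous.comp
      ((s.ι n).hom.continuous.comp continuous_fst)).prodMk continuous_snd
  convert isClosed_iUnion_of_finite fun m => isClosed_iUnion_of_finite (hcl m) using 1
  ext ⟨y, t⟩
  simp only [mem_iUnion]
  constructor
  · rintro ⟨h, ht⟩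
    obtain ⟨c, δ, hδ, r, hr, rfl⟩ := exists_support (k := ⦋n⦌) t
    have hlt : c.len < n := by
      refine lt_of_le_of_ne (SimplexCategory.len_le_of_mono δ) fun he => ht ?_
      have := epi_of_mono_of_len_eq δ he
      exact isInterior_simplexMap δ hr
    refine ⟨⟨c.len, hlt⟩, δ, (y, r), ?_, rfl⟩
    change realizationMk _ (X.map δ.op (s.ι n y)) r ∈ K
    rw [realizationMk_map]
    exact h
  · rintro ⟨m, θ, ⟨y', r⟩, h, h'⟩
    cases h'
    refine ⟨?_, fun hint => ?_⟩
    · change realizationMk ⦋n⦌ (s.ι n y') (simplexMap θ r) ∈ K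
      rw [← realizationMk_map]
      exact h
    · have := epi_of_isInterior_simplexMap θ hint
      exact absurd (SimplexCategory.len_le_of_epi θ) (not_le.2 m.2)

/-- The cells of the realization of a split simplicial space. -/
def realizationCells : CellStructure (Realization X) where
  N := s.N
  q := cellMap s
  continuous_q := continuous_cellMap s
  dim z := (normalForm s z).1
  exists_rep z := by
    obtain ⟨p, rfl⟩ := Quot.exists_rep z
    have h := isNormalForm_normalForm (s := s) p
    exact ⟨_, h.isInterior, h.realizationMk_eq⟩
  dim_q n y hy := by
    rw [cellMap, realizationMk, (isNormalForm_self y.1 hy).eq]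
  dim_q_lt n y hy := (isNormalForm_normalForm (s := s) ⟨⦋n⦌, s.ι n y.1, y.2⟩).lt hy
  q_inj n y y' hy hy' h := by
    have h' := congrArg (normalForm s) h
    rw [cellMap, cellMap, realizationMk, realizationMk, (isNormalForm_self y.1 hy).eq,
      (isNormalForm_self y'.1 hy').eq] at h'
    exact eq_of_heq (Sigma.mk.inj_iff.1 h').2
  isClosed_of_preimage _ := isClosed_of_cellMap s
  isClosed_boundary n _ := isClosed_cell_boundary s n

end Cells

theorem mem_of_joined_of_isClopen {X : Type*} [TopologicalSpace X] {U : Set X} (hU : IsClopen U)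
    {x x' : X} (h : Joined x x') (hx : x ∈ U) : x' ∈ U := by
  obtain ⟨γ⟩ := h
  have := (isPreconnected_range γ.continuous).subset_isClopen hU ⟨x, ⟨0, γ.source⟩, hx⟩
  exact this ⟨1, γ.target⟩

/-- The lifting property passes to a clopen subspace of the target and its preimage. -/
theorem LiftsOver.restrict {X Y A B : Type*} [TopologicalSpace X] [TopologicalSpace Y]
    [TopologicalSpace A] [TopologicalSpace B] {p : X → Y} (h : LiftsOver p univ) {g : A → B}
    {i : A → X} {j : B → Y} (hi : IsEmbedding i) (hj : IsEmbedding j) (hr : IsClopen (range j))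
    (hg : ∀ y, j (g y) = p (i y)) (hp : ∀ x, p x ∈ range j → x ∈ range i) :
    LiftsOver g univ := by
  intro n a b ha hb _ hab
  have : Nonempty A := ⟨a 0⟩
  have : Nonempty B := ⟨b 0⟩
  obtain ⟨a', H, ha', ha'a, hH, -, hH0, hH1, hHs⟩ := h n (i ∘ a) (j ∘ b)
    (hi.continuous.comp_continuousOn ha) (hj.continuous.comp_continuousOn hb) (mapsTo_univ _ _)
    fun x hx => ((hg _).symm.trans (congrArg j (hab hx)))
  have hmem : ∀ z ∈ closedBall (0 : Fin n → ℝ) 1 ×ˢ Icc (0 : ℝ) 1, H z ∈ range j := by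
    rintro ⟨x, t⟩ ⟨hx, ht⟩
    -- Each track of the homotopy is connected and ends in the clopen range of j, so it never leaves
    -- that range.
    have hc : IsPreconnected ((fun t => H (x, t)) '' Icc (0 : ℝ) 1) :=
      isPreconnected_Icc.image _ (hH.comp (by fun_prop) fun t ht => ⟨hx, ht⟩)
    refine hc.subset_isClopen hr ⟨H (x, 1), ⟨1, by simp, rfl⟩, ?_⟩ ⟨t, ht, rfl⟩
    rw [hH1 x hx]
    exact ⟨_, rfl⟩
  have hamem : ∀ x ∈ closedBall (0 : Fin n → ℝ) 1, a' x ∈ range i := by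
    intro x hx
    refine hp _ ?_
    rw [← hH0 x hx]
    exact hmem _ ⟨hx, by simp⟩
  have hia : ∀ x ∈ closedBall (0 : Fin n → ℝ) 1, i (Function.invFun i (a' x)) = a' x :=
    fun x hx => Function.invFun_eq (hamem x hx)
  have hjH : ∀ z ∈ closedBall (0 : Fin n → ℝ) 1 ×ˢ Icc (0 : ℝ) 1,
      j (Function.invFun j (H z)) = H z := fun z hz => Function.invFun_eq (hmem z hz)
  refine ⟨fun x => Function.invFun i (a' x), fun z => Function.invFun j (H z), ?_, ?_, ?_,
    mapsTo_univ _ _, ?_, ?_, ?_⟩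
  · exact hi.continuousOn_iff.2 (ha'.congr hia)
  · intro x hx
    refine hi.injective ((hia x (sphere_subset_closedBall hx)).trans (ha'a hx))
  · exact hj.continuousOn_iff.2 (hH.congr hjH)
  · intro x hx
    refine hj.injective ((hjH _ ⟨hx, by simp⟩).trans ?_)
    rw [hg, hia x hx, hH0 x hx]
  · intro x hx
    exact hj.injective ((hjH _ ⟨hx, by simp⟩).trans (hH1 x hx))
  · intro x hx t ht
    exact hj.injective ((hjH _ ⟨sphere_subset_closedBall hx, ht⟩).trans (hHs x hx t ht))

/-! ### Nondegenerate simplices under a levelwise weak equivalence -/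

section Nondegenerate

variable {X Y : SimplicialObject TopCat.{u}} (s : SimplicialObject.Splitting X)
  (s' : SimplicialObject.Splitting Y)

theorem isClosedEmbedding_ι (n : ℕ) : IsClosedEmbedding (s.ι n) ∧ IsClopen (range (s.ι n)) := by
  let A := SimplicialObject.Splitting.IndexSet.id (op ⦋n⦌)
  have h : ⇑(s.ι n) = splittingHomeo s (op ⦋n⦌) ∘ Sigma.mk A := by
    ext y
    refine Eq.symm ((splittingHomeo_apply s (op ⦋n⦌) A y).trans ?_)
    exact map_id_op_apply (X := X) (n := ⦋n⦌) (s.ι n y)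
  have hc : IsClosedEmbedding (s.ι n) := by
    rw [h]
    exact (splittingHomeo s (op ⦋n⦌)).isClosedEmbedding.comp .sigmaMk
  refine ⟨hc, hc.isClosed_range, ?_⟩
  rw [h]
  exact ((splittingHomeo s (op ⦋n⦌)).isOpenEmbedding.comp .sigmaMk).isOpen_range

/-- The distinguished summand in degree `n` consists of the nondegenerate simplices. -/
theorem mem_range_ι_iff {n : ℕ} {x : X.obj (op ⦋n⦌)} :
    x ∈ range (s.ι n) ↔
      ∀ (k : ℕ) (σ : ⦋n⦌ ⟶ ⦋k⦌) (x' : X.obj (op ⦋k⦌)), Epi σ → X.map σ.op x' = x → n ≤ k := by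
  constructor
  · rintro ⟨y, rfl⟩ k σ x' hσ h
    obtain ⟨l, τ, hτ, y', rfl⟩ := exists_degeneracy s ⦋k⦌ x'
    rw [← map_comp_op_apply] at h
    have := epi_comp σ τ
    have hid := degeneracy_unique s (σ ≫ τ) (𝟙 ⦋n⦌) (h.trans (map_id_op_apply _).symm)
    have hl : l = n := congrArg Sigma.fst hid
    have hle : l ≤ k := SimplexCategory.len_le_of_epi τ
    exact hl ▸ hle
  · intro h
    obtain ⟨k, σ, hσ, y, rfl⟩ := exists_degeneracy s ⦋n⦌ x
    have h1 : n ≤ k := h k σ _ hσ rfl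
    have h2 : k ≤ n := SimplexCategory.len_le_of_epi σ
    obtain rfl := le_antisymm h1 h2
    rw [SimplexCategory.eq_id_of_epi σ]
    exact ⟨y, (map_id_op_apply _).symm⟩

variable {s s'} (f : X ⟶ Y)

/-- A simplicial map sends degenerate simplices to degenerate ones. -/
theorem mem_range_ι_of_map {n : ℕ} {x : X.obj (op ⦋n⦌)}
    (h : f.app (op ⦋n⦌) x ∈ range (s'.ι n)) : x ∈ range (s.ι n) := by
  rw [mem_range_ι_iff] at h ⊢
  rintro k σ x' hσ rfl
  exact h k σ (f.app _ x') hσ (NatTrans.naturality_apply f σ.op x').symm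

/-- Suppose f x = σ^* y, and let d be a section of σ. Then x and σ^* d^* x have the same image, so
they lie in one path component of X_n. The nondegenerate simplices form a clopen set, so σ^* d^* x
is nondegenerate along with x, and σ cannot lower the dimension. -/
theorem map_mem_range_ι {n : ℕ} {x : X.obj (op ⦋n⦌)}
    (hf : WeakEquiv.IsWeakEquivalence (f.app (op ⦋n⦌)).hom) (hx : x ∈ range (s.ι n)) :
    f.app (op ⦋n⦌) x ∈ range (s'.ι n) := by
  rw [mem_range_ι_iff]
  intro k σ y hσ h
  have := isSplitEpi_of_epi σ
  have hfx : f.app (op ⦋n⦌) (X.map σ.op (X.map (section_ σ).op x)) = f.app (op ⦋n⦌) x := by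
    have h1 := NatTrans.naturality_apply f σ.op (X.map (section_ σ).op x)
    have h2 := NatTrans.naturality_apply f (section_ σ).op x
    rw [h1, h2, ← h, ← map_comp_op_apply (section_ σ) σ, IsSplitEpi.id, map_id_op_apply]
  have hj : Joined x (X.map σ.op (X.map (section_ σ).op x)) :=
    joined_of_joined_map hf (hfx ▸ Joined.refl _)
  have hmem := mem_of_joined_of_isClopen (isClosedEmbedding_ι s n).2 hj hx
  exact (mem_range_ι_iff s).1 hmem k σ _ hσ rfl

/-- By surjectivity on path components some f x is joined to a nondegenerate simplex. It is then
nondegenerate itself, and so is x. -/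
theorem nonempty_of_nonempty_target {n : ℕ}
    (hf : WeakEquiv.IsWeakEquivalence (f.app (op ⦋n⦌)).hom) (h : Nonempty (s'.N n)) :
    Nonempty (s.N n) := by
  obtain ⟨y⟩ := h
  obtain ⟨x, hx⟩ := exists_joined_map hf (s'.ι n y)
  obtain ⟨z, -⟩ := mem_range_ι_of_map (s := s) f
    (mem_of_joined_of_isClopen (isClosedEmbedding_ι s' n).2 hx.symm ⟨y, rfl⟩)
  exact ⟨z⟩

end Nondegenerate

/-! ### Conclusion for geometric realizations -/

/-- A levelwise weak equivalence between split simplicial spaces has the lifting property on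
realizations. -/
theorem liftsOver_realizationMap {X Y : SimplicialObject TopCat.{u}}
    (s : SimplicialObject.Splitting X) (s' : SimplicialObject.Splitting Y) (f : X ⟶ Y)
    (hf : ∀ n : ℕ, WeakEquiv.IsWeakEquivalence (f.app (op ⦋n⦌)).hom) :
    LiftsOver (realizationMap f) univ := by
  choose g hg using fun (n : ℕ) (y : s.N n) =>
    map_mem_range_ι (s := s) (s' := s') f (hf n) ⟨y, rfl⟩
  refine CellStructure.liftsOver_univ (C := realizationCells s) (C' := realizationCells s')
    (g := g) ?_ ?_ fun n => nonempty_of_nonempty_target f (hf n)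
  · exact fun n x t => congrArg (fun z => realizationMk ⦋n⦌ z t) (hg n x).symm
  · intro n
    -- The nondegenerate part of X_n is exactly the preimage of the clopen nondegenerate part of
    -- Y_n, so the lifting property of f_n restricts to it.
    exact (hf n).liftsOver.restrict (isClosedEmbedding_ι s n).1.isEmbedding
      (isClosedEmbedding_ι s' n).1.isEmbedding (isClosedEmbedding_ι s' n).2 (hg n)
      fun x => mem_range_ι_of_map f

theorem nonempty_realization {X Y : SimplicialObject TopCat.{u}}
    (s : SimplicialObject.Splitting X) (s' : SimplicialObject.Splitting Y) (f : X ⟶ Y)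
    (hf : ∀ n : ℕ, WeakEquiv.IsWeakEquivalence (f.app (op ⦋n⦌)).hom)
    (h : Nonempty (Realization Y)) : Nonempty (Realization X) := by
  obtain ⟨z⟩ := h
  obtain ⟨y, -⟩ := (realizationCells s').exists_rep z
  obtain ⟨x⟩ := nonempty_of_nonempty_target (s := s) (s' := s') f (hf _) ⟨y.1⟩
  exact ⟨cellMap s _ (x, y.2)⟩

end DiskLifting

theorem mainTheorem5 (X Y : SimplicialObject TopCat.{u})
    (hX : SimplicialSpace.HasFreeDegeneracies X) (hY : SimplicialSpace.HasFreeDegeneracies Y)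
    (f : X ⟶ Y)
    (hf : ∀ n : ℕ, WeakEquiv.IsWeakEquivalence (f.app (op ⦋n⦌)).hom) :
    WeakEquiv.IsWeakEquivalence (SimplicialSpace.realizationMap f) := by
  obtain ⟨s⟩ := hX
  obtain ⟨s'⟩ := hY
  exact (DiskLifting.liftsOver_realizationMap s s' f hf).isWeakEquivalence
    (DiskLifting.nonempty_realization s s' f hf)

end
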